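/- **Setting.** Let $n\ge 2$, and let $z=(z_1,\dots,z_n)\in\mathbb C^n$ satisfy $z_a-z_b\notin\mathbb Z$ for all $a\ne b$. Let $$H_z=\mathbb C[x]\Big/\Big\langle\prod_{a=1}^n(x-z_a)\Big\rangle$$ be the $T^n$-equivariant cohomology algebra of $P^{n-1}$ with equivariant parameters specialized to $z$. Let $y_1,\dots,y_{n-1}$ be the equivariant Chern roots of the quotient bundle with fiber $\mathbb C^n/F$ over the line $F$; their symmetric functions are the elements of $H_z$ determined by $$(u-x)\prod_{j=1}^{n-1}(u-y_j)=\prod_{a=1}^n(u-z_a).$$ For $p\ne0$ with a chosen argument, and for $J=1,\dots,n$ and $m\in\mathbb Z$, put $$\Phi(t,p,z)=\bigl(e^{\pi i(2-n)}p\bigr)^t\prod_{a=1}^n\Gamma(z_a-t),\qquad W(t,y)=\prod_{j=1}^{n-1}(y_j-t),$$ $$\Psi_J(p,y,z)=-\sum_{k=0}^\infty\operatorname{Res}_{t=z_J+k}\bigl(\Phi(t,p,z)\,W(t,y)\bigr),\qquad \Psi^m(p,y,z)=\sum_{J=1}^n e^{2\pi i(m-1)z_J}\,\Psi_J(p,y,z),$$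 which are $H_z$-valued functions. **Lemma.** Let $m\in\mathbb Z$ and $\phi\in\mathbb R$ satisfy $\frac mn-1<\phi<\frac mn$. Put $s=re^{-2\pi i\phi}$ with $r>0$, $\omega=e^{2\pi i/n}$ and $p=s^n$, where $\arg p=-2\pi n\phi$. Then, as $r\to\infty$, $$\Psi^m(s^n,y,z)=\frac{(2\pi)^{(n-1)/2}}{\sqrt n}\;e^{n\omega^m s}\,(-\omega^m s)^{\sum_{a=1}^n z_a+(1-n)/2}\,\prod_{j=1}^{n-1}(y_j-\omega^m s)\,\bigl(1+\mathcal O(1/s)\bigr),$$ where the power of $-\omega^m s$ is taken with $\arg(-\omega^m s)=2\pi m/n-\pi-2\pi\phi$, so that $|\arg(-\omega^m s)|<\pi$. Here $\mathcal O(1/s)$ is an $H_z$-valued function of $r$ whose norm, in any fixed norm on the finite-dimensional space $H_z$, is at most a constant times $1/r$ for all large $r$. -/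

import Mathlib

open Polynomial Asymptotics Filter Topology

noncomputable section

namespace QuantumPn

/-- The residue at `c` of a function `f` with values in a normed space: the limit of
`(2πi)⁻¹ ∮ f(t) dt` over the positively oriented circles of radius `ε → 0+` around `c`. For `f`
holomorphic in a punctured neighbourhood of `c` the integral does not depend on small `ε`. -/
def residue {E : Type*} [NormedAddCommGroup E] [NormedSpace ℂ E] (f : ℂ → E) (c : ℂ) : E :=
  limUnder (𝓝[>] (0 : ℝ)) fun ε : ℝ =>
    (2 * (Real.pi : ℂ) * Complex.I)⁻¹ • ∮ t in C(c, ε), f t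

/-- The polynomial `∏_a (u - z_a)`. -/
def weightPoly {n : ℕ} (z : Fin n → ℂ) : ℂ[X] := ∏ a, (X - C (z a))

lemma weightPoly_monic {n : ℕ} (z : Fin n → ℂ) : (weightPoly z).Monic :=
  monic_prod_of_monic _ _ fun a _ => monic_X_sub_C (z a)

/-- The equivariant cohomology algebra `ℂ[x] / ⟨∏_a (x - z_a)⟩` of `P^{n-1}` with the equivariant
parameters specialized to the complex numbers `z_1, …, z_n`. -/
def EqCohomology {n : ℕ} (z : Fin n → ℂ) : Type := AdjoinRoot (weightPoly z)

namespace EqCohomology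

variable {n : ℕ} (z : Fin n → ℂ)

instance : CommRing (EqCohomology z) := inferInstanceAs (CommRing (AdjoinRoot (weightPoly z)))

instance : Algebra ℂ (EqCohomology z) :=
  inferInstanceAs (Algebra ℂ (AdjoinRoot (weightPoly z)))

/-- The basis `1, x, …, x^{n-1}` of the algebra over `ℂ`. -/
def basis : Module.Basis (Fin (weightPoly z).natDegree) ℂ (EqCohomology z) :=
  (AdjoinRoot.powerBasis' (weightPoly_monic z)).basis

/-- The maximum norm of the coordinates in the basis `1, x, …, x^{n-1}`. The algebra has finite
dimension over `ℂ`, so every other norm on this vector space is equivalent to it. -/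
instance : NormedAddCommGroup (EqCohomology z) :=
  NormedAddCommGroup.induced (EqCohomology z) (Fin (weightPoly z).natDegree → ℂ)
    (basis z).equivFun (basis z).equivFun.injective

instance : NormedSpace ℂ (EqCohomology z) :=
  NormedSpace.induced ℂ (EqCohomology z) (Fin (weightPoly z).natDegree → ℂ) (basis z).equivFun

/-- The equivariant first Chern class `x` of the tautological line bundle. -/
def x : EqCohomology z := AdjoinRoot.root (weightPoly z)

/-- The polynomial `∏_j (u - y_j)` in `u`, where `y_1, …, y_{n-1}` are the equivariant Chern roots
of the quotient bundle with fibre `ℂⁿ / F`. Its coefficients, the symmetric functions of the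
`y_j`, lie in the algebra; they are given by the relation
`(u - x) ∏_j (u - y_j) = ∏_a (u - z_a)`. -/
def chernRootPoly : (EqCohomology z)[X] :=
  (weightPoly z).map (algebraMap ℂ (EqCohomology z)) /ₘ (X - C (x z))

/-- The defining relation `(u - x) ∏_j (u - y_j) = ∏_a (u - z_a)` of the Chern roots. -/
lemma X_sub_C_x_mul_chernRootPoly :
    (X - C (x z)) * chernRootPoly z = (weightPoly z).map (algebraMap ℂ (EqCohomology z)) := by
  refine mul_divByMonic_eq_iff_isRoot.2 ?_
  rw [IsRoot.def, eval_map]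
  exact AdjoinRoot.eval₂_root (weightPoly z)

/-- The class `∏_{j=1}^{n-1} (y_j - t)`, that is, `(-1)^{n-1} ∏_j (t - y_j)`. -/
def W (t : ℂ) : EqCohomology z :=
  (-1) ^ (n - 1) * (chernRootPoly z).eval (algebraMap ℂ (EqCohomology z) t)

end EqCohomology

variable {n : ℕ}

/-- The master function `Φ(t, p, z) = (e^{πi(2-n)} p)^t ∏_a Γ(z_a - t)`. The variable `p ≠ 0` with
a fixed argument is given through its logarithm `logp = log |p| + i arg p`. -/
def masterFunction (t logp : ℂ) (z : Fin n → ℂ) : ℂ :=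
  Complex.exp (t * (logp + Real.pi * Complex.I * (2 - (n : ℂ)))) * ∏ a, Complex.Gamma (z a - t)

/-- The Jackson integral `Ψ_J = - ∑_{k ≥ 0} Res_{t = z_J + k} Φ(t, p, z) W(t, y)`. -/
def PsiJ (J : Fin n) (logp : ℂ) (z : Fin n → ℂ) : EqCohomology z :=
  -∑' k : ℕ, residue (fun t : ℂ => masterFunction t logp z • EqCohomology.W z t) (z J + k)

/-- The solution `Ψ_Q = ∑_J Q(e^{2πi z_J}, e^{2πi z_1}, …, e^{2πi z_n}) Ψ_J`, where the Laurent
polynomial `Q(X, Z)` is given as a function of its arguments. -/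
def PsiQ (Q : ℂ → (Fin n → ℂ) → ℂ) (logp : ℂ) (z : Fin n → ℂ) : EqCohomology z :=
  ∑ J, Q (Complex.exp (2 * Real.pi * Complex.I * z J))
    (fun a => Complex.exp (2 * Real.pi * Complex.I * z a)) • PsiJ J logp z

/-- The solution `Ψ^m`, which is `Ψ_Q` for the Laurent monomial `Q = X^{m-1}`. -/
def Psi (m : ℤ) (logp : ℂ) (z : Fin n → ℂ) : EqCohomology z :=
  PsiQ (fun T _ => T ^ (m - 1)) logp z

end QuantumPn

end

/-! Since the `z a` are distinct, the algebra is a product of copies of `ℂ` through the evaluations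
`x ↦ z b` (`eq_of_forall_evalAt`), so the asymptotics can be checked one component at a time. In the
`b`-th component `W` becomes `∏_{a ≠ b} (z a - t)` (`evalAt_W`), which turns `Γ(z a - t)` into `Γ(z
a - t + 1)` for `a ≠ b`. The weights `e^{2πi(m-1) z_J}` agree with `e^{2πi(m-1)t}` at `t = z_J + k`,
so they move inside the residues. After the substitution `w = n (centre z - t)` each component is an
explicit factor times the sum of all residues of one function `e^{-Lw} ∏ Γ(α_a + w/n)`, with `∑ α_a
= (n-1)/2` and `L = log(-ω^m s)` (`evalAt_Psi`).

For such parameters Stirling's formula gives an asymptotic version of Gauss's multiplication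
formula: the product of Gamma functions is a constant times `n^{-w} Γ(w) (1 + b/w + …)`
(`prod_Gamma_eq`, `exists_norm_gammaKernel_sub_le`). The residues of `e^{-λw} Γ(w)` and `e^{-λw}
Γ(w-1)` sum exactly to `e^{-S}` and `e^{-S}/S`, where `S = e^λ`
(`tsum_simpleResidue_gammaKernel_one`). The first is the main term and the second is of relative
order `1/S`.

What remains is a residue sum for a function of relative size `D⁻²` at distance `D` from the
negative axis. It is a limit of integrals over the lower, right and upper sides of rectangles
growing to the left (`tendsto_threeSideIntegral_gammaKernelError`). These sides can be chosen so
that `|e^{-λw} Γ(w)|` is controlled by its size at the saddle point `w = S`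
(`exists_isSaddleRectangle`); this is possible in every direction off the negative real axis, which
is the condition on `φ`. The effective length of the contour is of order `|S|`, so the error is `|S|
· |S|⁻² = 1/|S|` relative to `e^{-S}` (`exists_norm_sum_residues_sub_le`). The crude length bound
loses one power of `|S|`, and this is why the expansion is carried to second order. -/

noncomputable section

namespace QuantumPn

/-! ### The logarithm away from the negative real axis. -/

section

open Complex Set

/-- The points at distance at least `D` from the negative real axis, up to the choice of the
norm: the points with `|Im w| ≥ D` or `Re w ≥ D`. -/
def FarFromNegAxis (D : ℝ) (w : ℂ) : Prop := D ≤ |w.im| ∨ D ≤ w.re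

namespace FarFromNegAxis

variable {D : ℝ} {w : ℂ}

lemma mem_slitPlane (hD : 0 < D) (h : FarFromNegAxis D w) : w ∈ slitPlane := by
  rw [mem_slitPlane_iff]
  rcases h with h | h
  · right
    intro h0
    rw [h0, abs_zero] at h
    linarith
  · left; linarith

lemma le_norm (h : FarFromNegAxis D w) : D ≤ ‖w‖ := by
  rcases h with h | h
  · exact h.trans (abs_im_le_norm w)
  · exact h.trans ((le_abs_self _).trans (abs_re_le_norm w))

lemma mono {D' : ℝ} (hD : D' ≤ D) (h : FarFromNegAxis D w) : FarFromNegAxis D' w :=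
  h.imp hD.trans hD.trans

lemma add_ofReal (h : FarFromNegAxis D w) {t : ℝ} (ht : 0 ≤ t) : FarFromNegAxis D (w + t) := by
  rcases h with h | h
  · left; simpa using h
  · right; simp; linarith

lemma add_natCast (h : FarFromNegAxis D w) (k : ℕ) : FarFromNegAxis D (w + k) := by
  simpa using h.add_ofReal (Nat.cast_nonneg (α := ℝ) k)

lemma add_of_norm_le (h : FarFromNegAxis D w) {a : ℂ} {d : ℝ} (ha : ‖a‖ ≤ d) :
    FarFromNegAxis (D - d) (w + a) := by
  have h1 := (abs_re_le_norm a).trans ha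
  have h2 := (abs_im_le_norm a).trans ha
  rw [abs_le] at h1
  rcases h with h | h
  · left
    have h3 := abs_sub_abs_le_abs_sub w.im (-a.im)
    rw [abs_neg, sub_neg_eq_add] at h3
    rw [add_im]
    linarith
  · right; rw [add_re]; linarith

lemma div_natCast {n : ℕ} (hn : 0 < n) (h : FarFromNegAxis D w) :
    FarFromNegAxis (D / n) (w / n) := by
  have hn' : (0 : ℝ) < n := by exact_mod_cast hn
  rcases h with h | h
  · left
    rw [div_natCast_im, abs_div, abs_of_pos hn']
    gcongr
  · right
    rw [div_natCast_re]
    gcongr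

end FarFromNegAxis

/-- Along `τ ↦ s + τ a` the difference `log (s + τ a) - log (1 + τ a / s)` has zero derivative,
because neither argument meets the cut; so it keeps its value `log s` at `τ = 0`. -/
lemma log_add_eq_log_add_log_one_add {s a : ℂ} (hs : ∀ τ ∈ Icc (0 : ℝ) 1, s + τ * a ∈ slitPlane)
    (ha : ‖a / s‖ < 1) : log (s + a) = log s + log (1 + a / s) := by
  have hs0 : s ∈ slitPlane := by simpa using hs 0 (by simp)
  have hsne : s ≠ 0 := slitPlane_ne_zero hs0
  have h1 : ∀ τ ∈ Icc (0 : ℝ) 1, 1 + τ * (a / s) ∈ slitPlane := by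
    intro τ hτ
    rw [mem_slitPlane_iff]
    left
    have h2 : ‖(τ : ℂ) * (a / s)‖ < 1 := by
      rw [norm_mul, norm_real, Real.norm_eq_abs, abs_of_nonneg hτ.1]
      calc τ * ‖a / s‖ ≤ 1 * ‖a / s‖ := by gcongr; exact hτ.2
        _ < 1 := by rwa [one_mul]
    have h3 := (abs_re_le_norm ((τ : ℂ) * (a / s))).trans_lt h2
    rw [abs_lt] at h3
    rw [add_re, one_re]
    linarith
  have hd : ∀ τ ∈ Icc (0 : ℝ) 1,
      HasDerivAt (fun τ : ℝ => log (s + τ * a) - log (1 + τ * (a / s))) 0 τ := by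
    intro τ hτ
    have e1 : HasDerivAt (fun τ : ℝ => s + τ * a) a τ := by
      simpa using ((hasDerivAt_id τ).ofReal_comp.mul_const a).const_add s
    have e2 : HasDerivAt (fun τ : ℝ => 1 + τ * (a / s)) (a / s) τ := by
      simpa using ((hasDerivAt_id τ).ofReal_comp.mul_const (a / s)).const_add 1
    have e3 := (e1.clog_real (hs τ hτ)).sub (e2.clog_real (h1 τ hτ))
    convert! e3 using 1
    have n1 := slitPlane_ne_zero (hs τ hτ)
    have n2 := slitPlane_ne_zero (h1 τ hτ)
    rw [eq_comm, sub_eq_zero, div_div, mul_add, mul_one]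
    congr 2
    field_simp
  have key := constant_of_derivWithin_zero (a := (0 : ℝ)) (b := 1)
    (fun τ hτ => (hd τ hτ).differentiableAt.differentiableWithinAt)
    (fun τ hτ => (hd τ (Ico_subset_Icc_self hτ)).hasDerivWithinAt.derivWithin
      (uniqueDiffOn_Icc zero_lt_one τ (Ico_subset_Icc_self hτ))) 1 (by simp)
  simp only [ofReal_one, one_mul, ofReal_zero, zero_mul, add_zero, log_one, sub_zero] at key
  rw [← key]; ring

lemma log_add_of_farFromNegAxis {D : ℝ} {w a : ℂ} (h : FarFromNegAxis D w) (ha : ‖a‖ < D) :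
    log (w + a) = log w + log (1 + a / w) := by
  have hD : 0 < D := (norm_nonneg a).trans_lt ha
  have hw := h.le_norm
  apply log_add_eq_log_add_log_one_add
  · intro τ hτ
    refine (h.add_of_norm_le (a := τ * a) (d := ‖a‖) ?_).mem_slitPlane (by linarith)
    rw [norm_mul, norm_real, Real.norm_eq_abs, abs_of_nonneg hτ.1]
    calc τ * ‖a‖ ≤ 1 * ‖a‖ := by gcongr; exact hτ.2
      _ = ‖a‖ := one_mul _
  · rw [norm_div, div_lt_one (hD.trans_le hw)]
    linarith

/-! ### Stirling's formula with an explicit remainder. -/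

/-- The terms of Gudermann's series for the remainder in Stirling's formula. -/
def gudermann (w : ℂ) : ℂ := (w + 1 / 2) * log (1 + 1 / w) - 1

/-- The terms of Gudermann's series with the main part `(1/w - 1/(w+1))/12` removed. -/
def gudermannTail (w : ℂ) : ℂ := gudermann w - (1 / 12) * (1 / w - 1 / (w + 1))

/-- In powers of `u = 1/w` the two parts agree through `u³`, so a fourth order Taylor polynomial of
the logarithm leaves `O(u⁴)`. The cubic bound is enough: summation over `w + k` costs one power and
leaves `D⁻²`. -/
lemma norm_gudermannTail_le {w : ℂ} (hw : 2 ≤ ‖w‖) : ‖gudermannTail w‖ ≤ 1 / ‖w‖ ^ 3 := by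
  have hw0 : w ≠ 0 := by
    intro h; rw [h, norm_zero] at hw; linarith
  obtain ⟨u, rfl⟩ : ∃ u, w = u⁻¹ := ⟨w⁻¹, (inv_inv w).symm⟩
  have hu0 : u ≠ 0 := by simpa using hw0
  have hup : 0 < ‖u‖ := norm_pos_iff.2 hu0
  rw [norm_inv] at hw
  have hu : ‖u‖ ≤ 1 / 2 := by
    rw [le_inv_comm₀ (by norm_num) hup] at hw
    linarith
  have h1u : 1 + u ≠ 0 := by
    intro h
    have : u = -1 := by linear_combination h
    rw [this] at hu; norm_num at hu
  have h1u' : 1 / 2 ≤ ‖1 + u‖ := by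
    have := norm_sub_norm_le (1 : ℂ) (-u)
    rw [norm_neg, norm_one, sub_neg_eq_add] at this
    linarith
  have hl := norm_log_sub_logTaylor_le 4 (z := u) (by linarith)
  have hT : logTaylor (4 + 1) u = u - u ^ 2 / 2 + u ^ 3 / 3 - u ^ 4 / 4 := by
    simp [logTaylor_succ, logTaylor_zero]; ring
  rw [hT] at hl
  set l := log (1 + u) - (u - u ^ 2 / 2 + u ^ 3 / 3 - u ^ 4 / 4) with hl_def
  have hl2 : ‖l‖ ≤ ‖u‖ ^ 5 * (2 / 5) := by
    refine hl.trans ?_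
    have : (1 - ‖u‖)⁻¹ ≤ 2 := by
      rw [inv_le_comm₀ (by linarith) (by norm_num)]; linarith
    calc ‖u‖ ^ (4 + 1) * (1 - ‖u‖)⁻¹ / ((4 : ℕ) + 1) ≤ ‖u‖ ^ (4 + 1) * 2 / ((4 : ℕ) + 1) := by
          gcongr
      _ = _ := by norm_num; ring
  have e : gudermannTail u⁻¹ = (u⁻¹ + 1 / 2) * l - u ^ 4 * (1 / 8 + 1 / 12 * (1 + u)⁻¹) := by
    have h2 : u⁻¹ + 1 ≠ 0 := by
      intro h; apply h1u; field_simp at h; linear_combination h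
    have hlog : log (1 + u) = l + (u - u ^ 2 / 2 + u ^ 3 / 3 - u ^ 4 / 4) := by rw [hl_def]; ring
    have h4 : 1 / (u⁻¹ + 1) = u * (1 + u)⁻¹ := by field_simp
    have h7 : 1 / u⁻¹ = u := by simp
    rw [gudermannTail, gudermann, h7, hlog, h4]
    have h5 : (1 + u)⁻¹ * (1 + u) = 1 := inv_mul_cancel₀ h1u
    have h6 : u⁻¹ * u = 1 := inv_mul_cancel₀ hu0
    generalize (1 + u)⁻¹ = q at *
    generalize u⁻¹ = p at *
    linear_combination (1 - u / 2 + u ^ 2 / 3 - u ^ 3 / 4) * h6 +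
      (u / 12 - u ^ 2 / 12 + u ^ 3 / 12) * h5
  have e' : 1 / ‖u⁻¹‖ ^ 3 = ‖u‖ ^ 3 := by simp
  rw [e, e']
  have n1 : ‖(u⁻¹ + 1 / 2) * l‖ ≤ 1 / 2 * ‖u‖ ^ 4 := by
    rw [norm_mul]
    have : ‖u⁻¹ + 1 / 2‖ ≤ 5 / 4 * ‖u‖⁻¹ := by
      refine (norm_add_le _ _).trans ?_
      rw [norm_inv]
      have : ‖(1 / 2 : ℂ)‖ = 1 / 2 := by norm_num
      rw [this]; linarith
    calc ‖u⁻¹ + 1 / 2‖ * ‖l‖ ≤ (5 / 4 * ‖u‖⁻¹) * (‖u‖ ^ 5 * (2 / 5)) := by gcongr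
      _ = 1 / 2 * ‖u‖ ^ 4 := by field_simp; ring
  have n2 : ‖u ^ 4 * (1 / 8 + 1 / 12 * (1 + u)⁻¹)‖ ≤ 1 / 2 * ‖u‖ ^ 4 := by
    rw [norm_mul, norm_pow, mul_comm]
    gcongr
    refine (norm_add_le _ _).trans ?_
    rw [norm_mul, norm_inv]
    have : ‖1 + u‖⁻¹ ≤ 2 := by
      rw [inv_le_comm₀ (by linarith) (by norm_num)]; linarith
    have e1 : ‖(1 / 8 : ℂ)‖ = 1 / 8 := by norm_num
    have e2 : ‖(1 / 12 : ℂ)‖ = 1 / 12 := by norm_num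
    rw [e1, e2]; linarith
  calc _ ≤ 1 / 2 * ‖u‖ ^ 4 + 1 / 2 * ‖u‖ ^ 4 := (norm_sub_le _ _).trans (add_le_add n1 n2)
    _ = ‖u‖ * ‖u‖ ^ 3 := by ring
    _ ≤ 1 * ‖u‖ ^ 3 := by gcongr; linarith
    _ = _ := one_mul _

/-- The function `u / (D + |u|)` has derivative `D / (D + |u|)²` and values in `[-1, 1]`. Each term
is at most `2/D` times its increment over a unit step, and the increments telescope, uniformly in
`x`. -/
lemma sum_range_inv_sq_le {D : ℝ} (hD : 1 ≤ D) (x : ℝ) (N : ℕ) :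
    ∑ k ∈ Finset.range N, 1 / (D + |x + k|) ^ 2 ≤ 4 / D := by
  set φ : ℝ → ℝ := fun u => u / (D + |u|) with hφ
  have hpos : ∀ u : ℝ, 0 < D + |u| := fun u => by positivity
  have hφ1 : ∀ u, |φ u| ≤ 1 := by
    intro u
    rw [hφ]; simp only
    rw [abs_div, abs_of_pos (hpos u), div_le_one (hpos u)]
    linarith
  have step : ∀ u, 1 / (D + |u|) ^ 2 ≤ 2 / D * (φ (u + 1) - φ u) := by
    intro u
    have hDp : 0 < D := by linarith
    rcases le_total 0 u with hu | hu
    · have : φ (u + 1) - φ u = D / ((D + u) * (D + (u + 1))) := by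
        simp only [hφ]
        rw [abs_of_nonneg hu, abs_of_nonneg (by linarith : 0 ≤ u + 1)]
        field_simp; ring
      rw [this, abs_of_nonneg hu]
      have : 2 / D * (D / ((D + u) * (D + (u + 1)))) = 2 / ((D + u) * (D + (u + 1))) := by
        field_simp
      rw [this, div_le_div_iff₀ (by positivity) (by positivity)]
      nlinarith
    · rcases le_total u (-1) with hu1 | hu1
      · have h1 : 0 < D - u := by linarith
        have h2 : 0 < D - (u + 1) := by linarith
        have : φ (u + 1) - φ u = D / ((D - u) * (D - (u + 1))) := by
          simp only [hφ]
          rw [abs_of_nonpos hu, abs_of_nonpos (by linarith : u + 1 ≤ 0), ← sub_eq_add_neg,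
            ← sub_eq_add_neg]
          field_simp; ring
        rw [this, abs_of_nonpos hu]
        have : 2 / D * (D / ((D - u) * (D - (u + 1)))) = 2 / ((D - u) * (D - (u + 1))) := by
          field_simp
        rw [this, div_le_div_iff₀ (by nlinarith) (by positivity)]
        nlinarith
      · have h1 : 1 / (D + 1) ≤ φ (u + 1) - φ u := by
          simp only [hφ]
          rw [abs_of_nonpos hu, abs_of_nonneg (by linarith : 0 ≤ u + 1)]
          have a1 : (u + 1) / (D + 1) ≤ (u + 1) / (D + (u + 1)) := by
            gcongr <;> linarith
          have a2 : (-u) / (D + 1) ≤ (-u) / (D + -u) := by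
            gcongr <;> linarith
          have a3 : u / (D + -u) = -((-u) / (D + -u)) := by ring
          rw [a3]
          have a4 : 1 / (D + 1) = (u + 1) / (D + 1) + (-u) / (D + 1) := by ring
          rw [a4]; linarith
        calc 1 / (D + |u|) ^ 2 ≤ 1 / D ^ 2 := by
              gcongr; linarith [abs_nonneg u]
          _ ≤ 2 / D * (1 / (D + 1)) := by
              rw [div_mul_div_comm, div_le_div_iff₀ (by positivity) (by positivity)]
              nlinarith
          _ ≤ _ := by gcongr
  calc ∑ k ∈ Finset.range N, 1 / (D + |x + k|) ^ 2
      ≤ ∑ k ∈ Finset.range N, 2 / D * (φ (x + (k + 1 : ℕ)) - φ (x + k)) := by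
        refine Finset.sum_le_sum fun k _ => ?_
        have := step (x + k)
        rw [add_assoc] at this
        simpa using this
    _ = 2 / D * (φ (x + N) - φ x) := by
        rw [← Finset.mul_sum, Finset.sum_range_sub (fun k : ℕ => φ (x + k))]; simp
    _ ≤ 2 / D * 2 := by
        have h1 := abs_le.1 (hφ1 (x + N))
        have h2 := abs_le.1 (hφ1 x)
        have : 0 < D := by linarith
        gcongr
        linarith
    _ = 4 / D := by ring

lemma sum_range_norm_gudermannTail_le {D : ℝ} (hD : 2 ≤ D) {w : ℂ} (hw : FarFromNegAxis D w)
    (N : ℕ) : ∑ k ∈ Finset.range N, ‖gudermannTail (w + k)‖ ≤ 32 / D ^ 2 := by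
  have hDp : 0 < D := by linarith
  calc ∑ k ∈ Finset.range N, ‖gudermannTail (w + k)‖
      ≤ ∑ k ∈ Finset.range N, 8 / D * (1 / (D + |w.re + k|) ^ 2) := by
        refine Finset.sum_le_sum fun k _ => ?_
        have h1 := (hw.add_natCast k).le_norm
        have h2 := abs_re_le_norm (w + k)
        rw [add_re, natCast_re] at h2
        refine (norm_gudermannTail_le (hD.trans h1)).trans ?_
        have h3 : (D + |w.re + k|) / 2 ≤ ‖w + k‖ := by linarith
        have hp : 0 < D + |w.re + k| := by positivity
        calc 1 / ‖w + k‖ ^ 3 ≤ 1 / ((D + |w.re + k|) / 2) ^ 3 := by gcongr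
          _ = 8 / (D + |w.re + k|) * (1 / (D + |w.re + k|) ^ 2) := by field_simp; norm_num
          _ ≤ 8 / D * (1 / (D + |w.re + k|) ^ 2) := by
            gcongr
            linarith [abs_nonneg (w.re + k)]
    _ = 8 / D * ∑ k ∈ Finset.range N, (1 / (D + |w.re + k|) ^ 2) := by rw [Finset.mul_sum]
    _ ≤ 8 / D * (4 / D) := by gcongr; exact sum_range_inv_sq_le (by linarith) _ _
    _ = 32 / D ^ 2 := by ring

lemma summable_norm_gudermannTail {D : ℝ} (hD : 2 ≤ D) {w : ℂ} (hw : FarFromNegAxis D w) :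
    Summable fun k : ℕ => ‖gudermannTail (w + k)‖ :=
  summable_of_sum_range_le (fun _ => norm_nonneg _) (sum_range_norm_gudermannTail_le hD hw)

/-- The remainder in Stirling's formula: `log Γ(w) = (w - 1/2) log w - w + log √(2π) + J(w)`. -/
def stirlingRemainder (w : ℂ) : ℂ := 1 / 12 * (1 / w) + ∑' k : ℕ, gudermannTail (w + k)

lemma norm_stirlingRemainder_sub_le {D : ℝ} (hD : 2 ≤ D) {w : ℂ} (hw : FarFromNegAxis D w) :
    ‖stirlingRemainder w - 1 / 12 * (1 / w)‖ ≤ 32 / D ^ 2 := by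
  rw [stirlingRemainder, add_sub_cancel_left]
  exact (norm_tsum_le_tsum_norm (summable_norm_gudermannTail hD hw)).trans
    (Real.tsum_le_of_sum_range_le (fun _ => norm_nonneg _) (sum_range_norm_gudermannTail_le hD hw))

lemma norm_stirlingRemainder_le {D : ℝ} (hD : 2 ≤ D) {w : ℂ} (hw : FarFromNegAxis D w) :
    ‖stirlingRemainder w‖ ≤ 17 / D := by
  have hDp : 0 < D := by linarith
  have h1 := norm_stirlingRemainder_sub_le hD hw
  have h2 : ‖(1 / 12 * (1 / w) : ℂ)‖ ≤ 1 / D := by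
    rw [norm_mul, norm_div, norm_div, norm_one]
    have : 1 / ‖w‖ ≤ 1 / D := by gcongr; exact hw.le_norm
    have e2 : ‖(12 : ℂ)‖ = 12 := by norm_num
    rw [e2]
    have : 0 ≤ 1 / ‖w‖ := by positivity
    linarith
  have h3 : 32 / D ^ 2 ≤ 16 / D := by
    rw [div_le_div_iff₀ (by positivity) hDp]; nlinarith
  calc ‖stirlingRemainder w‖
      = ‖(stirlingRemainder w - 1 / 12 * (1 / w)) + 1 / 12 * (1 / w)‖ := by ring_nf
    _ ≤ 32 / D ^ 2 + 1 / D := (norm_add_le _ _).trans (add_le_add h1 h2)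
    _ ≤ 16 / D + 1 / D := by gcongr
    _ = 17 / D := by ring

lemma stirlingRemainder_sub_add_one {w : ℂ} (hw : FarFromNegAxis 2 w) :
    stirlingRemainder w - stirlingRemainder (w + 1) = gudermann w := by
  have h := (summable_norm_gudermannTail le_rfl hw).of_norm.tsum_eq_zero_add
  have h2 : ∀ k : ℕ, w + 1 + k = w + (k + 1 : ℕ) := fun k => by push_cast; ring
  simp only [stirlingRemainder, h2]
  rw [h, Nat.cast_zero, add_zero, gudermannTail]
  ring

/-- Stirling's approximation to the logarithm of the Gamma function, without the constant
`log √(2π)` but with the exact remainder. -/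
def stirlingLog (w : ℂ) : ℂ := (w - 1 / 2) * log w - w + stirlingRemainder w

lemma exp_stirlingLog_add_one {w : ℂ} (hw : FarFromNegAxis 2 w) :
    exp (stirlingLog (w + 1)) = w * exp (stirlingLog w) := by
  have h0 : w ≠ 0 := slitPlane_ne_zero (hw.mem_slitPlane two_pos)
  have h1 : log (w + 1) = log w + log (1 + 1 / w) :=
    log_add_of_farFromNegAxis hw (by simp)
  have h2 := stirlingRemainder_sub_add_one hw
  rw [gudermann] at h2
  have : stirlingLog (w + 1) = log w + stirlingLog w := by
    rw [stirlingLog, stirlingLog, h1]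
    linear_combination -h2
  rw [this, exp_add, exp_log h0]

lemma exp_stirlingLog_add_natCast {w : ℂ} (hw : FarFromNegAxis 2 w) (N : ℕ) :
    exp (stirlingLog (w + N)) = (∏ j ∈ Finset.range N, (w + j)) * exp (stirlingLog w) := by
  induction N with
  | zero => simp
  | succ N ih =>
    rw [Finset.prod_range_succ, Nat.cast_add, Nat.cast_one, ← add_assoc,
      exp_stirlingLog_add_one (hw.add_natCast N), ih]
    ring

lemma log_natCast_add {a : ℂ} : ∀ᶠ N : ℕ in atTop, log (a + N) = Real.log N + log (1 + a / N) := by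
  filter_upwards [eventually_gt_atTop ⌈‖a‖⌉₊, eventually_gt_atTop 0] with N hN hN0
  have hN' : ‖a‖ < N := Nat.lt_of_ceil_lt hN
  have hf : FarFromNegAxis (N : ℝ) (N : ℂ) := Or.inr (by simp)
  rw [add_comm, log_add_of_farFromNegAxis hf hN', natCast_log]

/-- The shift is `N + 1` because the denominator of `GammaSeq w N` has `N + 1` factors. After `log
N` is split off, `N log (1 + (w+1)/N) → w + 1` cancels the linear term `-(w + 1)`. -/
lemma tendsto_stirlingLog_sub (w : ℂ) :
    Tendsto (fun N : ℕ => stirlingLog (w + (N + 1 : ℕ)) - (w + N + 1 / 2) * Real.log N + N)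
      atTop (𝓝 0) := by
  have h0 : Tendsto (fun N : ℕ => (w + 1) / (N : ℂ)) atTop (𝓝 0) :=
    tendsto_const_div_atTop_nhds_zero_nat (w + 1)
  have h1 : Tendsto (fun N : ℕ => (N : ℂ) * log (1 + (w + 1) / N)) atTop (𝓝 (w + 1)) := by
    refine tendsto_nat_mul_log_one_add_of_tendsto ?_
    refine tendsto_const_nhds.congr' ?_
    filter_upwards [eventually_gt_atTop 0] with N hN
    have : (N : ℂ) ≠ 0 := by exact_mod_cast hN.ne'
    field_simp
  have h2 : Tendsto (fun N : ℕ => (w + 1 / 2) * log (1 + (w + 1) / N)) atTop (𝓝 0) := by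
    have : Tendsto (fun N : ℕ => log (1 + (w + 1) / (N : ℂ))) atTop (𝓝 (log (1 + 0))) :=
      (h0.const_add 1).clog (by simp)
    simpa using this.const_mul (w + 1 / 2)
  have h3 : Tendsto (fun N : ℕ => stirlingRemainder (w + (N + 1 : ℕ))) atTop (𝓝 0) := by
    rw [tendsto_zero_iff_norm_tendsto_zero]
    have hD : Tendsto (fun N : ℕ => w.re + (N : ℝ)) atTop atTop :=
      tendsto_atTop_add_const_left _ _ tendsto_natCast_atTop_atTop
    refine squeeze_zero' (Eventually.of_forall fun _ => norm_nonneg _) ?_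
      (hD.const_div_atTop 17)
    filter_upwards [hD.eventually_ge_atTop 2] with N hN
    refine norm_stirlingRemainder_le hN (Or.inr ?_)
    simp
  have h4 := ((h1.add h2).sub_const (w + 1)).add h3
  simp only [add_zero, sub_self] at h4
  refine h4.congr' ?_
  filter_upwards [log_natCast_add (a := w + 1)] with N hN
  rw [stirlingLog]
  have : w + (N + 1 : ℕ) = w + 1 + N := by push_cast; ring
  rw [this, hN]
  ring

lemma factorial_eq_stirlingSeq_mul_exp {N : ℕ} (hN : 0 < N) :
    ((N.factorial : ℝ) : ℂ) = (Stirling.stirlingSeq N * √2 : ℝ) *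
      exp ((N + 1 / 2) * Real.log N - N) := by
  have hN' : (0 : ℝ) < N := by exact_mod_cast hN
  have h : (exp ((N + 1 / 2) * Real.log N - N)) =
      ((√N * (N / Real.exp 1) ^ N : ℝ) : ℂ) := by
    rw [Real.sqrt_eq_rpow, Real.rpow_def_of_pos hN', div_pow, ← Real.exp_nat_mul,
      ← Real.exp_log (pow_pos hN' N), Real.log_pow, ← Real.exp_sub, ← Real.exp_add, ofReal_exp]
    congr 1
    push_cast
    ring
  rw [h, ← ofReal_mul, Stirling.stirlingSeq]
  congr 1
  rw [Real.sqrt_mul (by norm_num)]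
  field_simp

/-- Stirling's formula with remainder, away from the negative real axis. -/
theorem Gamma_eq_exp_stirlingLog {w : ℂ} (hw : FarFromNegAxis 2 w) :
    Gamma w = (√(2 * Real.pi) : ℝ) * exp (stirlingLog w) := by
  -- The functional equation writes the denominator of Euler's sequence as a quotient of two values
  -- of `exp ∘ stirlingLog`. The limit is then forced, with the constant `√(2π)` coming from
  -- Stirling's formula for `N!`.
  refine tendsto_nhds_unique (GammaSeq_tendsto_Gamma w) ?_
  have h1 := (tendsto_stirlingLog_sub w).neg.cexp
  have h2 : Tendsto (fun N => ((Stirling.stirlingSeq N * √2 : ℝ) : ℂ)) atTop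
      (𝓝 ((√Real.pi * √2 : ℝ) : ℂ)) :=
    (continuous_ofReal.tendsto _).comp (Stirling.tendsto_stirlingSeq_sqrt_pi.mul_const _)
  have h3 := (h2.mul h1).mul_const (exp (stirlingLog w))
  rw [neg_zero, exp_zero, mul_one, ← Real.sqrt_mul Real.pi_nonneg, mul_comm Real.pi 2] at h3
  refine h3.congr' ?_
  filter_upwards [eventually_gt_atTop 0] with N hN
  have hN0 : (N : ℂ) ≠ 0 := by exact_mod_cast hN.ne'
  have hP := exp_stirlingLog_add_natCast hw (N + 1)
  have hP0 : (∏ j ∈ Finset.range (N + 1), (w + (j : ℂ))) ≠ 0 := by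
    rw [Finset.prod_ne_zero_iff]
    intro j _
    exact slitPlane_ne_zero ((hw.add_natCast j).mem_slitPlane two_pos)
  have hf := factorial_eq_stirlingSeq_mul_exp hN
  rw [ofReal_natCast] at hf
  rw [GammaSeq, hf, eq_div_iff hP0, cpow_def_of_ne_zero hN0, mul_assoc,
    mul_comm (exp (stirlingLog w)),
    ← hP, mul_assoc, ← exp_add, ← natCast_log, mul_left_comm, ← exp_add]
  congr 2
  ring

/-! ### Calculus of second order expansions. -/

/-- `f w = a + b / w + O(D⁻²)` at distance `D` from the negative real axis. -/
def HasSecondOrderExpansion (f : ℂ → ℂ) (a b : ℂ) : Prop :=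
  ∃ K C : ℝ, 0 < K ∧ 0 ≤ C ∧ ∀ D ≥ K, ∀ w, FarFromNegAxis D w → ‖f w - a - b / w‖ ≤ C / D ^ 2

namespace HasSecondOrderExpansion

variable {f g : ℂ → ℂ} {a b a' b' : ℂ}

lemma add (hf : HasSecondOrderExpansion f a b) (hg : HasSecondOrderExpansion g a' b') :
    HasSecondOrderExpansion (fun w => f w + g w) (a + a') (b + b') := by
  obtain ⟨K, C, hK, hC, h⟩ := hf
  obtain ⟨K', C', hK', hC', h'⟩ := hg
  refine ⟨max K K', C + C', by positivity, by positivity, fun D hD w hw => ?_⟩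
  have h1 := h D (le_trans (le_max_left _ _) hD) w hw
  have h2 := h' D (le_trans (le_max_right _ _) hD) w hw
  calc ‖f w + g w - (a + a') - (b + b') / w‖
      = ‖(f w - a - b / w) + (g w - a' - b' / w)‖ := by congr 1; ring
    _ ≤ C / D ^ 2 + C' / D ^ 2 := (norm_add_le _ _).trans (add_le_add h1 h2)
    _ = (C + C') / D ^ 2 := by ring

lemma neg (hf : HasSecondOrderExpansion f a b) :
    HasSecondOrderExpansion (fun w => -f w) (-a) (-b) := by
  obtain ⟨K, C, hK, hC, h⟩ := hf
  refine ⟨K, C, hK, hC, fun D hD w hw => ?_⟩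
  rw [← norm_neg]
  convert! h D hD w hw using 2
  ring

lemma zero : HasSecondOrderExpansion (fun _ => 0) 0 0 :=
  ⟨1, 0, one_pos, le_rfl, fun D _ w _ => by simp⟩

lemma exists_sum {ι : Type*} (s : Finset ι) {f : ι → ℂ → ℂ}
    (hf : ∀ i, ∃ b, HasSecondOrderExpansion (f i) 0 b) :
    ∃ b, HasSecondOrderExpansion (fun w => ∑ i ∈ s, f i w) 0 b := by
  classical
  induction s using Finset.induction_on with
  | empty => exact ⟨0, by simpa using zero⟩
  | insert i s hi ih =>
    obtain ⟨b, hb⟩ := ih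
    obtain ⟨b', hb'⟩ := hf i
    refine ⟨b' + b, ?_⟩
    simp only [Finset.sum_insert hi]
    simpa using hb'.add hb

/-- Once `D ≥ 2‖c‖` the shifted point is still at distance `D / 2`, and `b / (w + c) - b / w` is
itself `O(D⁻²)`, so the coefficients do not change. -/
lemma comp_add_const (hf : HasSecondOrderExpansion f a b) (c : ℂ) :
    HasSecondOrderExpansion (fun w => f (w + c)) a b := by
  obtain ⟨K, C, hK, hC, h⟩ := hf
  refine ⟨max (2 * K) (2 * ‖c‖ + 1), 4 * C + 2 * ‖b‖ * ‖c‖, by positivity, by positivity,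
    fun D hD w hw => ?_⟩
  have hD1 : 2 * K ≤ D := le_trans (le_max_left _ _) hD
  have hD2 : 2 * ‖c‖ + 1 ≤ D := le_trans (le_max_right _ _) hD
  have hDp : 0 < D := by linarith [norm_nonneg c]
  have hw' : FarFromNegAxis (D / 2) (w + c) := by
    have := hw.add_of_norm_le (a := c) (d := D / 2) (by linarith)
    rwa [sub_half] at this
  have h1 := h (D / 2) (by linarith) _ hw'
  have n1 : D ≤ ‖w‖ := hw.le_norm
  have n2 : D / 2 ≤ ‖w + c‖ := hw'.le_norm
  have w0 : w ≠ 0 := norm_pos_iff.1 (hDp.trans_le n1)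
  have w1 : w + c ≠ 0 := norm_pos_iff.1 ((half_pos hDp).trans_le n2)
  have h2 : ‖b / (w + c) - b / w‖ ≤ 2 * ‖b‖ * ‖c‖ / D ^ 2 := by
    have : b / (w + c) - b / w = -(b * c) / ((w + c) * w) := by field_simp; ring
    rw [this, norm_div, norm_neg, norm_mul, norm_mul]
    calc ‖b‖ * ‖c‖ / (‖w + c‖ * ‖w‖) ≤ ‖b‖ * ‖c‖ / (D / 2 * D) := by gcongr
      _ = _ := by field_simp
  calc ‖f (w + c) - a - b / w‖
      = ‖(f (w + c) - a - b / (w + c)) + (b / (w + c) - b / w)‖ := by congr 1; ring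
    _ ≤ C / (D / 2) ^ 2 + 2 * ‖b‖ * ‖c‖ / D ^ 2 := (norm_add_le _ _).trans (add_le_add h1 h2)
    _ = (4 * C + 2 * ‖b‖ * ‖c‖) / D ^ 2 := by field_simp; ring

lemma comp_div_natCast (hf : HasSecondOrderExpansion f a b) {n : ℕ} (hn : 0 < n) :
    HasSecondOrderExpansion (fun w => f (w / n)) a (b * n) := by
  obtain ⟨K, C, hK, hC, h⟩ := hf
  have hn' : (0 : ℝ) < n := by exact_mod_cast hn
  refine ⟨K * n, C * n ^ 2, by positivity, by positivity, fun D hD w hw => ?_⟩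
  have hDp : 0 < D := lt_of_lt_of_le (by positivity) hD
  have h1 := h (D / n) (by rwa [ge_iff_le, le_div_iff₀ hn']) _ (hw.div_natCast hn)
  have : b / (w / n) = b * n / w := by rw [div_div_eq_mul_div]
  rw [this] at h1
  refine h1.trans (le_of_eq ?_)
  field_simp

/-- Here `‖f w‖ ≤ B / D ≤ 1`, so `e^f - 1 - f` is bounded by `‖f‖² = O(D⁻²)`. -/
lemma exp_of_zero (hf : HasSecondOrderExpansion f 0 b) :
    HasSecondOrderExpansion (fun w => exp (f w)) 1 b := by
  obtain ⟨K, C, hK, hC, h⟩ := hf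
  set B := ‖b‖ + C with hB
  refine ⟨max K (B + 1), C + B ^ 2, by positivity, by positivity, fun D hD w hw => ?_⟩
  have hD1 : K ≤ D := le_trans (le_max_left _ _) hD
  have hD2 : B + 1 ≤ D := le_trans (le_max_right _ _) hD
  have hB0 : 0 ≤ B := by positivity
  have hDp : 0 < D := by linarith
  have h1 := h D hD1 w hw
  rw [sub_zero] at h1
  have h2 : ‖f w‖ ≤ B / D := by
    calc ‖f w‖ = ‖(f w - b / w) + b / w‖ := by rw [sub_add_cancel]
      _ ≤ C / D ^ 2 + ‖b‖ / D := by
        refine (norm_add_le _ _).trans (add_le_add h1 ?_)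
        rw [norm_div]; gcongr; exact hw.le_norm
      _ ≤ C / D + ‖b‖ / D := by
        gcongr; nlinarith
      _ = B / D := by rw [hB]; ring
  have h3 : ‖f w‖ ≤ 1 := h2.trans (by rw [div_le_one hDp]; linarith)
  calc ‖exp (f w) - 1 - b / w‖ = ‖(exp (f w) - 1 - f w) + (f w - b / w)‖ := by congr 1; ring
    _ ≤ ‖f w‖ ^ 2 + C / D ^ 2 :=
      (norm_add_le _ _).trans (add_le_add (norm_exp_sub_one_sub_id_le h3) h1)
    _ ≤ (B / D) ^ 2 + C / D ^ 2 := by gcongr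
    _ = (C + B ^ 2) / D ^ 2 := by ring

lemma of_stirlingRemainder : HasSecondOrderExpansion stirlingRemainder 0 (1 / 12) := by
  refine ⟨2, 32, two_pos, by norm_num, fun D hD w hw => ?_⟩
  have := norm_stirlingRemainder_sub_le hD hw
  rw [sub_zero]
  convert! this using 3
  ring

end HasSecondOrderExpansion

/-! ### Products of shifted Gamma functions compared with one Gamma function. -/

/-- The difference between the main terms of Stirling's formula for `log Γ(s + α)` and
`(s + α - 1/2) log s - s`. -/
def stirlingShift (α s : ℂ) : ℂ := (s + α - 1 / 2) * log (1 + α / s) - α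

/-- With `u = α / s`, insert `log (1 + u) = u - u²/2 + O(u³)` and use `s u = α`: the constant terms
cancel and `(α - 1) u / 2` remains. Later only the existence of the coefficient matters. -/
lemma hasSecondOrderExpansion_stirlingShift (α : ℂ) :
    HasSecondOrderExpansion (stirlingShift α) 0 (α ^ 2 / 2 - α / 2) := by
  refine ⟨max 1 (2 * ‖α‖ + 1), 2 * ‖α‖ ^ 3 + ‖α‖ ^ 2, by positivity, by positivity,
    fun D hD s hs => ?_⟩
  have hD1 : 1 ≤ D := le_trans (le_max_left _ _) hD
  have hD2 : 2 * ‖α‖ + 1 ≤ D := le_trans (le_max_right _ _) hD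
  have hDp : 0 < D := by linarith
  have hs1 := hs.le_norm
  have s0 : s ≠ 0 := norm_pos_iff.1 (hDp.trans_le hs1)
  have hsp : 0 < ‖s‖ := norm_pos_iff.2 s0
  set u := α / s with hu_def
  have hun : ‖u‖ = ‖α‖ / ‖s‖ := norm_div _ _
  have hu : ‖u‖ ≤ 1 / 2 := by
    rw [hun, div_le_iff₀ hsp]; linarith
  have hl := norm_log_sub_logTaylor_le 2 (z := u) (by linarith)
  have hT : logTaylor (2 + 1) u = u - u ^ 2 / 2 := by
    simp [logTaylor_succ, logTaylor_zero]; ring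
  rw [hT] at hl
  set l := log (1 + u) - (u - u ^ 2 / 2) with hl_def
  have hl2 : ‖l‖ ≤ ‖u‖ ^ 3 * (2 / 3) := by
    refine hl.trans ?_
    have : (1 - ‖u‖)⁻¹ ≤ 2 := by
      rw [inv_le_comm₀ (by linarith) (by norm_num)]; linarith
    calc ‖u‖ ^ (2 + 1) * (1 - ‖u‖)⁻¹ / ((2 : ℕ) + 1) ≤ ‖u‖ ^ (2 + 1) * 2 / ((2 : ℕ) + 1) := by
          gcongr
      _ = _ := by norm_num; ring
  have hsu : s * u = α := by rw [hu_def]; field_simp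
  have e : stirlingShift α s - 0 - (α ^ 2 / 2 - α / 2) / s =
      -((α - 1 / 2) * u ^ 2 / 2) + (s + α - 1 / 2) * l := by
    have h1 : (α ^ 2 / 2 - α / 2) / s = (α / 2 - 1 / 2) * u := by rw [hu_def]; ring
    have h2 : log (1 + u) = l + (u - u ^ 2 / 2) := by rw [hl_def]; ring
    rw [stirlingShift, h1, ← hu_def, h2]
    linear_combination (1 - u / 2) * hsu
  have half : ‖(1 / 2 : ℂ)‖ = 1 / 2 := by norm_num
  have n1 : ‖-((α - 1 / 2) * u ^ 2 / 2)‖ ≤ (‖α‖ + 1 / 2) / 2 * (‖α‖ / D) ^ 2 := by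
    have e2 : ‖(2 : ℂ)‖ = 2 := by norm_num
    rw [norm_neg, norm_div, norm_mul, norm_pow, hun, e2]
    have : ‖α - 1 / 2‖ ≤ ‖α‖ + 1 / 2 := (norm_sub_le _ _).trans (by rw [half])
    calc ‖α - 1 / 2‖ * (‖α‖ / ‖s‖) ^ 2 / 2 ≤ (‖α‖ + 1 / 2) * (‖α‖ / D) ^ 2 / 2 := by gcongr
      _ = _ := by ring
  have n2 : ‖(s + α - 1 / 2) * l‖ ≤ 4 / 3 * ‖α‖ * (‖α‖ / D) ^ 2 := by
    rw [norm_mul]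
    have : ‖s + α - 1 / 2‖ ≤ 2 * ‖s‖ := by
      refine (norm_sub_le _ _).trans ?_
      rw [half]
      linarith [norm_add_le s α]
    calc ‖s + α - 1 / 2‖ * ‖l‖ ≤ 2 * ‖s‖ * (‖u‖ ^ 3 * (2 / 3)) := by gcongr
      _ = 4 / 3 * ‖α‖ * (‖α‖ / ‖s‖) ^ 2 := by rw [hun]; field_simp; norm_num; ring
      _ ≤ _ := by gcongr
  rw [e]
  calc _ ≤ (‖α‖ + 1 / 2) / 2 * (‖α‖ / D) ^ 2 + 4 / 3 * ‖α‖ * (‖α‖ / D) ^ 2 :=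
        (norm_add_le _ _).trans (add_le_add n1 n2)
    _ = (11 / 6 * ‖α‖ ^ 3 + 1 / 4 * ‖α‖ ^ 2) / D ^ 2 := by ring
    _ ≤ (2 * ‖α‖ ^ 3 + ‖α‖ ^ 2) / D ^ 2 := by
      gcongr <;> linarith [pow_nonneg (norm_nonneg α) 3, sq_nonneg ‖α‖]

/-- The logarithm of the ratio of `∏_a Γ(α_a + w/n)` to the main term given by Gauss's
multiplication formula. -/
def gammaRatioLog {n : ℕ} (α : Fin n → ℂ) (w : ℂ) : ℂ :=
  ∑ a, (stirlingShift (α a) (w / n) + stirlingRemainder (w / n + α a)) + -stirlingRemainder w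

lemma exists_hasSecondOrderExpansion_gammaRatioLog {n : ℕ} (hn : 0 < n) (α : Fin n → ℂ) :
    ∃ b, HasSecondOrderExpansion (gammaRatioLog α) 0 b := by
  obtain ⟨b, hb⟩ := HasSecondOrderExpansion.exists_sum Finset.univ
    (f := fun a w => stirlingShift (α a) (w / n) + stirlingRemainder (w / n + α a))
    (fun a => ⟨_, by
      simpa using (((hasSecondOrderExpansion_stirlingShift (α a)).comp_div_natCast hn).add
        ((HasSecondOrderExpansion.of_stirlingRemainder.comp_add_const (α a)).comp_div_natCast hn))⟩)
  exact ⟨_, by simpa using! hb.add HasSecondOrderExpansion.of_stirlingRemainder.neg⟩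

/-- The constant `(2π)^{(n-1)/2} √n` of Gauss's multiplication formula. -/
def gaussConst (n : ℕ) : ℝ := √(2 * Real.pi) ^ n / √(2 * Real.pi) * √n

/-- With `s = w / n`, the exponents of `s` in the Stirling approximations add up to `n s + ∑ α_a -
n/2`. The condition on `∑ α_a` makes this `w - 1/2`, the exponent for a single `Γ(w)`; the factors
`n^{-w}` and `√n` come from `log w = log s + log n`. -/
lemma prod_Gamma_eq {n : ℕ} (hn : 0 < n) (α : Fin n → ℂ) (hα : ∑ a, α a = ((n : ℂ) - 1) / 2) :
    ∃ K : ℝ, ∀ w, FarFromNegAxis K w → ∏ a, Gamma (α a + w / n) =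
      gaussConst n * exp (-(w * Real.log n)) * Gamma w * exp (gammaRatioLog α w) := by
  have hn' : (0 : ℝ) < n := by exact_mod_cast hn
  have hn1 : (1 : ℝ) ≤ n := by exact_mod_cast hn
  set M := ∑ a, ‖α a‖ with hM
  have hM0 : 0 ≤ M := Finset.sum_nonneg fun _ _ => norm_nonneg _
  have hMa : ∀ a, ‖α a‖ ≤ M := fun a =>
    Finset.single_le_sum (f := fun a => ‖α a‖) (fun _ _ => norm_nonneg _) (Finset.mem_univ a)
  refine ⟨(M + 2) * n, fun w hw => ?_⟩
  have hs : FarFromNegAxis (M + 2) (w / n) := by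
    have := hw.div_natCast hn
    rwa [mul_div_cancel_right₀ _ hn'.ne'] at this
  have hw2 : FarFromNegAxis 2 w := hw.mono (by nlinarith)
  have hw0 : w ≠ 0 := slitPlane_ne_zero (hw2.mem_slitPlane two_pos)
  have hn0 : (n : ℂ) ≠ 0 := by exact_mod_cast hn.ne'
  have hlog : log w = log (w / n) + Real.log n := by
    have h1 : w = (n : ℝ) * (w / n) := by push_cast; field_simp
    conv_lhs => rw [h1]
    rw [log_ofReal_mul hn' (div_ne_zero hw0 hn0), add_comm]
  set s := w / n with hs_def
  have hws : w = n * s := by rw [hs_def]; field_simp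
  have hG : ∀ a, Gamma (α a + s) = (√(2 * Real.pi) : ℝ) *
      exp ((s + α a - 1 / 2) * log s - s +
        (stirlingShift (α a) s + stirlingRemainder (s + α a))) := by
    intro a
    have h1 : FarFromNegAxis 2 (s + α a) := by
      have := hs.add_of_norm_le (hMa a)
      exact this.mono (by linarith)
    rw [add_comm, Gamma_eq_exp_stirlingLog h1, stirlingLog,
      log_add_of_farFromNegAxis hs ((hMa a).trans_lt (by linarith)), stirlingShift]
    congr 2
    ring
  have hsum : ∑ a, ((s + α a - 1 / 2) * log s - s) = (w - 1 / 2) * log s - w := by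
    rw [Finset.sum_sub_distrib, ← Finset.sum_mul, Finset.sum_sub_distrib,
      Finset.sum_add_distrib, hα]
    simp only [Finset.sum_const, Finset.card_univ, Fintype.card_fin, nsmul_eq_mul]
    rw [hws]; ring
  have hsqrt : exp (Real.log n / 2) = (√n : ℝ) := by
    rw [Real.sqrt_eq_rpow, Real.rpow_def_of_pos hn', ofReal_exp]
    congr 1; push_cast; ring
  have hpi : ((√(2 * Real.pi) : ℝ) : ℂ) ≠ 0 := by
    rw [ofReal_ne_zero]; positivity
  have hratio : gammaRatioLog α w =
      ∑ a, (stirlingShift (α a) s + stirlingRemainder (s + α a)) + -stirlingRemainder w := rfl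
  simp only [hG]
  rw [Finset.prod_mul_distrib, ← exp_sum, Finset.sum_add_distrib, hsum, Finset.prod_const,
    Finset.card_univ, Fintype.card_fin, Gamma_eq_exp_stirlingLog hw2, stirlingLog, hlog, hratio,
    gaussConst]
  push_cast
  rw [← hsqrt]
  generalize ∑ a, (stirlingShift (α a) s + stirlingRemainder (s + α a)) = Q
  have : (w - 1 / 2) * log s - w + Q = Real.log n / 2 + -(w * Real.log n) +
      ((w - 1 / 2) * (log s + Real.log n) - w + stirlingRemainder w) +
      (Q + -stirlingRemainder w) := by ring
  rw [this, exp_add, exp_add, exp_add]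
  push_cast at hpi ⊢
  field_simp

/-- The main function of the Mellin–Barnes integrals: `e^{-λw} ∏_a Γ(α_a + w/n)`. -/
def gammaKernel {n : ℕ} (α : Fin n → ℂ) (lam w : ℂ) : ℂ :=
  exp (-(lam * w)) * ∏ a, Gamma (α a + w / n)

/-- Second order expansion of `∏_a Γ(α_a + w/n)` relative to `Γ(w)`, written in terms of the
functions `Γ(w)` and `Γ(w - 1)`. -/
lemma exists_norm_gammaKernel_sub_le {n : ℕ} (hn : 0 < n) (α : Fin n → ℂ)
    (hα : ∑ a, α a = ((n : ℂ) - 1) / 2) :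
    ∃ (A : ℂ) (K C : ℝ), 0 < K ∧ 0 ≤ C ∧ ∀ D ≥ K, ∀ w, FarFromNegAxis D w → ∀ lam : ℂ,
      ‖gammaKernel α lam w - gaussConst n * (exp (-((lam + Real.log n) * w)) * Gamma w)
        - A * (exp (-((lam + Real.log n) * w)) * Gamma (w - 1))‖
        ≤ C / D ^ 2 * ‖exp (-((lam + Real.log n) * w)) * Gamma w‖ := by
  obtain ⟨b, hb⟩ := exists_hasSecondOrderExpansion_gammaRatioLog hn α
  obtain ⟨K, C, hK, hC, h⟩ := hb.exp_of_zero
  obtain ⟨K', hK'⟩ := prod_Gamma_eq hn α hα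
  refine ⟨gaussConst n * b, max K (max K' 2), |gaussConst n| * (C + 2 * ‖b‖), by positivity,
    by positivity, fun D hD w hw lam => ?_⟩
  have hD1 : K ≤ D := le_trans (le_max_left _ _) hD
  have hD2 : K' ≤ D := le_trans (le_trans (le_max_left _ _) (le_max_right _ _)) hD
  have hD3 : 2 ≤ D := le_trans (le_trans (le_max_right _ _) (le_max_right _ _)) hD
  have h1 := h D hD1 w hw
  have h2 := hK' w (hw.mono hD2)
  have hwn := hw.le_norm
  have w0 : w ≠ 0 := norm_pos_iff.1 (by linarith)
  have hwn1 : D / 2 ≤ ‖w - 1‖ := by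
    have := norm_sub_norm_le w 1
    rw [norm_one] at this; linarith
  have w1 : w - 1 ≠ 0 := norm_pos_iff.1 (by linarith)
  have hGam : Gamma w = (w - 1) * Gamma (w - 1) := by
    have := Gamma_add_one (w - 1) w1
    rwa [sub_add_cancel] at this
  have hGam' : Gamma (w - 1) = Gamma w / (w - 1) := by rw [hGam]; field_simp
  have e1 : exp (-(lam * w)) * exp (-(w * Real.log n)) = exp (-((lam + Real.log n) * w)) := by
    rw [← exp_add]; congr 1; ring
  have e : gammaKernel α lam w - gaussConst n * (exp (-((lam + Real.log n) * w)) * Gamma w)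
        - gaussConst n * b * (exp (-((lam + Real.log n) * w)) * Gamma (w - 1)) =
      gaussConst n * ((exp (gammaRatioLog α w) - 1 - b / w) + (b / w - b / (w - 1))) *
        (exp (-((lam + Real.log n) * w)) * Gamma w) := by
    rw [gammaKernel, h2, ← e1, hGam']
    ring
  -- Replacing `Γ(w)/w` by `Γ(w)/(w-1) = Γ(w-1)` is free at this order, and the residues of `e^{-λw}
  -- Γ(w-1)` have a closed sum.
  have n2 : ‖b / w - b / (w - 1)‖ ≤ 2 * ‖b‖ / D ^ 2 := by
    have : b / w - b / (w - 1) = -b / (w * (w - 1)) := by field_simp; ring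
    rw [this, norm_div, norm_neg, norm_mul]
    calc ‖b‖ / (‖w‖ * ‖w - 1‖) ≤ ‖b‖ / (D * (D / 2)) := by gcongr
      _ = _ := by field_simp
  rw [e, norm_mul, norm_mul, norm_real, Real.norm_eq_abs]
  gcongr
  calc |gaussConst n| * ‖_‖ ≤ |gaussConst n| * (C / D ^ 2 + 2 * ‖b‖ / D ^ 2) := by
        gcongr
        exact (norm_add_le _ _).trans (add_le_add h1 n2)
    _ = _ := by ring

/-! ### The size of `e^{-λw} Γ(w)`. -/

/-- The exponent `Re (w log w - w - λw)` of the function `|e^{-λw} Γ(w)|`. -/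
def gammaExponent (lam w : ℂ) : ℝ := (w * log w - w - lam * w).re

lemma norm_exp_mul_Gamma_le {w : ℂ} (hw : FarFromNegAxis 2 w) (lam : ℂ) :
    ‖exp (-(lam * w)) * Gamma w‖ ≤
      √(2 * Real.pi) * Real.exp 9 * ((√‖w‖)⁻¹ * Real.exp (gammaExponent lam w)) := by
  have hw0 : w ≠ 0 := slitPlane_ne_zero (hw.mem_slitPlane two_pos)
  have hwp : 0 < ‖w‖ := norm_pos_iff.2 hw0
  have e : exp (-(lam * w)) * Gamma w = (√(2 * Real.pi) : ℝ) * (exp (stirlingRemainder w) *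
      (exp (-(1 / 2) * log w) * exp (w * log w - w - lam * w))) := by
    rw [Gamma_eq_exp_stirlingLog hw, stirlingLog, mul_left_comm, ← exp_add, ← exp_add, ← exp_add]
    congr 2; ring
  -- The remainder is at most `17 / 2` at distance `2`.
  have h1 : ‖exp (stirlingRemainder w)‖ ≤ Real.exp 9 := by
    rw [norm_exp]
    gcongr
    refine (re_le_norm _).trans ((norm_stirlingRemainder_le le_rfl hw).trans ?_)
    norm_num
  have h2 : ‖exp (-(1 / 2) * log w)‖ = (√‖w‖)⁻¹ := by
    rw [norm_exp, Real.sqrt_eq_rpow, ← Real.rpow_neg hwp.le, Real.rpow_def_of_pos hwp]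
    congr 1
    have : (-(1 / 2) * log w : ℂ) = ((-(1 / 2) : ℝ) : ℂ) * log w := by push_cast; ring
    rw [this, re_ofReal_mul, log_re]; ring
  rw [e, norm_mul, norm_mul, norm_mul, h2, norm_exp (w * log w - w - lam * w), norm_real,
    Real.norm_eq_abs, abs_of_nonneg (Real.sqrt_nonneg _), mul_assoc]
  gcongr
  rfl

/-! ### Integrals over rectangles and the residue theorem. -/

/-- The integral of `f` over the lower, right and upper sides of the rectangle
`[a, c] × [-Y, Y]`, taken counterclockwise. -/
def threeSideIntegral (f : ℂ → ℂ) (a c Y : ℝ) : ℂ :=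
  (∫ x : ℝ in a..c, f (x + (-Y : ℝ) * I)) - (∫ x : ℝ in a..c, f (x + Y * I)) +
    I * ∫ y : ℝ in -Y..Y, f (c + y * I)

/-- The integral of `f` over the left side of the rectangle `[a, c] × [-Y, Y]`, upwards. -/
def leftSideIntegral (f : ℂ → ℂ) (a Y : ℝ) : ℂ := I * ∫ y : ℝ in -Y..Y, f (a + y * I)

/-- The integral of `f` over the boundary of the rectangle `[a, c] × [-Y, Y]`. -/
def rectIntegral (f : ℂ → ℂ) (a c Y : ℝ) : ℂ := threeSideIntegral f a c Y - leftSideIntegral f a Y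

/-- The boundary of the rectangle `[a, c] × [-Y, Y]`. -/
def rectFrame (a c Y : ℝ) : Set ℂ := (Icc a c ×ℂ Icc (-Y) Y) \ (Ioo a c ×ℂ Ioo (-Y) Y)

section

variable {a c Y : ℝ}

lemma horizontal_mem_rectFrame {x y : ℝ} (hx : x ∈ Icc a c) (hy : |y| = Y) :
    (x : ℂ) + y * I ∈ rectFrame a c Y := by
  have h1 := abs_le.1 hy.le
  refine ⟨⟨by simpa using hx, by simpa using h1⟩, fun h => ?_⟩
  have h2 : (-Y < y) ∧ y < Y := by simpa using h.2
  exact (abs_lt.2 h2).ne hy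

lemma vertical_mem_rectFrame {x y : ℝ} (hac : a ≤ c) (hx : x = a ∨ x = c) (hy : y ∈ Icc (-Y) Y) :
    (x : ℂ) + y * I ∈ rectFrame a c Y := by
  rcases hx with rfl | rfl <;> simp_all [rectFrame, mem_reProdIm]

lemma intervalIntegrable_horizontal {f : ℂ → ℂ} (hf : ContinuousOn f (rectFrame a c Y))
    (hac : a ≤ c) {y : ℝ} (hy : |y| = Y) :
    IntervalIntegrable (fun x : ℝ => f (x + y * I)) MeasureTheory.volume a c := by
  apply ContinuousOn.intervalIntegrable
  rw [uIcc_of_le hac]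
  exact hf.comp (by fun_prop) fun x hx => horizontal_mem_rectFrame hx hy

lemma intervalIntegrable_vertical {f : ℂ → ℂ} (hf : ContinuousOn f (rectFrame a c Y))
    (hac : a ≤ c) (hY : 0 ≤ Y) {x : ℝ} (hx : x = a ∨ x = c) :
    IntervalIntegrable (fun y : ℝ => f (x + y * I)) MeasureTheory.volume (-Y) Y := by
  apply ContinuousOn.intervalIntegrable
  rw [uIcc_of_le (by linarith)]
  exact hf.comp (by fun_prop) fun y hy => vertical_mem_rectFrame hac hx hy

lemma threeSideIntegral_sub {f g : ℂ → ℂ} (hf : ContinuousOn f (rectFrame a c Y))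
    (hg : ContinuousOn g (rectFrame a c Y)) (hac : a ≤ c) (hY : 0 ≤ Y) :
    threeSideIntegral (fun w => f w - g w) a c Y =
      threeSideIntegral f a c Y - threeSideIntegral g a c Y := by
  have h1 : |(-Y)| = Y := by rw [abs_neg, abs_of_nonneg hY]
  have h2 : |Y| = Y := abs_of_nonneg hY
  rw [threeSideIntegral, intervalIntegral.integral_sub (intervalIntegrable_horizontal hf hac h1)
    (intervalIntegrable_horizontal hg hac h1),
    intervalIntegral.integral_sub (intervalIntegrable_horizontal hf hac h2)
    (intervalIntegrable_horizontal hg hac h2),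
    intervalIntegral.integral_sub (intervalIntegrable_vertical hf hac hY (Or.inr rfl))
    (intervalIntegrable_vertical hg hac hY (Or.inr rfl)), threeSideIntegral, threeSideIntegral]
  ring

lemma leftSideIntegral_sub {f g : ℂ → ℂ} (hf : ContinuousOn f (rectFrame a c Y))
    (hg : ContinuousOn g (rectFrame a c Y)) (hac : a ≤ c) (hY : 0 ≤ Y) :
    leftSideIntegral (fun w => f w - g w) a Y =
      leftSideIntegral f a Y - leftSideIntegral g a Y := by
  rw [leftSideIntegral,
    intervalIntegral.integral_sub (intervalIntegrable_vertical hf hac hY (Or.inl rfl))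
    (intervalIntegrable_vertical hg hac hY (Or.inl rfl)), leftSideIntegral,
    leftSideIntegral]
  ring

lemma rectIntegral_sub {f g : ℂ → ℂ} (hf : ContinuousOn f (rectFrame a c Y))
    (hg : ContinuousOn g (rectFrame a c Y)) (hac : a ≤ c) (hY : 0 ≤ Y) :
    rectIntegral (fun w => f w - g w) a c Y = rectIntegral f a c Y - rectIntegral g a c Y := by
  rw [rectIntegral, threeSideIntegral_sub hf hg hac hY, leftSideIntegral_sub hf hg hac hY,
    rectIntegral, rectIntegral]
  ring

lemma threeSideIntegral_const_mul (f : ℂ → ℂ) (k : ℂ) :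
    threeSideIntegral (fun w => k * f w) a c Y = k * threeSideIntegral f a c Y := by
  simp only [threeSideIntegral, intervalIntegral.integral_const_mul]
  ring

lemma rectIntegral_const_mul (f : ℂ → ℂ) (k : ℂ) :
    rectIntegral (fun w => k * f w) a c Y = k * rectIntegral f a c Y := by
  simp only [rectIntegral, threeSideIntegral, leftSideIntegral, intervalIntegral.integral_const_mul]
  ring

lemma rectIntegral_congr {f g : ℂ → ℂ} (h : EqOn f g (rectFrame a c Y)) (hac : a ≤ c)
    (hY : 0 ≤ Y) : rectIntegral f a c Y = rectIntegral g a c Y := by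
  have h1 : |(-Y)| = Y := by rw [abs_neg, abs_of_nonneg hY]
  have h2 : |Y| = Y := abs_of_nonneg hY
  have hYY : -Y ≤ Y := by linarith
  rw [rectIntegral, rectIntegral, threeSideIntegral, threeSideIntegral, leftSideIntegral,
    leftSideIntegral]
  congr 1
  · congr 1
    · congr 1
      · refine intervalIntegral.integral_congr fun x hx => h ?_
        rw [uIcc_of_le hac] at hx
        exact horizontal_mem_rectFrame hx h1
      · refine intervalIntegral.integral_congr fun x hx => h ?_
        rw [uIcc_of_le hac] at hx
        exact horizontal_mem_rectFrame hx h2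
    · congr 1
      refine intervalIntegral.integral_congr fun x hx => h ?_
      rw [uIcc_of_le hYY] at hx
      exact vertical_mem_rectFrame hac (Or.inr rfl) hx
  · congr 1
    refine intervalIntegral.integral_congr fun x hx => h ?_
    rw [uIcc_of_le hYY] at hx
    exact vertical_mem_rectFrame hac (Or.inl rfl) hx

lemma rectIntegral_eq_zero {f : ℂ → ℂ} (hac : a ≤ c) (hY : 0 ≤ Y)
    (hf : DifferentiableOn ℂ f (Icc a c ×ℂ Icc (-Y) Y)) : rectIntegral f a c Y = 0 := by
  have := integral_boundary_rect_eq_zero_of_differentiableOn f (a + (-Y : ℝ) * I) (c + Y * I)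
    (by simpa [uIcc_of_le hac, uIcc_of_le (by linarith : -Y ≤ Y)] using hf)
  simpa [rectIntegral, threeSideIntegral, leftSideIntegral] using! this

lemma integral_inv_horizontal {p : ℂ} {y : ℝ} (hy : y ≠ p.im) :
    ∫ x : ℝ in a..c, ((x : ℂ) + y * I - p)⁻¹ = log (c + y * I - p) - log (a + y * I - p) := by
  have hs : ∀ x : ℝ, (x : ℂ) + y * I - p ∈ slitPlane := fun x => by
    rw [mem_slitPlane_iff]; right
    simpa using sub_ne_zero.2 hy
  refine intervalIntegral.integral_eq_sub_of_hasDerivAt (f := fun x : ℝ => log (x + y * I - p))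
    (fun x _ => ?_) ?_
  · have e1 : HasDerivAt (fun x : ℝ => (x : ℂ) + y * I - p) 1 x := by
      simpa using (((hasDerivAt_id x).ofReal_comp.add_const (y * I)).sub_const p)
    simpa using e1.clog_real (hs x)
  · apply Continuous.intervalIntegrable
    exact Continuous.inv₀ (by fun_prop) fun x => slitPlane_ne_zero (hs x)

lemma integral_inv_vertical_of_re_lt {p : ℂ} {x : ℝ} (hx : p.re < x) (u v : ℝ) :
    I * ∫ y : ℝ in u..v, ((x : ℂ) + y * I - p)⁻¹ = log (x + v * I - p) - log (x + u * I - p) := by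
  have hs : ∀ y : ℝ, (x : ℂ) + y * I - p ∈ slitPlane := fun y => by
    rw [mem_slitPlane_iff]; left
    simpa using hx
  rw [← intervalIntegral.integral_const_mul]
  refine intervalIntegral.integral_eq_sub_of_hasDerivAt (f := fun y : ℝ => log (x + y * I - p))
    (fun y _ => ?_) ?_
  · have e1 : HasDerivAt (fun y : ℝ => (x : ℂ) + y * I - p) I y := by
      simpa using ((((hasDerivAt_id y).ofReal_comp.mul_const I).const_add (x : ℂ)).sub_const p)
    simpa [div_eq_mul_inv] using e1.clog_real (hs y)
  · apply Continuous.intervalIntegrable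
    exact continuous_const.mul
      (Continuous.inv₀ (by fun_prop) fun x => slitPlane_ne_zero (hs x))

lemma integral_inv_vertical_of_lt_re {p : ℂ} {x : ℝ} (hx : x < p.re) (u v : ℝ) :
    I * ∫ y : ℝ in u..v, ((x : ℂ) + y * I - p)⁻¹ =
      log (-(x + v * I - p)) - log (-(x + u * I - p)) := by
  have hs : ∀ y : ℝ, -((x : ℂ) + y * I - p) ∈ slitPlane := fun y => by
    rw [mem_slitPlane_iff]; left
    simpa using hx
  rw [← intervalIntegral.integral_const_mul]
  refine intervalIntegral.integral_eq_sub_of_hasDerivAt (f := fun y : ℝ => log (-(x + y * I - p)))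
    (fun y _ => ?_) ?_
  · have e1 : HasDerivAt (fun y : ℝ => -((x : ℂ) + y * I - p)) (-I) y := by
      have e0 : HasDerivAt (fun y : ℝ => (x : ℂ) + y * I - p) I y := by
        simpa using ((((hasDerivAt_id y).ofReal_comp.mul_const I).const_add (x : ℂ)).sub_const p)
      exact e0.neg
    have e2 := e1.clog_real (hs y)
    rwa [neg_div_neg_eq, div_eq_mul_inv] at e2
  · apply Continuous.intervalIntegrable
    refine continuous_const.mul
      (Continuous.inv₀ (by fun_prop) fun x => ?_)
    have := slitPlane_ne_zero (hs x)
    exact neg_ne_zero.1 this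

/-- `log (w - p)` is a primitive along three sides, but its cut crosses the left side, where `log (p
- w)` serves instead. The two branches differ by `±πi` at the left corners, and these jumps give
`2πi`. -/
lemma rectIntegral_inv_sub {p : ℂ} (hp : p ∈ Ioo a c ×ℂ Ioo (-Y) Y) :
    rectIntegral (fun w => (w - p)⁻¹) a c Y = 2 * Real.pi * I := by
  obtain ⟨⟨h1, h2⟩, h3, h4⟩ := hp
  rw [rectIntegral, threeSideIntegral, leftSideIntegral, integral_inv_horizontal h3.ne,
    integral_inv_horizontal h4.ne', integral_inv_vertical_of_re_lt h2,
    integral_inv_vertical_of_lt_re h1]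
  have e1 : log (-((a : ℂ) + Y * I - p)) = log (a + Y * I - p) - Real.pi * I := by
    rw [log, log, norm_neg, arg_neg_eq_arg_sub_pi_of_im_pos (by simpa using h4)]
    push_cast; ring
  have e2 : log (-((a : ℂ) + (-Y : ℝ) * I - p)) = log (a + (-Y : ℝ) * I - p) + Real.pi * I := by
    rw [log, log, norm_neg, arg_neg_eq_arg_add_pi_of_im_neg (by simpa using h3)]
    push_cast; ring
  rw [e1, e2]
  ring

/-- The residue theorem for functions with simple poles in a rectangle. -/
theorem rectIntegral_eq_sum_residues (S : Finset ℂ) (r : ℂ → ℂ) (hac : a ≤ c) (hY : 0 ≤ Y)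
    (hS : (S : Set ℂ) ⊆ Ioo a c ×ℂ Ioo (-Y) Y) (f : ℂ → ℂ)
    (hf : DifferentiableOn ℂ f ((Icc a c ×ℂ Icc (-Y) Y) \ S))
    (hr : ∀ p ∈ S, Tendsto (fun w => (w - p) * f w) (𝓝[≠] p) (𝓝 (r p))) :
    rectIntegral f a c Y = 2 * Real.pi * I * ∑ p ∈ S, r p := by
  classical
  induction S using Finset.induction_on generalizing f with
  | empty =>
    rw [Finset.sum_empty, mul_zero]
    exact rectIntegral_eq_zero hac hY (by simpa using hf)
  | insert p S hpS ih =>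
    rw [Finset.coe_insert, insert_subset_iff] at hS
    obtain ⟨hp, hS⟩ := hS
    set R := Icc a c ×ℂ Icc (-Y) Y with hR
    have hRp : R \ S ∈ 𝓝 p := by
      refine inter_mem ?_ (S.finite_toSet.isClosed.isOpen_compl.mem_nhds (by simpa using hpS))
      exact mem_of_superset ((isOpen_Ioo.reProdIm isOpen_Ioo).mem_nhds hp)
        (inter_subset_inter (preimage_mono Ioo_subset_Icc_self) (preimage_mono Ioo_subset_Icc_self))
    -- Subtracting the polar part at `p` leaves a removable singularity, so after one value is
    -- redefined the induction hypothesis applies with one pole fewer. A value `r p = 0` is allowed.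
    set f₁ : ℂ → ℂ := fun w => f w - r p * (w - p)⁻¹ with hf₁
    have hset : (R \ S) \ {p} = R \ (insert p S : Finset ℂ) := by
      ext w; simp [not_or]; tauto
    have hinv : DifferentiableOn ℂ (fun w => r p * (w - p)⁻¹) {p}ᶜ := by
      intro w hw
      have : w - p ≠ 0 := sub_ne_zero.2 hw
      fun_prop (disch := assumption)
    have hd₁ : DifferentiableOn ℂ f₁ ((R \ S) \ {p}) := by
      rw [hset]
      refine hf.sub (hinv.mono fun w hw => ?_)
      rw [← hset] at hw
      exact hw.2
    have ho : (fun w => f₁ w - f₁ p) =o[𝓝[≠] p] fun w => (w - p)⁻¹ := by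
      rw [isLittleO_iff_tendsto']
      · have h1 : Tendsto (fun w => w - p) (𝓝[≠] p) (𝓝 0) := by
          have : Tendsto (fun w => w - p) (𝓝 p) (𝓝 (p - p)) := tendsto_id.sub_const p
          rw [sub_self] at this
          exact this.mono_left nhdsWithin_le_nhds
        have h2 := ((hr p (Finset.mem_insert_self _ _)).sub_const (r p)).sub (h1.mul_const (f₁ p))
        simp only [sub_self, zero_mul] at h2
        refine h2.congr' ?_
        filter_upwards [self_mem_nhdsWithin] with w hw
        have : w - p ≠ 0 := sub_ne_zero.2 hw
        simp only [hf₁]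
        field_simp
      · filter_upwards [self_mem_nhdsWithin] with w hw h0
        exact absurd (inv_eq_zero.1 h0) (sub_ne_zero.2 hw)
    set F := Function.update f₁ p (limUnder (𝓝[≠] p) f₁) with hF
    have hFd : DifferentiableOn ℂ F (R \ S) :=
      differentiableOn_update_limUnder_of_isLittleO hRp hd₁ ho
    have hFf : ∀ w, w ≠ p → F w = f₁ w := fun w hw => Function.update_of_ne hw _ _
    have key := ih hS F hFd (fun q hq => by
      have hqp : q ≠ p := fun h => hpS (h ▸ hq)
      have h1 : Tendsto (fun w => (w - q) * (r p * (w - p)⁻¹)) (𝓝[≠] q) (𝓝 0) := by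
        have : Tendsto (fun w => (w - q) * (r p * (w - p)⁻¹)) (𝓝 q)
            (𝓝 ((q - q) * (r p * (q - p)⁻¹))) := by
          refine (tendsto_id.sub_const q).mul (Tendsto.const_mul _ (Tendsto.inv₀ ?_ ?_))
          · exact tendsto_id.sub_const p
          · exact sub_ne_zero.2 hqp
        rw [sub_self, zero_mul] at this
        exact this.mono_left nhdsWithin_le_nhds
      have h2 := (hr q (Finset.mem_insert_of_mem hq)).sub h1
      rw [sub_zero] at h2
      refine h2.congr' ?_
      filter_upwards [mem_nhdsWithin_of_mem_nhds (isOpen_compl_singleton.mem_nhds hqp)] with w hw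
      rw [hFf w hw, hf₁]; ring)
    have hframe : ∀ w ∈ rectFrame a c Y, w ∈ R ∧ w ∉ (insert p S : Finset ℂ) := by
      intro w hw
      refine ⟨hw.1, fun h => hw.2 ?_⟩
      rcases Finset.mem_insert.1 h with rfl | h
      · exact hp
      · exact hS h
    have h1 : rectIntegral F a c Y =
        rectIntegral f a c Y - rectIntegral (fun w => r p * (w - p)⁻¹) a c Y := by
      rw [← rectIntegral_sub _ _ hac hY]
      · refine rectIntegral_congr (fun w hw => hFf w ?_) hac hY
        rintro rfl
        exact (hframe _ hw).2 (Finset.mem_insert_self _ _)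
      · exact hf.continuousOn.mono fun w hw => ⟨(hframe w hw).1, by simpa using (hframe w hw).2⟩
      · refine hinv.continuousOn.mono fun w hw h => (hframe w hw).2 ?_
        rw [mem_singleton_iff.1 h]
        exact Finset.mem_insert_self _ _
    rw [rectIntegral_const_mul, rectIntegral_inv_sub hp, key] at h1
    rw [Finset.sum_insert hpS]
    linear_combination -h1

end

/-! ### Residues of the Gamma kernel and their sums. -/

/-- The residue of a function with an at most simple pole. -/
def simpleResidue (f : ℂ → ℂ) (p : ℂ) : ℂ := limUnder (𝓝[≠] p) fun w => (w - p) * f w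

lemma tendsto_natCast_add_mul_Gamma (m : ℕ) :
    Tendsto (fun s => (s - (-m : ℂ)) * Gamma s) (𝓝[≠] (-m : ℂ)) (𝓝 ((-1) ^ m / m.factorial)) := by
  induction m with
  | zero => simpa using tendsto_self_mul_Gamma_nhds_zero
  | succ m ih =>
    have hm : (-(m + 1 : ℕ) : ℂ) ≠ 0 := by
      rw [neg_ne_zero]; exact_mod_cast m.succ_ne_zero
    have h1 : Tendsto (fun s : ℂ => s + 1) (𝓝[≠] (-(m + 1 : ℕ) : ℂ)) (𝓝[≠] (-m : ℂ)) := by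
      refine tendsto_nhdsWithin_iff.2 ⟨?_, ?_⟩
      · have : Tendsto (fun s : ℂ => s + 1) (𝓝 (-(m + 1 : ℕ) : ℂ)) (𝓝 (-(m + 1 : ℕ) + 1)) :=
          tendsto_id.add_const 1
        have e : (-(m + 1 : ℕ) + 1 : ℂ) = -m := by push_cast; ring
        rw [e] at this
        exact this.mono_left nhdsWithin_le_nhds
      · filter_upwards [self_mem_nhdsWithin] with s hs h
        apply hs
        simp only [mem_singleton_iff] at h ⊢
        push_cast
        linear_combination h
    have h2 : Tendsto (fun s : ℂ => s⁻¹) (𝓝[≠] (-(m + 1 : ℕ) : ℂ)) (𝓝 (-(m + 1 : ℕ) : ℂ)⁻¹) :=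
      (tendsto_inv₀ hm).mono_left nhdsWithin_le_nhds
    have h3 := (ih.comp h1).mul h2
    have e : (-1 : ℂ) ^ (m + 1) / (m + 1).factorial =
        (-1) ^ m / m.factorial * (-(m + 1 : ℕ) : ℂ)⁻¹ := by
      rw [Nat.factorial_succ, inv_neg]
      push_cast
      have : (m : ℂ) + 1 ≠ 0 := by exact_mod_cast m.succ_ne_zero
      have : (m.factorial : ℂ) ≠ 0 := by exact_mod_cast m.factorial_ne_zero
      field_simp
      ring
    rw [e]
    refine h3.congr' ?_
    filter_upwards [mem_nhdsWithin_of_mem_nhds (isOpen_compl_singleton.mem_nhds hm)] with s hs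
    have hs0 : s ≠ 0 := hs
    simp only [Function.comp]
    rw [Gamma_add_one s hs0]
    push_cast
    field_simp
    ring

/-- Positive `j` are included because the poles are indexed by `β`: when `α J = β J + 1` the point
with `k = 0` has Gamma argument `1`, is not a pole, and contributes zero. -/
lemma exists_tendsto_sub_intCast_mul_Gamma (j : ℤ) :
    ∃ r, Tendsto (fun s => (s - j) * Gamma s) (𝓝[≠] (j : ℂ)) (𝓝 r) := by
  rcases le_or_gt j 0 with hj | hj
  · obtain ⟨m, rfl⟩ : ∃ m : ℕ, j = -m := ⟨j.natAbs, by omega⟩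
    exact ⟨_, by simpa using tendsto_natCast_add_mul_Gamma m⟩
  · refine ⟨((j : ℂ) - j) * Gamma j, ?_⟩
    have : ContinuousAt Gamma (j : ℂ) := by
      refine (differentiableAt_Gamma _ fun m h => ?_).continuousAt
      have : j = -m := by exact_mod_cast h
      omega
    exact ((tendsto_id.sub_const _).mul this).mono_left nhdsWithin_le_nhds

section

variable {n : ℕ} {α β : Fin n → ℂ} {lam : ℂ}

/-- The (possible) poles of `∏_a Γ(β_a + w/n)`. -/
def gammaPole (β : Fin n → ℂ) (J : Fin n) (k : ℕ) : ℂ := -(n * (β J + k))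

lemma gammaPole_injective (hn : 0 < n) (hβ : ∀ a b, a ≠ b → ∀ k : ℤ, β a - β b ≠ k)
    {J J' : Fin n} {k k' : ℕ} (h : gammaPole β J k = gammaPole β J' k') : J = J' ∧ k = k' := by
  have hn0 : (n : ℂ) ≠ 0 := by exact_mod_cast hn.ne'
  rw [gammaPole, gammaPole, neg_inj, mul_right_inj' hn0] at h
  have hJ : J = J' := by
    by_contra hne
    apply hβ J J' hne (k' - k)
    push_cast
    linear_combination h
  subst hJ
  refine ⟨rfl, ?_⟩
  exact_mod_cast add_left_cancel h

lemma gammaKernel_differentiableAt (hn : 0 < n) (hαβ : ∀ a, α a = β a ∨ α a = β a + 1) {w : ℂ}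
    (hw : ∀ J k, w ≠ gammaPole β J k) : DifferentiableAt ℂ (gammaKernel α lam) w := by
  have hn0 : (n : ℂ) ≠ 0 := by exact_mod_cast hn.ne'
  unfold gammaKernel
  refine DifferentiableAt.mul (by fun_prop) ?_
  refine DifferentiableAt.fun_finsetProd fun a _ => ?_
  have : DifferentiableAt ℂ Gamma (α a + w / n) := by
    refine differentiableAt_Gamma _ fun m h => ?_
    have h' : w = -(n * (α a + m)) := by
      field_simp at h; linear_combination h
    rcases hαβ a with ha | ha
    · exact hw a m (by rw [h', ha, gammaPole])
    · exact hw a (m + 1) (by rw [h', ha, gammaPole]; push_cast; ring)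
  exact this.comp (f := fun w => α a + w / n) w (by fun_prop)

lemma gammaKernel_sub_natCast (hn : 0 < n) {w : ℂ} (hw : ∀ a, α a + w / n - 1 ≠ 0) :
    gammaKernel α lam (w - n) =
      exp (lam * n) / (∏ a, (α a + w / n - 1)) * gammaKernel α lam w := by
  have hn0 : (n : ℂ) ≠ 0 := by exact_mod_cast hn.ne'
  have h1 : ∀ a, Gamma (α a + w / n) = (α a + w / n - 1) * Gamma (α a + (w - n) / n) := by
    intro a
    have := Gamma_add_one (α a + w / n - 1) (hw a)
    rw [sub_add_cancel] at this
    rw [this]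
    congr 2
    field_simp
    ring
  have h2 : ∏ a, (α a + w / n - 1) ≠ 0 := Finset.prod_ne_zero_iff.2 fun a _ => hw a
  have h3 : exp (-(lam * (w - n))) = exp (lam * n) * exp (-(lam * w)) := by
    rw [← exp_add]; congr 1; ring
  simp only [gammaKernel, h1, Finset.prod_mul_distrib]
  rw [h3]
  generalize ∏ a, (α a + w / n - 1) = P at h2 ⊢
  field_simp

lemma exists_tendsto_gammaKernel (hn : 0 < n) (hαβ : ∀ a, α a = β a ∨ α a = β a + 1)
    (hβ : ∀ a b, a ≠ b → ∀ k : ℤ, β a - β b ≠ k) (J : Fin n) (k : ℕ) :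
    Tendsto (fun w => (w - gammaPole β J k) * gammaKernel α lam w) (𝓝[≠] gammaPole β J k)
      (𝓝 (simpleResidue (gammaKernel α lam) (gammaPole β J k))) := by
  have hn0 : (n : ℂ) ≠ 0 := by exact_mod_cast hn.ne'
  apply tendsto_nhds_limUnder
  set p := gammaPole β J k with hp
  have hpn : p / n = -(β J + k) := by rw [hp, gammaPole]; field_simp
  obtain ⟨j, hj⟩ : ∃ j : ℤ, α J + p / n = j := by
    rcases hαβ J with h | h
    · exact ⟨-k, by rw [h, hpn]; push_cast; ring⟩
    · exact ⟨1 - k, by rw [h, hpn]; push_cast; ring⟩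
  obtain ⟨r, hr⟩ := exists_tendsto_sub_intCast_mul_Gamma j
  have h1 : Tendsto (fun w : ℂ => α J + w / n) (𝓝[≠] p) (𝓝[≠] (j : ℂ)) := by
    refine tendsto_nhdsWithin_iff.2 ⟨?_, ?_⟩
    · have : Tendsto (fun w : ℂ => α J + w / n) (𝓝 p) (𝓝 (α J + p / n)) :=
        (tendsto_id.div_const _).const_add _
      rw [hj] at this
      exact this.mono_left nhdsWithin_le_nhds
    · filter_upwards [self_mem_nhdsWithin] with w hw h
      apply hw
      rw [mem_singleton_iff] at h ⊢
      rw [← hj] at h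
      field_simp at h
      linear_combination h
  have h2 : ∀ a ∈ Finset.univ.erase J, Tendsto (fun w : ℂ => Gamma (α a + w / n)) (𝓝[≠] p)
      (𝓝 (Gamma (α a + p / n))) := by
    intro a ha
    have hc : ContinuousAt Gamma (α a + p / n) := by
      refine (differentiableAt_Gamma _ fun m h => ?_).continuousAt
      rw [hpn] at h
      rcases hαβ a with h' | h'
      · exact hβ a J (Finset.ne_of_mem_erase ha) (k - m)
          (by rw [h'] at h; push_cast; linear_combination h)
      · exact hβ a J (Finset.ne_of_mem_erase ha) (k - m - 1)
          (by rw [h'] at h; push_cast; linear_combination h)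
    have : Tendsto (fun w : ℂ => α a + w / n) (𝓝 p) (𝓝 (α a + p / n)) :=
      (tendsto_id.div_const _).const_add _
    exact (hc.tendsto.comp this).mono_left nhdsWithin_le_nhds
  have h3 := tendsto_finsetProd _ h2
  have h4 : Tendsto (fun w : ℂ => exp (-(lam * w))) (𝓝[≠] p) (𝓝 (exp (-(lam * p)))) :=
    (Continuous.tendsto (by fun_prop) p).mono_left nhdsWithin_le_nhds
  refine ⟨_, (h4.mul (((hr.comp h1).mul h3).const_mul (n : ℂ))).congr fun w => ?_⟩
  simp only [Function.comp, gammaKernel]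
  rw [← Finset.mul_prod_erase Finset.univ _ (Finset.mem_univ J), ← hj]
  field_simp
  ring

/-- Translation by `-n` carries the `k`-th pole to the next, and `Γ(x + 1) = x Γ(x)` gives the ratio
of the kernels. For `k = 0` the denominator would vanish when `α J = β J + 1`. -/
lemma simpleResidue_gammaKernel_succ (hn : 0 < n) (hαβ : ∀ a, α a = β a ∨ α a = β a + 1)
    (hβ : ∀ a b, a ≠ b → ∀ k : ℤ, β a - β b ≠ k) (J : Fin n) {k : ℕ} (hk : 0 < k) :
    simpleResidue (gammaKernel α lam) (gammaPole β J (k + 1)) =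
      exp (lam * n) / (∏ a, (α a - β J - (k + 1))) *
        simpleResidue (gammaKernel α lam) (gammaPole β J k) := by
  have hn0 : (n : ℂ) ≠ 0 := by exact_mod_cast hn.ne'
  have hne : ∀ a, α a + gammaPole β J k / n - 1 = α a - β J - (k + 1) := by
    intro a; rw [gammaPole]; field_simp; ring
  have hne0 : ∀ a, α a + gammaPole β J k / n - 1 ≠ 0 := by
    intro a h
    rw [hne] at h
    by_cases ha : a = J
    · subst ha
      rcases hαβ a with h' | h' <;> rw [h'] at h
      · have : ((k + 1 : ℕ) : ℂ) = 0 := by push_cast; linear_combination -h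
        exact k.succ_ne_zero (by exact_mod_cast this)
      · have : (k : ℂ) = 0 := by linear_combination -h
        exact hk.ne' (by exact_mod_cast this)
    · rcases hαβ a with h' | h' <;> rw [h'] at h
      · exact hβ a J ha (k + 1) (by push_cast; linear_combination h)
      · exact hβ a J ha k (by push_cast; linear_combination h)
  have h1 : Tendsto (fun w : ℂ => w - n) (𝓝[≠] gammaPole β J k) (𝓝[≠] gammaPole β J (k + 1)) := by
    refine tendsto_nhdsWithin_iff.2 ⟨?_, ?_⟩
    · have : Tendsto (fun w : ℂ => w - n) (𝓝 (gammaPole β J k)) (𝓝 (gammaPole β J k - n)) :=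
        tendsto_id.sub_const _
      have e : gammaPole β J k - n = gammaPole β J (k + 1) := by
        rw [gammaPole, gammaPole]; push_cast; ring
      rw [e] at this
      exact this.mono_left nhdsWithin_le_nhds
    · filter_upwards [self_mem_nhdsWithin] with s hs h
      apply hs
      rw [mem_singleton_iff] at h ⊢
      rw [gammaPole] at h ⊢
      push_cast at h
      linear_combination h
  have h2 := (exists_tendsto_gammaKernel (lam := lam) hn hαβ hβ J (k + 1)).comp h1
  refine tendsto_nhds_unique h2 ?_
  have h3 : Tendsto (fun w : ℂ => exp (lam * n) / ∏ a, (α a + w / n - 1)) (𝓝[≠] gammaPole β J k)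
      (𝓝 (exp (lam * n) / ∏ a, (α a + gammaPole β J k / n - 1))) := by
    have : ContinuousAt (fun w : ℂ => exp (lam * n) / ∏ a, (α a + w / n - 1)) (gammaPole β J k) := by
      refine ContinuousAt.div (by fun_prop) (by fun_prop) ?_
      exact Finset.prod_ne_zero_iff.2 fun a _ => hne0 a
    exact this.tendsto.mono_left nhdsWithin_le_nhds
  simp only [hne] at h3
  refine (h3.mul (exists_tendsto_gammaKernel (lam := lam) hn hαβ hβ J k)).congr' ?_
  have hev : ∀ᶠ w : ℂ in 𝓝[≠] gammaPole β J k, ∀ a, α a + w / n - 1 ≠ 0 := by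
    rw [eventually_all]
    intro a
    refine mem_nhdsWithin_of_mem_nhds ?_
    have : ContinuousAt (fun w : ℂ => α a + w / n - 1) (gammaPole β J k) := by fun_prop
    exact this.eventually_ne (hne0 a)
  filter_upwards [hev] with w hw
  simp only [Function.comp]
  rw [gammaKernel_sub_natCast hn hw]
  have : w - n - gammaPole β J (k + 1) = w - gammaPole β J k := by
    rw [gammaPole, gammaPole]; push_cast; ring
  rw [this]
  ring

lemma norm_exp_div_prod_le_half (hn : 0 < n) {lam : ℂ} {x : Fin n → ℂ}
    (hx : ∀ a, 2 * ‖exp (lam * n)‖ + 1 ≤ ‖x a‖) : ‖exp (lam * n) / ∏ a, x a‖ ≤ 1 / 2 := by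
  set T := 2 * ‖exp (lam * n)‖ + 1 with hT
  have hT1 : 1 ≤ T := by linarith [norm_nonneg (exp (lam * n))]
  have h1 : T ≤ ‖∏ a, x a‖ := by
    rw [norm_prod]
    calc T ≤ T ^ n := le_self_pow₀ hT1 hn.ne'
      _ = ∏ _a : Fin n, T := by simp
      _ ≤ _ := Finset.prod_le_prod (fun _ _ => by linarith) fun a _ => hx a
  rw [norm_div, div_le_iff₀ (by linarith)]
  linarith

/-- Ratio test: the denominators in the recursion of the residues tend to infinity, so the series
converges for every `lam`. -/
lemma summable_simpleResidue_gammaKernel (hn : 0 < n) (hαβ : ∀ a, α a = β a ∨ α a = β a + 1)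
    (hβ : ∀ a b, a ≠ b → ∀ k : ℤ, β a - β b ≠ k) (J : Fin n) :
    Summable fun k => simpleResidue (gammaKernel α lam) (gammaPole β J k) := by
  set B := ∑ a, ‖α a - β J‖ with hB
  have hBa : ∀ a, ‖α a - β J‖ ≤ B := fun a =>
    Finset.single_le_sum (f := fun a => ‖α a - β J‖) (fun _ _ => norm_nonneg _) (Finset.mem_univ a)
  refine summable_of_ratio_norm_eventually_le (r := 1 / 2) (by norm_num) ?_
  filter_upwards [eventually_gt_atTop 0,
    tendsto_natCast_atTop_atTop.eventually_ge_atTop (B + (2 * ‖exp (lam * n)‖ + 1))] with k hk hk2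
  rw [simpleResidue_gammaKernel_succ hn hαβ hβ J hk, norm_mul]
  gcongr
  refine norm_exp_div_prod_le_half hn fun a => ?_
  have h1 := norm_sub_norm_le ((k : ℂ) + 1) (α a - β J)
  rw [norm_sub_rev ((k : ℂ) + 1)] at h1
  have h2 : ‖(k : ℂ) + 1‖ = k + 1 := by
    have : ((k : ℂ) + 1) = ((k + 1 : ℕ) : ℂ) := by push_cast; rfl
    rw [this, norm_natCast]; push_cast; rfl
  linarith [hBa a]

/-- The left sides move by the translation `w ↦ w - n`, under which the kernel eventually shrinks by
a factor of at least `2`. The condition on `X` keeps them off the poles. -/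
lemma tendsto_leftSideIntegral_gammaKernel (hn : 0 < n) (hαβ : ∀ a, α a = β a ∨ α a = β a + 1)
    {X : ℝ} (hX : ∀ a, ∀ j : ℤ, (β a).re - X / n ≠ j) {Y : ℝ} (hY : 0 ≤ Y) :
    Tendsto (fun N : ℕ => leftSideIntegral (gammaKernel α lam) (-(X + n * N)) Y) atTop (𝓝 0) := by
  have hn' : (0 : ℝ) < n := by exact_mod_cast hn
  have hn0 : (n : ℂ) ≠ 0 := by exact_mod_cast hn.ne'
  set B := ∑ a, ‖α a‖ with hB
  have hBa : ∀ a, ‖α a‖ ≤ B := fun a =>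
    Finset.single_le_sum (f := fun a => ‖α a‖) (fun _ _ => norm_nonneg _) (Finset.mem_univ a)
  set w : ℕ → ℝ → ℂ := fun N y => ((-(X + n * N) : ℝ) : ℂ) + y * I with hw
  have hwre : ∀ N y, (w N y).re = -(X + n * N) := fun N y => by simp [hw]
  obtain ⟨N₀, hN₀⟩ := exists_nat_ge (2 * ‖exp (lam * n)‖ + 1 + B + |X / n|)
  have hstep : ∀ N ≥ N₀, ∀ y, ‖gammaKernel α lam (w (N + 1) y)‖ ≤
      1 / 2 * ‖gammaKernel α lam (w N y)‖ := by
    intro N hN y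
    have hN' : (N₀ : ℝ) ≤ N := by exact_mod_cast hN
    have hlow : ∀ a, 2 * ‖exp (lam * n)‖ + 1 ≤ ‖α a + w N y / n - 1‖ := by
      intro a
      have h1 := abs_re_le_norm (α a + w N y / n - 1)
      have h2 : (α a + w N y / n - 1).re = (α a).re - X / n - N - 1 := by
        rw [sub_re, add_re, div_natCast_re, hwre, one_re]; field_simp; ring
      rw [h2] at h1
      have h3 := (abs_re_le_norm (α a)).trans (hBa a)
      rw [abs_le] at h3
      have h4 := neg_abs_le (X / n)
      have h5 := neg_le_abs ((α a).re - X / n - N - 1)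
      linarith
    have e : w (N + 1) y = w N y - n := by simp only [hw]; push_cast; ring
    rw [e, gammaKernel_sub_natCast hn, norm_mul]
    · gcongr
      exact norm_exp_div_prod_le_half hn hlow
    · intro a h
      have := hlow a
      rw [h, norm_zero] at this
      linarith [norm_nonneg (exp (lam * n))]
  have hcont : ContinuousOn (fun y => gammaKernel α lam (w N₀ y)) (Icc (-Y) Y) := by
    intro y _
    refine ContinuousAt.continuousWithinAt ?_
    have h1 : ContinuousAt (gammaKernel α lam) (w N₀ y) := by
      refine (gammaKernel_differentiableAt hn hαβ fun J k h => ?_).continuousAt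
      have h2 := congrArg re h
      rw [hwre, gammaPole] at h2
      have h3 : (-(n * (β J + k)) : ℂ).re = -(n * ((β J).re + k)) := by
        simp
      rw [h3] at h2
      apply hX J (N₀ - k)
      push_cast
      field_simp
      linarith
    exact h1.comp (f := w N₀) (by fun_prop)
  obtain ⟨M, hM⟩ := isCompact_Icc.exists_bound_of_continuousOn hcont
  have hbound : ∀ N, ∀ y ∈ Icc (-Y) Y, ‖gammaKernel α lam (w (N + N₀) y)‖ ≤ (1 / 2) ^ N * M := by
    intro N y hy
    induction N with
    | zero => simpa using hM y hy
    | succ N ih =>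
      have := hstep (N + N₀) (by omega) y
      rw [show N + 1 + N₀ = N + N₀ + 1 by ring]
      refine this.trans ?_
      rw [pow_succ', mul_assoc]
      gcongr
  rw [← tendsto_add_atTop_iff_nat N₀]
  have hlim : Tendsto (fun N : ℕ => ((1 / 2 : ℝ) ^ N * M) * |Y - -Y|) atTop (𝓝 0) := by
    have := ((tendsto_pow_atTop_nhds_zero_of_lt_one (r := (1 / 2 : ℝ)) (by norm_num)
      (by norm_num)).mul_const M).mul_const |Y - -Y|
    simpa using this
  refine squeeze_zero_norm (fun N => ?_) hlim
  rw [leftSideIntegral, norm_mul, norm_I, one_mul]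
  refine intervalIntegral.norm_integral_le_of_norm_le_const fun y hy => ?_
  rw [uIoc_of_le (by linarith)] at hy
  exact hbound N y (Ioc_subset_Icc_self hy)

/-- A substitute for an infinite contour open to the left: by the residue theorem the three sides
give the residues enclosed so far plus the integral over the left side, which tends to zero. -/
lemma tendsto_threeSideIntegral_gammaKernel (hn : 0 < n)
    (hαβ : ∀ a, α a = β a ∨ α a = β a + 1) (hβ : ∀ a b, a ≠ b → ∀ k : ℤ, β a - β b ≠ k)
    {X : ℝ} (hX : ∀ a, ∀ j : ℤ, (β a).re - X / n ≠ j) {c Y : ℝ} (hY : 0 ≤ Y)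
    (hc : ∀ a, -(n * (β a).re) < c) (hYβ : ∀ a, n * |(β a).im| < Y) :
    Tendsto (fun N : ℕ => threeSideIntegral (gammaKernel α lam) (-(X + n * N)) c Y) atTop
      (𝓝 (2 * Real.pi * I *
        ∑ J, ∑' k, simpleResidue (gammaKernel α lam) (gammaPole β J k))) := by
  classical
  have hn' : (0 : ℝ) < n := by exact_mod_cast hn
  set r := simpleResidue (gammaKernel α lam) with hr
  -- The number of points of the `J`-th sequence to the right of the left side.
  set Kn : Fin n → ℕ → ℕ := fun J N => ⌈X / n + N - (β J).re⌉₊ with hKn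
  have hKlim : ∀ J, Tendsto (Kn J) atTop atTop := by
    intro J
    refine tendsto_nat_ceil_atTop.comp ?_
    have := tendsto_atTop_add_const_left atTop (X / n - (β J).re)
      (tendsto_natCast_atTop_atTop (R := ℝ))
    refine this.congr fun N => ?_
    ring
  have hre : ∀ J k, (gammaPole β J k).re = -(n * ((β J).re + k)) := fun J k => by
    simp [gammaPole]
  have him : ∀ J k, (gammaPole β J k).im = -(n * (β J).im) := fun J k => by
    simp [gammaPole]
  have hsum : Tendsto (fun N : ℕ => 2 * Real.pi * I *
      ∑ J, ∑ k ∈ Finset.range (Kn J N), r (gammaPole β J k)) atTop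
      (𝓝 (2 * Real.pi * I * ∑ J, ∑' k, r (gammaPole β J k))) := by
    refine Tendsto.const_mul _ (tendsto_finsetSum _ fun J _ => ?_)
    exact (summable_simpleResidue_gammaKernel hn hαβ hβ J).hasSum.tendsto_sum_nat.comp (hKlim J)
  have hleft := tendsto_leftSideIntegral_gammaKernel (lam := lam) hn hαβ hX hY
  have htot := hsum.add hleft
  rw [add_zero] at htot
  refine htot.congr' ?_
  have hac : ∀ᶠ N : ℕ in atTop, -(X + n * N) ≤ c := by
    have : Tendsto (fun N : ℕ => X + n * (N : ℝ)) atTop atTop :=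
      tendsto_atTop_add_const_left _ _ (tendsto_natCast_atTop_atTop.const_mul_atTop hn')
    filter_upwards [this.eventually_ge_atTop (-c)] with N hN
    linarith
  filter_upwards [hac] with N hN
  set a := -(X + n * N) with ha
  have hlt : ∀ J k, k < Kn J N ↔ a < (gammaPole β J k).re := by
    intro J k
    rw [hKn, Nat.lt_ceil, hre, ha, neg_lt_neg_iff]
    have e : X + n * N = n * (X / n + N) := by field_simp
    rw [e, mul_lt_mul_iff_right₀ hn']
    constructor <;> intro h <;> linarith
  set S : Finset ℂ := (Finset.univ.sigma fun J => Finset.range (Kn J N)).image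
    (fun x : (_ : Fin n) × ℕ => gammaPole β x.1 x.2) with hS
  have hSsum : ∑ p ∈ S, r p = ∑ J, ∑ k ∈ Finset.range (Kn J N), r (gammaPole β J k) := by
    rw [hS, Finset.sum_image, Finset.sum_sigma]
    rintro ⟨J, k⟩ _ ⟨J', k'⟩ _ h
    obtain ⟨rfl, rfl⟩ := gammaPole_injective hn hβ h
    rfl
  have hres := rectIntegral_eq_sum_residues S r hN hY (f := gammaKernel α lam) ?_ ?_ ?_
  · rw [rectIntegral, hSsum] at hres
    rw [← hres]; ring
  · intro p hp
    simp only [hS, Finset.coe_image, Set.mem_image, Finset.mem_coe, Finset.mem_sigma,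
      Finset.mem_univ, true_and, Finset.mem_range] at hp
    obtain ⟨⟨J, k⟩, hk, rfl⟩ := hp
    refine ⟨⟨(hlt J k).1 hk, ?_⟩, ?_⟩
    · have := hc J
      have h2 : (0 : ℝ) ≤ n * k := by positivity
      show (gammaPole β J k).re < c
      rw [hre, mul_add]; linarith
    · show (gammaPole β J k).im ∈ Ioo (-Y) Y
      have := hYβ J
      rw [← abs_of_pos hn', ← abs_mul, abs_lt] at this
      rw [him]
      constructor <;> linarith
  · intro w hw
    refine (gammaKernel_differentiableAt hn hαβ fun J k h => hw.2 ?_).differentiableWithinAt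
    have h1 : a ≤ w.re := hw.1.1.1
    simp only [hS, Finset.coe_image, Set.mem_image, Finset.mem_coe, Finset.mem_sigma,
      Finset.mem_univ, true_and, Finset.mem_range]
    refine ⟨⟨J, k⟩, (hlt J k).2 (lt_of_le_of_ne (h ▸ h1) fun h2 => ?_), h.symm⟩
    rw [hre, ha] at h2
    apply hX J (N - k)
    push_cast
    field_simp
    linarith
  · intro p hp
    simp only [hS, Finset.mem_image, Finset.mem_sigma,
      Finset.mem_univ, true_and, Finset.mem_range] at hp
    obtain ⟨⟨J, k⟩, hk, rfl⟩ := hp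
    exact exists_tendsto_gammaKernel hn hαβ hβ J k

end

/-! ### Contours through or near the saddle point `w = S`. -/

lemma gammaExponent_log (S w : ℂ) : gammaExponent (log S) w =
    w.re * (Real.log ‖w‖ - Real.log ‖S‖ - 1) - w.im * (arg w - arg S) := by
  simp [gammaExponent, log_re, log_im]
  ring

lemma gammaExponent_log_self (S : ℂ) : gammaExponent (log S) S = -S.re := by
  rw [gammaExponent_log]; ring

lemma gammaExponent_conj {S w : ℂ} (hS : S ∈ slitPlane) (hw : w ∈ slitPlane) :
    gammaExponent (log (starRingEnd ℂ S)) (starRingEnd ℂ w) = gammaExponent (log S) w := by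
  rw [gammaExponent_log, gammaExponent_log, norm_conj, norm_conj, arg_conj, arg_conj,
    if_neg (mem_slitPlane_iff_arg.1 hw).1, if_neg (mem_slitPlane_iff_arg.1 hS).1, conj_re, conj_im]
  ring

/-- The derivative of `w log w - w - λ w` is `log w - λ`, so this is the mean value inequality along
a segment avoiding the cut. On vertical segments the sign depends only on `arg w - arg S`, on
horizontal ones only on `log ‖w‖ - log ‖S‖`. -/
lemma gammaExponent_le_of_segment {lam w₀ w₁ : ℂ} {B : ℝ}
    (h : ∀ t ∈ Icc (0 : ℝ) 1, w₀ + t * (w₁ - w₀) ∈ slitPlane ∧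
      ((w₁ - w₀) * (log (w₀ + t * (w₁ - w₀)) - lam)).re ≤ B) :
    gammaExponent lam w₁ ≤ gammaExponent lam w₀ + B := by
  set γ : ℝ → ℂ := fun t => w₀ + t * (w₁ - w₀) with hγ
  have hd : ∀ t ∈ Icc (0 : ℝ) 1, HasDerivAt (fun t => gammaExponent lam (γ t))
      ((w₁ - w₀) * (log (γ t) - lam)).re t := by
    intro t ht
    have e1 : HasDerivAt (fun t : ℝ => w₀ + t * (w₁ - w₀)) (w₁ - w₀) t := by
      simpa using ((hasDerivAt_id t).ofReal_comp.mul_const (w₁ - w₀)).const_add w₀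
    have e2 := ((e1.mul (e1.clog_real (h t ht).1)).sub e1).sub (e1.const_mul lam)
    have hne : γ t ≠ 0 := slitPlane_ne_zero (h t ht).1
    have e3 : (w₁ - w₀) * log (γ t) + γ t * ((w₁ - w₀) / γ t) - (w₁ - w₀) - lam * (w₁ - w₀) =
        (w₁ - w₀) * (log (γ t) - lam) := by
      field_simp; ring
    rw [e3] at e2
    have e4 := (reCLM.hasFDerivAt (x := γ t * log (γ t) - γ t - lam * γ t)).comp_hasDerivAt t e2
    simpa using! e4
  have key := (convex_Icc (0 : ℝ) 1).image_sub_le_mul_sub_of_deriv_le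
    (f := fun t => gammaExponent lam (γ t))
    (fun t ht => (hd t ht).continuousAt.continuousWithinAt)
    (fun t ht => (hd t (interior_subset ht)).differentiableAt.differentiableWithinAt)
    (C := B) (fun t ht => by
      rw [(hd t (interior_subset ht)).deriv]; exact (h t (interior_subset ht)).2)
    0 (by simp) 1 (by simp) zero_le_one
  have h0 : γ 0 = w₀ := by simp [hγ]
  have h1 : γ 1 = w₁ := by simp [hγ]
  rw [h0, h1] at key
  linarith

lemma arg_le_arg_of_re_eq {w w' : ℂ} (hw : 0 < w.re) (hre : w'.re = w.re) (him : w.im ≤ w'.im) :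
    arg w ≤ arg w' := by
  have h : ∀ z : ℂ, 0 < z.re → arg z = Real.arctan (z.im / z.re) := by
    intro z hz
    have := abs_lt.1 (abs_arg_lt_pi_div_two_iff.2 (Or.inl hz))
    rw [← tan_arg, Real.arctan_tan this.1 this.2]
  rw [h w hw, h w' (hre ▸ hw), hre]
  exact Real.arctan_strictMono.monotone (by gcongr)

lemma mul_cos_le_sin {δ : ℝ} (h0 : 0 ≤ δ) (h1 : δ ≤ Real.pi / 2) : δ * Real.cos δ ≤ Real.sin δ := by
  rcases h1.eq_or_lt with rfl | h1
  · rw [Real.cos_pi_div_two, mul_zero, Real.sin_pi_div_two]; exact zero_le_one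
  · have hc : 0 < Real.cos δ := Real.cos_pos_of_mem_Ioo ⟨by linarith, h1⟩
    have := Real.le_tan h0 h1
    rwa [Real.tan_eq_sin_div_cos, le_div_iff₀ hc] at this

/-- With `δ = π/2 - arg z` the expression is `‖z‖ (sin δ - δ cos δ)`. -/
lemma re_add_im_mul_arg_nonneg {z : ℂ} (hre : 0 ≤ z.re) (him : 0 ≤ z.im) :
    0 ≤ z.re + z.im * (arg z - Real.pi / 2) := by
  have h1 := norm_mul_cos_arg z
  have h2 := norm_mul_sin_arg z
  have h3 := abs_le.1 (abs_arg_le_pi_div_two_iff.2 hre)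
  have h4 := arg_nonneg_iff.2 him
  have h5 := mul_cos_le_sin (δ := Real.pi / 2 - arg z) (by linarith) (by linarith)
  rw [Real.cos_pi_div_two_sub, Real.sin_pi_div_two_sub] at h5
  rw [← h1, ← h2]
  nlinarith [norm_nonneg z]

lemma re_add_im_mul_arg_nonpos {z : ℂ} (hre : z.re ≤ 0) (him : 0 < z.im) :
    z.re + z.im * (arg z - Real.pi / 2) ≤ 0 := by
  have h1 := norm_mul_cos_arg z
  have h2 := norm_mul_sin_arg z
  have h3 := arg_le_pi z
  have h4 : Real.pi / 2 ≤ arg z := by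
    rcases hre.eq_or_lt with h | h
    · rw [(arg_eq_pi_div_two_iff).2 ⟨h, him⟩]
    · by_contra hlt
      push Not at hlt
      have := (abs_arg_lt_pi_div_two_iff (z := z)).1
        (abs_lt.2 ⟨by linarith [arg_nonneg_iff.2 him.le, Real.pi_pos], hlt⟩)
      rcases this with h' | h'
      · linarith
      · rw [h'] at him; simp at him
  have h5 := mul_cos_le_sin (δ := arg z - Real.pi / 2) (by linarith) (by linarith)
  rw [Real.cos_sub_pi_div_two, Real.sin_sub_pi_div_two] at h5
  rw [← h1, ← h2]
  nlinarith [norm_nonneg z]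

/-- Up to `|Re w| = e^{10} ‖S‖` the bound `B` suffices. Further left `log ‖w‖ - log ‖S‖ ≥ 10`, so
the exponent falls at least like `9 Re w`, which beats the argument term (at most `7 ‖S‖`, as `2π <
7`) and `Re S`. The resulting exponential decay is weakened to an integrable profile. -/
lemma exp_gammaExponent_le_of_horizontal {S w : ℂ} {B : ℝ} (hS : 1 ≤ ‖S‖) (hy : |w.im| ≤ ‖S‖)
    (hB : |w.re| ≤ Real.exp 10 * ‖S‖ → gammaExponent (log S) w + S.re ≤ B) (hx : w.re ≤ ‖S‖) :
    Real.exp (gammaExponent (log S) w + S.re) ≤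
      (Real.exp B * (1 + Real.exp 20) + 2) / (1 + (w.re / ‖S‖) ^ 2) := by
  have hSp : 0 < ‖S‖ := by linarith
  rw [le_div_iff₀ (by positivity)]
  by_cases h : |w.re| ≤ Real.exp 10 * ‖S‖
  · have h1 : (w.re / ‖S‖) ^ 2 ≤ Real.exp 20 := by
      have : |w.re / ‖S‖| ≤ Real.exp 10 := by
        rw [abs_div, abs_of_pos hSp, div_le_iff₀ hSp]; exact h
      rw [← sq_abs]
      calc |w.re / ‖S‖| ^ 2 ≤ Real.exp 10 ^ 2 := by gcongr
        _ = Real.exp 20 := by rw [← Real.exp_nat_mul]; norm_num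
    have h2 := Real.exp_le_exp.2 (hB h)
    calc _ ≤ Real.exp B * (1 + Real.exp 20) := by gcongr
      _ ≤ _ := by linarith
  · push Not at h
    have e10 : 1 ≤ Real.exp 10 := Real.one_le_exp (by norm_num)
    have hneg : w.re < 0 := by
      by_contra hp
      push Not at hp
      rw [abs_of_nonneg hp] at h
      nlinarith
    set ξ := -w.re with hξ
    rw [abs_of_neg hneg] at h
    have hξS : ‖S‖ ≤ ξ := by nlinarith
    have hwξ : ξ ≤ ‖w‖ := by
      have := abs_re_le_norm w
      rwa [abs_of_neg hneg] at this
    have hlog : 10 ≤ Real.log ‖w‖ - Real.log ‖S‖ := by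
      have : Real.exp 10 * ‖S‖ ≤ ‖w‖ := by linarith
      have := Real.log_le_log (by positivity) this
      rw [Real.log_mul (by positivity) hSp.ne', Real.log_exp] at this
      linarith
    have hE : gammaExponent (log S) w + S.re ≤ -(ξ / ‖S‖) := by
      rw [gammaExponent_log]
      have h1 : w.re * (Real.log ‖w‖ - Real.log ‖S‖ - 1) ≤ -(9 * ξ) := by
        have : w.re = -ξ := by rw [hξ]; ring
        rw [this]
        nlinarith
      have h2 : -(w.im * (arg w - arg S)) ≤ 7 * ‖S‖ := by
        refine (neg_le_abs _).trans ?_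
        rw [abs_mul]
        have : |arg w - arg S| ≤ 7 := by
          have a1 := abs_arg_le_pi w
          have a2 := abs_arg_le_pi S
          have := abs_sub (arg w) (arg S)
          linarith [Real.pi_lt_d2]
        calc |w.im| * |arg w - arg S| ≤ ‖S‖ * 7 := by gcongr
          _ = 7 * ‖S‖ := by ring
      have h3 := (le_abs_self _).trans (abs_re_le_norm S)
      have h4 : ξ / ‖S‖ ≤ ξ := div_le_self (by linarith) hS
      linarith
    set v := ξ / ‖S‖ with hv
    have hv0 : 0 ≤ v := div_nonneg (by linarith) (norm_nonneg _)
    have hwv : w.re / ‖S‖ = -v := by rw [hv, hξ]; ring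
    have h5 : Real.exp (gammaExponent (log S) w + S.re) ≤ Real.exp (-v) := Real.exp_le_exp.2 hE
    have h6 := Real.quadratic_le_exp_of_nonneg hv0
    have h7 : Real.exp (-v) * (1 + v ^ 2) ≤ 2 := by
      rw [Real.exp_neg, inv_mul_le_iff₀ (Real.exp_pos _)]
      nlinarith
    rw [hwv, neg_sq]
    calc _ ≤ Real.exp (-v) * (1 + v ^ 2) := by gcongr
      _ ≤ 2 := h7
      _ ≤ _ := by linarith [show 0 ≤ Real.exp B * (1 + Real.exp 20) by positivity]

/-- The rectangle of right side `c` and half height `Y` on which the function `e^{-w log S} Γ(w)`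
is bounded by its value at the saddle point `w = S`, up to powers and constants. -/
structure IsSaddleRectangle (κ K : ℝ) (S : ℂ) (c Y : ℝ) : Prop where
  le_right : K ≤ c
  right_le : c ≤ ‖S‖
  le_height : ‖S‖ ≤ κ * Y
  height_le : Y ≤ ‖S‖
  -- The power of `‖w‖ / ‖S‖` compensates the error factor `D⁻²` where the right side comes close to
  -- the origin compared with `‖S‖`.
  vertical : ∀ y : ℝ, |y| ≤ Y →
    Real.exp (gammaExponent (log S) (c + y * I) + S.re) ≤ κ * (‖(c + y * I : ℂ)‖ / ‖S‖) ^ 3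
  horizontal : ∀ x ≤ c, ∀ y : ℝ, |y| = Y →
    Real.exp (gammaExponent (log S) (x + y * I) + S.re) ≤ κ / (1 + (x / ‖S‖) ^ 2)

lemma IsSaddleRectangle.conj {κ K c Y : ℝ} {S : ℂ} (hS : S ∈ slitPlane) (hY : 0 < Y) (hc : 0 < c)
    (h : IsSaddleRectangle κ K S c Y) : IsSaddleRectangle κ K (starRingEnd ℂ S) c Y := by
  have hconj : ∀ x y : ℝ, ((x : ℂ) + y * I) = starRingEnd ℂ ((x : ℂ) + (-y : ℝ) * I) := by
    intro x y; simp
  have hn : ∀ x y : ℝ, ‖((x : ℂ) + (-y : ℝ) * I)‖ = ‖((x : ℂ) + y * I)‖ := by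
    intro x y; rw [hconj x y, norm_conj]
  have hs : ∀ x y : ℝ, 0 < x ∨ y ≠ 0 → ((x : ℂ) + y * I) ∈ slitPlane := by
    intro x y hxy
    rw [mem_slitPlane_iff]
    simpa using hxy
  refine ⟨h.le_right, by simpa using h.right_le, by simpa using h.le_height,
    by simpa using h.height_le, fun y hy => ?_, fun x hx y hy => ?_⟩
  · rw [norm_conj, ← hn, conj_re]
    have := h.vertical (-y) (by rwa [abs_neg])
    rwa [← gammaExponent_conj hS (hs c (-y) (Or.inl hc)), ← hconj] at this
  · rw [norm_conj, conj_re]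
    have := h.horizontal x hx (-y) (by rwa [abs_neg])
    rwa [← gammaExponent_conj hS (hs x (-y) (Or.inr fun h0 => ?_)), ← hconj] at this
    rw [neg_eq_zero.1 h0, abs_zero] at hy
    linarith

/-- The right side passes through `S`: on a vertical line in the right half plane `arg` increases
with height, so the exponent is largest at `S`. The horizontal sides lie at height `±‖S‖`, where
`‖w‖ ≥ ‖S‖` makes the exponent decrease to the left. -/
lemma exists_isSaddleRectangle_of_re_pos {u : ℂ} (hu : ‖u‖ = 1) (hre : 0 < u.re) (K : ℝ) :
    ∃ κ r₁ : ℝ, 0 < κ ∧ ∀ ρ ≥ r₁, ∃ c Y, IsSaddleRectangle κ K (ρ * u) c Y := by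
  set κ := Real.exp 0 * (1 + Real.exp 20) + 2 + (u.re ^ 3)⁻¹ with hκ
  have hκ0 : 0 ≤ (u.re ^ 3)⁻¹ := by positivity
  have hκ1 : 0 ≤ Real.exp 0 * (1 + Real.exp 20) := by positivity
  refine ⟨κ, max 1 (K / u.re), by positivity, fun ρ hρ => ⟨ρ * u.re, ρ, ?_⟩⟩
  have hρ1 : 1 ≤ ρ := le_trans (le_max_left _ _) hρ
  have hρ2 : K ≤ ρ * u.re := by
    rw [← div_le_iff₀ hre]; exact le_trans (le_max_right _ _) hρ
  have hρ0 : 0 < ρ := by linarith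
  set S : ℂ := ρ * u with hS
  have hSn : ‖S‖ = ρ := by rw [hS, norm_mul, hu, mul_one, norm_real, Real.norm_of_nonneg hρ0.le]
  have hSre : S.re = ρ * u.re := by rw [hS, re_ofReal_mul]
  have hSp : 0 < S.re := by rw [hSre]; positivity
  have hcρ : ρ * u.re ≤ ρ := by
    rw [← hSre, ← hSn]; exact re_le_norm S
  have hvert : ∀ y : ℝ, gammaExponent (log S) ((ρ * u.re : ℝ) + y * I) ≤ -S.re := by
    intro y
    rw [← gammaExponent_log_self S, ← add_zero (gammaExponent (log S) S)]
    apply gammaExponent_le_of_segment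
    intro t ht
    have e : ((ρ * u.re : ℝ) + y * I : ℂ) - S = ((y - S.im : ℝ) : ℂ) * I := by
      rw [← hSre]; apply Complex.ext <;> simp
    set wt := S + t * (((ρ * u.re : ℝ) + y * I : ℂ) - S) with hwt
    have hwre : wt.re = S.re := by rw [hwt, e]; simp
    have hwim : wt.im = S.im + t * (y - S.im) := by rw [hwt, e]; simp
    refine ⟨mem_slitPlane_iff.2 (Or.inl (by rw [hwre]; exact hSp)), ?_⟩
    rw [e]
    have e2 : (((y - S.im : ℝ) : ℂ) * I * (log wt - log S)).re =
        -((y - S.im) * (arg wt - arg S)) := by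
      rw [mul_assoc, re_ofReal_mul, mul_comm I, mul_I_re, sub_im, log_im, log_im]; ring
    rw [e2, neg_nonpos]
    rcases le_total S.im y with h | h
    · refine mul_nonneg (by linarith) (sub_nonneg.2 (arg_le_arg_of_re_eq hSp hwre ?_))
      rw [hwim]; nlinarith [ht.1]
    · refine mul_nonneg_of_nonpos_of_nonpos (by linarith)
        (sub_nonpos.2 (arg_le_arg_of_re_eq (hwre ▸ hSp) hwre.symm ?_))
      rw [hwim]; nlinarith [ht.1]
  have hhor : ∀ x ≤ ρ * u.re, ∀ y : ℝ, |y| = ρ →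
      gammaExponent (log S) (x + y * I) ≤ -S.re := by
    intro x hx y hy
    refine le_trans ?_ (hvert y)
    rw [← add_zero (gammaExponent (log S) ((ρ * u.re : ℝ) + y * I))]
    apply gammaExponent_le_of_segment
    intro t ht
    have e : ((x : ℂ) + y * I) - ((ρ * u.re : ℝ) + y * I) = ((x - ρ * u.re : ℝ) : ℂ) := by
      push_cast; ring
    set wt := ((ρ * u.re : ℝ) + y * I : ℂ) + t * (((x : ℂ) + y * I) - ((ρ * u.re : ℝ) + y * I))
      with hwt
    have hwim : wt.im = y := by rw [hwt, e]; simp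
    have hwn : ρ ≤ ‖wt‖ := by
      rw [← hy, ← hwim]; exact abs_im_le_norm wt
    refine ⟨mem_slitPlane_iff.2 (Or.inr fun h => ?_), ?_⟩
    · rw [hwim] at h
      rw [h, abs_zero] at hy
      linarith
    · rw [e, re_ofReal_mul, sub_re, log_re, log_re, hSn]
      refine mul_nonpos_of_nonpos_of_nonneg (by linarith) (sub_nonneg.2 ?_)
      exact Real.log_le_log hρ0 hwn
  refine ⟨hρ2, by rw [hSn]; exact hcρ, ?_, hSn.ge, fun y hy => ?_, fun x hx y hy => ?_⟩
  · rw [hSn]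
    have : 1 ≤ κ := by linarith
    nlinarith
  · have h1 : Real.exp (gammaExponent (log S) ((ρ * u.re : ℝ) + y * I) + S.re) ≤ 1 := by
      rw [Real.exp_le_one_iff]; linarith [hvert y]
    refine h1.trans ?_
    have h2 : u.re ≤ ‖((ρ * u.re : ℝ) + y * I : ℂ)‖ / ‖S‖ := by
      rw [hSn, le_div_iff₀ hρ0, mul_comm]
      have := re_le_norm ((ρ * u.re : ℝ) + y * I : ℂ)
      simpa using this
    calc 1 = (u.re ^ 3)⁻¹ * u.re ^ 3 := by field_simp
      _ ≤ κ * (‖((ρ * u.re : ℝ) + y * I : ℂ)‖ / ‖S‖) ^ 3 := by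
        gcongr
        linarith
  · have h1 := exp_gammaExponent_le_of_horizontal (S := S) (w := x + y * I) (B := 0)
      (by rw [hSn]; exact hρ1) (by simp [hSn, hy])
      (fun _ => by linarith [hhor x hx y hy]) (by simp [hSn]; linarith)
    refine h1.trans ?_
    have : ((x : ℂ) + y * I).re = x := by simp
    rw [this]
    gcongr
    linarith

/-- On the horizontal line through `S` the exponent grows to the right only where `‖w‖ > ‖S‖`.
Between `S` and abscissa `c` one has `‖w‖² ≤ ‖S‖² + c²`, so the slope is at most `c² / (2‖S‖²)` over
a length of at most `2‖S‖`. To the left of `S` the exponent decreases. -/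
lemma gammaExponent_horizontal_le {S : ℂ} (hS : 1 ≤ ‖S‖) (hSre0 : S.re ≤ 0)
    (hSimp : 0 < S.im) {c : ℝ} (hc0 : 0 ≤ c) (hcS : c ≤ ‖S‖) {x : ℝ} (hx : x ≤ c) :
    gammaExponent (log S) (x + S.im * I) ≤ -S.re + c ^ 2 := by
  obtain ⟨ρ, hSn⟩ : ∃ ρ, ‖S‖ = ρ := ⟨_, rfl⟩
  rw [hSn] at hS hcS
  have hS1 : 1 ≤ ρ := hS
  have hS0 : 0 < ρ := by linarith
  have hSren : -S.re ≤ ρ := by rw [← hSn]; exact (neg_le_abs _).trans (abs_re_le_norm S)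
  have hSq : S.re ^ 2 + S.im ^ 2 = ρ ^ 2 := by
    rw [← hSn, Complex.sq_norm, normSq_apply]; ring
  rw [← gammaExponent_log_self S]
  apply gammaExponent_le_of_segment
  intro t ht
  have e : ((x : ℂ) + S.im * I) - S = ((x - S.re : ℝ) : ℂ) := by
    apply Complex.ext <;> simp
  set wt := S + t * (((x : ℂ) + S.im * I) - S) with hwt
  have hwim : wt.im = S.im := by rw [hwt, e]; simp
  have hwre : wt.re = S.re + t * (x - S.re) := by rw [hwt, e]; simp
  have hwsq : ‖wt‖ ^ 2 = wt.re ^ 2 + S.im ^ 2 := by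
    rw [Complex.sq_norm, normSq_apply, hwim]; ring
  have hw0 : wt ≠ 0 := by
    intro h; rw [h] at hwim; simp at hwim; linarith
  have hwp : 0 < ‖wt‖ := norm_pos_iff.2 hw0
  refine ⟨mem_slitPlane_iff.2 (Or.inr (by rw [hwim]; exact hSimp.ne')), ?_⟩
  rw [e, re_ofReal_mul, sub_re, log_re, log_re, hSn]
  rcases le_total x S.re with h | h
  · have h1 : ρ ≤ ‖wt‖ := by
      rw [← sq_le_sq₀ hS0.le hwp.le, hwsq, ← hSq]
      have : wt.re ≤ S.re := by rw [hwre]; nlinarith [ht.1]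
      nlinarith
    have h2 := Real.log_le_log hS0 h1
    have : (x - S.re) * (Real.log ‖wt‖ - Real.log ρ) ≤ 0 :=
      mul_nonpos_of_nonpos_of_nonneg (by linarith) (by linarith)
    nlinarith
  · have h1 : ‖wt‖ ^ 2 ≤ ρ ^ 2 + c ^ 2 := by
      rw [hwsq, ← hSq]
      have a1 : S.re ≤ wt.re := by rw [hwre]; nlinarith [ht.1]
      have a2 : wt.re ≤ c := by rw [hwre]; nlinarith [ht.1, ht.2]
      rcases le_total 0 wt.re with h0 | h0 <;> nlinarith
    have h2 : 2 * (Real.log ‖wt‖ - Real.log ρ) ≤ c ^ 2 / ρ ^ 2 := by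
      have a1 := Real.log_le_sub_one_of_pos (x := ‖wt‖ ^ 2 / ρ ^ 2) (by positivity)
      rw [Real.log_div (by positivity) (by positivity), Real.log_pow, Real.log_pow] at a1
      have a2 : ‖wt‖ ^ 2 / ρ ^ 2 ≤ 1 + c ^ 2 / ρ ^ 2 := by
        rw [div_le_iff₀ (by positivity)]
        field_simp
        linarith
      push_cast at a1
      linarith
    have h3 : Real.log ‖wt‖ - Real.log ρ ≤ c ^ 2 / (2 * ρ ^ 2) := by
      have : c ^ 2 / ρ ^ 2 = 2 * (c ^ 2 / (2 * ρ ^ 2)) := by field_simp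
      linarith
    calc (x - S.re) * (Real.log ‖wt‖ - Real.log ρ) ≤ (x - S.re) * (c ^ 2 / (2 * ρ ^ 2)) := by
          gcongr
      _ ≤ (2 * ρ) * (c ^ 2 / (2 * ρ ^ 2)) := by
          gcongr; linarith
      _ = c ^ 2 / ρ := by field_simp
      _ ≤ c ^ 2 := div_le_self (by positivity) hS1

/-- Here a vertical line through `S` would leave poles on its right. Instead the upper side passes
through `S` and the right side stays at a fixed `c`; on it the exponent exceeds `-Re S` by at most
`c log (‖w‖/‖S‖)`, hence the choice `c ≥ 3`. -/
lemma exists_isSaddleRectangle_of_re_nonpos {u : ℂ} (hu : ‖u‖ = 1) (hre : u.re ≤ 0) (him : 0 < u.im)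
    (K : ℝ) : ∃ κ r₁ : ℝ, 0 < κ ∧ ∀ ρ ≥ r₁, ∃ c Y, IsSaddleRectangle κ K (ρ * u) c Y := by
  set c := max K 3 with hc
  have hc3 : 3 ≤ c := le_max_right _ _
  have hc0 : 0 < c := by linarith
  set κ := Real.exp (c ^ 2) * (1 + Real.exp 20) + 2 + u.im⁻¹ + 2 ^ c with hκ
  have hκ0 : 0 ≤ Real.exp (c ^ 2) * (1 + Real.exp 20) := by positivity
  have hκ1 : 0 < u.im⁻¹ := by positivity
  have hκ2 : 0 < (2 : ℝ) ^ c := by positivity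
  refine ⟨κ, c, by positivity, fun ρ hρ => ⟨c, ρ * u.im, ?_⟩⟩
  have hρ1 : 1 ≤ ρ := by linarith
  have hρ0 : 0 < ρ := by linarith
  set S : ℂ := ρ * u with hS
  have hSn : ‖S‖ = ρ := by rw [hS, norm_mul, hu, mul_one, norm_real, Real.norm_of_nonneg hρ0.le]
  have hSre : S.re = ρ * u.re := by rw [hS, re_ofReal_mul]
  have hSim : S.im = ρ * u.im := by rw [hS, im_ofReal_mul]
  have hSre0 : S.re ≤ 0 := by rw [hSre]; nlinarith
  have hSimp : 0 < S.im := by rw [hSim]; positivity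
  have hSimn : S.im ≤ ρ := by rw [← hSn]; exact (le_abs_self _).trans (abs_im_le_norm S)
  have hSren : -S.re ≤ ρ := by rw [← hSn]; exact (neg_le_abs _).trans (abs_re_le_norm S)
  have hSq : S.re ^ 2 + S.im ^ 2 = ρ ^ 2 := by
    rw [← hSn, Complex.sq_norm, normSq_apply]; ring
  have hargS := re_add_im_mul_arg_nonpos hSre0 hSimp
  have hargS0 : 0 ≤ arg S := arg_nonneg_iff.2 hSimp.le
  rw [← hSim]
  have hhor : ∀ x ≤ c, ∀ y : ℝ, |y| = S.im → gammaExponent (log S) (x + y * I) + S.re ≤ c ^ 2 := by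
    intro x hx y hy
    have h1 := gammaExponent_horizontal_le (S := S) (by rw [hSn]; exact hρ1) hSre0 hSimp hc0.le
      (by rw [hSn]; exact hρ) hx
    rcases eq_or_eq_neg_of_abs_eq hy with h | h
    · rw [h]; linarith
    · have hconj : ((x : ℂ) + y * I) = starRingEnd ℂ ((x : ℂ) + S.im * I) := by
        rw [h]; simp
      have hs : arg ((x : ℂ) + S.im * I) ≠ Real.pi := by
        refine (mem_slitPlane_iff_arg.1 (mem_slitPlane_iff.2 (Or.inr ?_))).1
        simpa using hSimp.ne'
      -- Conjugating `w` changes the exponent by `-2 (Im S) (arg S)`, which is not positive in the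
      -- upper half plane.
      have h2 : gammaExponent (log S) (x + y * I) ≤ gammaExponent (log S) (x + S.im * I) := by
        rw [gammaExponent_log, gammaExponent_log, hconj, norm_conj, arg_conj, if_neg hs, conj_re,
          conj_im]
        have : ((x : ℂ) + S.im * I).im = S.im := by simp
        rw [this]
        nlinarith
      linarith
  refine ⟨le_max_left _ _, by rw [hSn]; exact hρ, ?_, by rw [hSn]; exact hSimn, fun y hy => ?_,
    fun x hx y hy => ?_⟩
  · rw [hSn]
    have : u.im⁻¹ * S.im = ρ := by rw [hSim]; field_simp
    calc ρ = u.im⁻¹ * S.im := this.symm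
      _ ≤ κ * S.im := by gcongr; linarith
  · set w : ℂ := c + y * I with hw
    have hwre : w.re = c := by simp [hw]
    have hwim : w.im = y := by simp [hw]
    have hwn : 0 < ‖w‖ := by
      have := re_le_norm w
      rw [hwre] at this; linarith
    have hwn2 : ‖w‖ ≤ 2 * ρ := by
      have := norm_le_abs_re_add_abs_im w
      rw [hwre, hwim, abs_of_pos hc0] at this
      linarith
    have h1 : gammaExponent (log S) w + S.re ≤ c * (Real.log ‖w‖ - Real.log ρ) := by
      rw [gammaExponent_log, hwre, hwim, hSn]
      rcases le_total 0 y with h | h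
      · have h2 := re_add_im_mul_arg_nonneg (z := w) (by rw [hwre]; exact hc0.le) (by rw [hwim]; exact h)
        rw [hwre, hwim] at h2
        rw [abs_of_nonneg h] at hy
        have h3 : 0 ≤ arg S - Real.pi / 2 ∨ arg S - Real.pi / 2 ≤ 0 := le_total _ _
        rcases h3 with h3 | h3
        · nlinarith
        · nlinarith
      · have h2 : arg w ≤ 0 := by
          rcases h.eq_or_lt with h | h
          · have : w = (c : ℝ) := by rw [hw, h]; simp
            rw [this, arg_ofReal_of_nonneg hc0.le]
          · exact (arg_neg_iff.2 (by rw [hwim]; exact h)).le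
        nlinarith
    rw [hSn]
    calc Real.exp (gammaExponent (log S) w + S.re)
        ≤ Real.exp (c * (Real.log ‖w‖ - Real.log ρ)) := Real.exp_le_exp.2 h1
      _ = (‖w‖ / ρ) ^ c := by
        rw [Real.rpow_def_of_pos (by positivity), Real.log_div hwn.ne' hρ0.ne', mul_comm]
      _ = 2 ^ c * (‖w‖ / ρ / 2) ^ c := by
        rw [← Real.mul_rpow (by norm_num) (by positivity)]
        congr 1; ring
      _ ≤ 2 ^ c * (‖w‖ / ρ / 2) ^ (3 : ℝ) := by
        gcongr 2 ^ c * ?_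
        refine Real.rpow_le_rpow_of_exponent_ge (by positivity) ?_ hc3
        rw [div_div, div_le_one (by positivity)]; linarith
      _ = 2 ^ c * (‖w‖ / ρ / 2) ^ 3 := by norm_cast
      _ ≤ κ * (‖w‖ / ρ) ^ 3 := by
        have h2 : ‖w‖ / ρ / 2 ≤ ‖w‖ / ρ := half_le_self (by positivity)
        exact mul_le_mul (by linarith) (pow_le_pow_left₀ (by positivity) h2 3) (by positivity)
          (by positivity)
  · have h1 := exp_gammaExponent_le_of_horizontal (S := S) (w := x + y * I) (B := c ^ 2)
      (by rw [hSn]; exact hρ1) (by simp [hSn, hy]; exact hSimn)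
      (fun _ => hhor x hx y hy) (by simp [hSn]; linarith)
    refine h1.trans ?_
    have : ((x : ℂ) + y * I).re = x := by simp
    rw [this]
    gcongr
    linarith

theorem exists_isSaddleRectangle {u : ℂ} (hu : ‖u‖ = 1) (hs : u ∈ slitPlane) {K : ℝ} (hK : 0 < K) :
    ∃ κ r₁ : ℝ, 0 < κ ∧ ∀ ρ ≥ r₁, ∃ c Y, IsSaddleRectangle κ K (ρ * u) c Y := by
  rcases lt_or_ge 0 u.re with hre | hre
  · exact exists_isSaddleRectangle_of_re_pos hu hre K
  rcases mem_slitPlane_iff.1 hs with h | him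
  · exact absurd h hre.not_gt
  rcases him.lt_or_gt with him | him
  · obtain ⟨κ, r₁, hκ, h⟩ := exists_isSaddleRectangle_of_re_nonpos (u := starRingEnd ℂ u)
      (by simpa using hu) (by simpa using hre) (by simpa using him) K
    refine ⟨κ, max r₁ 1, hκ, fun ρ hρ => ?_⟩
    have hρ0 : 0 < ρ := lt_of_lt_of_le one_pos (le_trans (le_max_right _ _) hρ)
    obtain ⟨c, Y, hcY⟩ := h ρ (le_trans (le_max_left _ _) hρ)
    refine ⟨c, Y, ?_⟩
    have hY : 0 < Y := by
      have h1 := hcY.le_height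
      have h2 : 0 < ‖(ρ : ℂ) * starRingEnd ℂ u‖ := by
        rw [norm_mul, norm_conj, hu, norm_real, Real.norm_of_nonneg hρ0.le]; linarith
      by_contra hY
      push Not at hY
      nlinarith
    have := hcY.conj ?_ hY (hK.trans_le hcY.le_right)
    · simpa using this
    · rw [mem_slitPlane_iff]; right
      simp [hρ0.ne', him.ne]
  · exact exists_isSaddleRectangle_of_re_nonpos hu hre him K

/-! ### The exactly solvable kernel with one Gamma function. -/

lemma gammaKernel_one (b lam w : ℂ) :
    gammaKernel (fun _ : Fin 1 => b) lam w = exp (-(lam * w)) * Gamma (b + w) := by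
  simp [gammaKernel]

lemma simpleResidue_gammaKernel_one (b lam : ℂ) (k : ℕ) :
    simpleResidue (gammaKernel (fun _ : Fin 1 => b) lam) (gammaPole (fun _ : Fin 1 => b) 0 k) =
      exp (lam * b) * ((-exp lam) ^ k / k.factorial) := by
  set p := gammaPole (fun _ : Fin 1 => b) 0 k with hp
  have hbp : b + p = -k := by rw [hp, gammaPole]; push_cast; ring
  have h1 : Tendsto (fun w : ℂ => b + w) (𝓝[≠] p) (𝓝[≠] (-k : ℂ)) := by
    refine tendsto_nhdsWithin_iff.2 ⟨?_, ?_⟩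
    · have : Tendsto (fun w : ℂ => b + w) (𝓝 p) (𝓝 (b + p)) := tendsto_id.const_add b
      rw [hbp] at this
      exact this.mono_left nhdsWithin_le_nhds
    · filter_upwards [self_mem_nhdsWithin] with w hw h
      apply hw
      rw [mem_singleton_iff, ← hbp] at h
      exact add_left_cancel h
  have h2 : Tendsto (fun w : ℂ => exp (-(lam * w))) (𝓝[≠] p) (𝓝 (exp (-(lam * p)))) :=
    (Continuous.tendsto (by fun_prop) p).mono_left nhdsWithin_le_nhds
  have h3 := h2.mul ((tendsto_natCast_add_mul_Gamma k).comp h1)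
  have e : exp (lam * b) * ((-exp lam) ^ k / k.factorial) =
      exp (-(lam * p)) * ((-1) ^ k / k.factorial) := by
    have : -(lam * p) = lam * b + k * lam := by
      have : p = -k - b := by linear_combination hbp
      rw [this]; ring
    rw [this, exp_add, exp_nat_mul, neg_pow]
    ring
  rw [e]
  refine Tendsto.limUnder_eq (h3.congr fun w => ?_)
  rw [gammaKernel_one]
  simp only [Function.comp]
  rw [← hbp]
  ring

/-- Inverse Mellin transform of the exponential: the residues `(-1)^k / k!` of Gamma reassemble the
series of `e^{-S}` with `S = exp lam`. -/
lemma tsum_simpleResidue_gammaKernel_one (b lam : ℂ) :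
    ∑ J, ∑' k, simpleResidue (gammaKernel (fun _ : Fin 1 => b) lam)
      (gammaPole (fun _ : Fin 1 => b) J k) = exp (lam * b) * exp (-exp lam) := by
  rw [Fin.sum_univ_one]
  simp only [simpleResidue_gammaKernel_one]
  rw [tsum_mul_left, exp_eq_exp_ℂ, NormedSpace.exp_eq_tsum_div]

/-- The profile `1 / (1 + (x/ρ)²)` has total integral `πρ`, so the bound does not depend on `a` and
survives the limit `a → -∞`. -/
lemma norm_threeSideIntegral_le {f : ℂ → ℂ} {a c Y ρ B₁ B₂ : ℝ} (hρ : 0 < ρ) (hac : a ≤ c)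
    (hY : 0 ≤ Y) (hB₁ : 0 ≤ B₁)
    (h₁ : ∀ x ≤ c, ∀ y : ℝ, |y| = Y → ‖f (x + y * I)‖ ≤ B₁ / (1 + (x / ρ) ^ 2))
    (h₂ : ∀ y : ℝ, |y| ≤ Y → ‖f (c + y * I)‖ ≤ B₂) :
    ‖threeSideIntegral f a c Y‖ ≤ 2 * (Real.pi * ρ * B₁) + 2 * Y * B₂ := by
  have hB_int : MeasureTheory.Integrable (fun x : ℝ => B₁ / (1 + (x / ρ) ^ 2)) := by
    simpa [div_eq_mul_inv] using! (integrable_inv_one_add_sq.comp_div hρ.ne').const_mul B₁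
  have htot : ∫ x : ℝ, B₁ / (1 + (x / ρ) ^ 2) = Real.pi * ρ * B₁ := by
    have h := MeasureTheory.Measure.integral_comp_div (fun x : ℝ => (1 + x ^ 2)⁻¹) ρ
    rw [integral_univ_inv_one_add_sq, abs_of_pos hρ, smul_eq_mul] at h
    simp only [div_eq_mul_inv B₁]
    rw [MeasureTheory.integral_const_mul, h]; ring
  have hhor : ∀ y : ℝ, |y| = Y → ‖∫ x : ℝ in a..c, f (x + y * I)‖ ≤ Real.pi * ρ * B₁ := by
    intro y hy
    refine (intervalIntegral.norm_integral_le_of_norm_le hac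
      (MeasureTheory.ae_of_all _ fun x hx => h₁ x hx.2 y hy) hB_int.intervalIntegrable).trans ?_
    rw [intervalIntegral.integral_of_le hac, ← htot]
    exact MeasureTheory.setIntegral_le_integral hB_int
      (MeasureTheory.ae_of_all _ fun x => by positivity)
  have hver : ‖I * ∫ y : ℝ in -Y..Y, f (c + y * I)‖ ≤ 2 * Y * B₂ := by
    rw [norm_mul, norm_I, one_mul]
    refine (intervalIntegral.norm_integral_le_of_norm_le_const (C := B₂) fun y hy => ?_).trans ?_
    · rw [uIoc_of_le (by linarith)] at hy
      exact h₂ y (abs_le.2 ⟨hy.1.le, hy.2⟩)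
    · rw [abs_of_nonneg (by linarith)]
      exact le_of_eq (by ring)
  refine (norm_add_le _ _).trans (add_le_add ((norm_sub_le _ _).trans ?_) hver)
  have h1 := hhor (-Y) (by rw [abs_neg, abs_of_nonneg hY])
  have h2 := hhor Y (abs_of_nonneg hY)
  linarith

lemma continuousOn_gammaKernel_rectFrame {n : ℕ} (hn : 0 < n) {α β : Fin n → ℂ} {lam : ℂ}
    (hαβ : ∀ a, α a = β a ∨ α a = β a + 1)
    {X : ℝ} (hX : ∀ a, ∀ j : ℤ, (β a).re - X / n ≠ j) {c Y : ℝ}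
    (hc : ∀ a, -(n * (β a).re) < c) (hYβ : ∀ a, n * |(β a).im| < Y) (N : ℕ) :
    ContinuousOn (gammaKernel α lam) (rectFrame (-(X + n * N)) c Y) := by
  have hn' : (0 : ℝ) < n := by exact_mod_cast hn
  intro w hw
  refine (gammaKernel_differentiableAt hn hαβ fun J k h => hw.2 ?_).continuousAt.continuousWithinAt
  have hre : w.re = -(n * ((β J).re + k)) := by rw [h, gammaPole]; simp
  have him : w.im = -(n * (β J).im) := by rw [h, gammaPole]; simp
  have h1 := hYβ J
  rw [← abs_of_pos hn', ← abs_mul, abs_lt] at h1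
  have h2 : (0 : ℝ) ≤ n * k := by positivity
  have h3 := hc J
  refine ⟨⟨lt_of_le_of_ne hw.1.1.1 fun h0 => ?_, ?_⟩, ⟨?_, ?_⟩⟩
  · rw [hre] at h0
    apply hX J (N - k)
    push_cast
    field_simp
    linarith
  · rw [hre]; linarith
  · rw [him]; linarith
  · rw [him]; linarith

/-- Only countably many values are excluded. Avoiding the integers as well lets the same rectangles
serve for `Γ(w)` and `Γ(w - 1)`. -/
lemma exists_generic_abscissa {n : ℕ} (hn : 0 < n) (x : Fin n → ℝ) :
    ∃ X : ℝ, (∀ a, ∀ j : ℤ, x a - X / n ≠ j) ∧ ∀ j : ℤ, X ≠ j := by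
  have hn' : (n : ℝ) ≠ 0 := by exact_mod_cast hn.ne'
  set B : Set ℝ := (⋃ a, range fun j : ℤ => n * (x a - j)) ∪ range fun j : ℤ => (j : ℝ) with hB
  have hBc : B.Countable :=
    (countable_iUnion fun a => countable_range _).union (countable_range _)
  obtain ⟨X, hX⟩ := (hBc.dense_compl ℝ).nonempty
  refine ⟨X, fun a j h => hX (Or.inl (mem_iUnion.2 ⟨a, j, ?_⟩)), fun j h => hX (Or.inr ⟨j, h.symm⟩)⟩
  simp only
  rw [← h]
  field_simp
  ring

/-! ### Asymptotics of the sum of residues. -/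

/-- The function `e^{-λw} ∏_a Γ(α_a + w/n)` minus the first two terms of its expansion. -/
def gammaKernelError {n : ℕ} (α : Fin n → ℂ) (A lam w : ℂ) : ℂ :=
  gammaKernel α (lam - Real.log n) w - gaussConst n * gammaKernel (fun _ : Fin 1 => 0) lam w
    - A * gammaKernel (fun _ : Fin 1 => -1) lam w

lemma exists_norm_gammaKernelError_le {n : ℕ} (hn : 0 < n) (α : Fin n → ℂ)
    (hα : ∑ a, α a = ((n : ℂ) - 1) / 2) :
    ∃ (A : ℂ) (K C : ℝ), 2 ≤ K ∧ 0 ≤ C ∧ ∀ D ≥ K, ∀ w, FarFromNegAxis D w → ∀ lam : ℂ,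
      ‖gammaKernelError α A lam w‖ ≤ C / D ^ 2 * Real.exp (gammaExponent lam w) := by
  obtain ⟨A, K, C, hK, hC, h⟩ := exists_norm_gammaKernel_sub_le hn α hα
  refine ⟨A, max K 2, C * (√(2 * Real.pi) * Real.exp 9), le_max_right _ _, by positivity,
    fun D hD w hw lam => ?_⟩
  have hD1 : K ≤ D := le_trans (le_max_left _ _) hD
  have hD2 : 2 ≤ D := le_trans (le_max_right _ _) hD
  have h1 := h D hD1 w hw (lam - Real.log n)
  rw [sub_add_cancel] at h1
  have h2 := norm_exp_mul_Gamma_le (hw.mono hD2) lam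
  rw [gammaKernelError, gammaKernel_one, gammaKernel_one, zero_add, neg_add_eq_sub]
  refine h1.trans ?_
  have h3 : (√‖w‖)⁻¹ ≤ 1 := by
    refine inv_le_one_of_one_le₀ ?_
    rw [Real.one_le_sqrt]
    linarith [hw.le_norm]
  calc _ ≤ C / D ^ 2 * (√(2 * Real.pi) * Real.exp 9 * (1 * Real.exp (gammaExponent lam w))) := by
        gcongr
        refine h2.trans ?_
        gcongr
    _ = _ := by ring

lemma tendsto_threeSideIntegral_gammaKernelError {n : ℕ} (hn : 0 < n) {α β : Fin n → ℂ}
    (hαβ : ∀ a, α a = β a ∨ α a = β a + 1) (hβ : ∀ a b, a ≠ b → ∀ k : ℤ, β a - β b ≠ k)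
    {X : ℝ} (hX : ∀ a, ∀ j : ℤ, (β a).re - X / n ≠ j) (hX' : ∀ j : ℤ, X ≠ j) {c Y : ℝ} (hY : 0 < Y)
    (hc : ∀ a, -(n * (β a).re) < c) (hYβ : ∀ a, n * |(β a).im| < Y) (hc1 : 1 < c) (A lam : ℂ) :
    Tendsto (fun N : ℕ => threeSideIntegral (gammaKernelError α A lam) (-(X + n * N)) c Y) atTop
      (𝓝 (2 * Real.pi * I * ((∑ J, ∑' k,
        simpleResidue (gammaKernel α (lam - Real.log n)) (gammaPole β J k)) -
          gaussConst n * exp (-exp lam) - A * (exp (-lam) * exp (-exp lam))))) := by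
  have hn' : (0 : ℝ) < n := by exact_mod_cast hn
  have h0 := tendsto_threeSideIntegral_gammaKernel (lam := lam - Real.log n) hn hαβ hβ hX hY.le hc
    hYβ
  -- The rectangles move by `n`, while those of the one-Gamma kernel move by `1`; the latter are
  -- used along the subsequence `n * N`.
  have hsub : Tendsto (fun N : ℕ => n * N) atTop atTop :=
    tendsto_id.const_mul_atTop' hn
  have hXb : ∀ b : ℤ, ∀ _a : Fin 1, ∀ j : ℤ, ((b : ℂ)).re - X / (1 : ℕ) ≠ j := by
    intro b _ j h
    apply hX' (b - j)
    simp at h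
    push_cast
    linarith
  have hcb : ∀ b : ℤ, -1 ≤ b → ∀ _a : Fin 1, -((1 : ℕ) * ((b : ℂ)).re) < c := by
    intro b hb _
    have : (-1 : ℝ) ≤ b := by exact_mod_cast hb
    simp
    linarith
  have hYb : ∀ b : ℤ, ∀ _a : Fin 1, ((1 : ℕ) : ℝ) * |((b : ℂ)).im| < Y := by
    intro b _
    simpa using hY
  have hone : ∀ b : ℤ, -1 ≤ b →
      Tendsto (fun N : ℕ => threeSideIntegral (gammaKernel (fun _ : Fin 1 => (b : ℂ)) lam)
        (-(X + n * N)) c Y) atTop (𝓝 (2 * Real.pi * I * (exp (lam * b) * exp (-exp lam)))) := by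
    intro b hb
    have h1 := tendsto_threeSideIntegral_gammaKernel (lam := lam) one_pos
      (α := fun _ : Fin 1 => (b : ℂ)) (β := fun _ => b) (fun _ => Or.inl rfl)
      (fun a a' h => absurd (Subsingleton.elim a a') h) (hXb b) hY.le (hcb b hb) (hYb b)
    rw [tsum_simpleResidue_gammaKernel_one] at h1
    refine (h1.comp hsub).congr fun N => ?_
    simp
  have h2 := hone 0 (by norm_num)
  have h3 := hone (-1) le_rfl
  have h4 := (h0.sub (h2.const_mul (gaussConst n : ℂ))).sub (h3.const_mul A)
  have hac : ∀ᶠ N : ℕ in atTop, -(X + n * N) ≤ c := by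
    have : Tendsto (fun N : ℕ => X + n * (N : ℝ)) atTop atTop :=
      tendsto_atTop_add_const_left _ _ (tendsto_natCast_atTop_atTop.const_mul_atTop hn')
    filter_upwards [this.eventually_ge_atTop (-c)] with N hN
    linarith
  refine (h4.congr' ?_).trans (le_of_eq ?_)
  · filter_upwards [hac] with N hN
    have c0 := continuousOn_gammaKernel_rectFrame (lam := lam - Real.log n) hn hαβ hX hc hYβ N
    have cb : ∀ b : ℤ, -1 ≤ b → ContinuousOn (gammaKernel (fun _ : Fin 1 => (b : ℂ)) lam)
        (rectFrame (-(X + n * N)) c Y) := by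
      intro b hb
      have := continuousOn_gammaKernel_rectFrame (lam := lam) one_pos
        (α := fun _ : Fin 1 => (b : ℂ)) (β := fun _ => b) (fun _ => Or.inl rfl) (hXb b)
        (hcb b hb) (hYb b) (n * N)
      simpa using this
    have c1 : ContinuousOn (fun w => (gaussConst n : ℂ) * gammaKernel (fun _ : Fin 1 => 0) lam w)
        (rectFrame (-(X + n * N)) c Y) := by
      have := cb 0 (by norm_num)
      rw [Int.cast_zero] at this
      exact continuousOn_const.mul this
    have c2 : ContinuousOn (fun w => A * gammaKernel (fun _ : Fin 1 => -1) lam w)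
        (rectFrame (-(X + n * N)) c Y) := by
      have := cb (-1) le_rfl
      rw [Int.cast_neg, Int.cast_one] at this
      exact continuousOn_const.mul this
    have e1 := threeSideIntegral_sub (c0.sub c1) c2 hN hY.le
    have e2 := threeSideIntegral_sub c0 c1 hN hY.le
    rw [threeSideIntegral_const_mul] at e1 e2
    simp only [Int.cast_zero, Int.cast_neg, Int.cast_one]
    rw [← e2]
    exact e1.symm
  · congr 1
    simp only [Int.cast_zero, Int.cast_neg, Int.cast_one, mul_zero, exp_zero, one_mul, mul_neg,
      mul_one]
    ring

/-- Asymptotics of the sum of the residues of `e^{-λw} ∏_a Γ(α_a + w/n)` in the directions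
different from the negative real axis. -/
theorem exists_norm_sum_residues_sub_le {n : ℕ} (hn : 0 < n) {α β : Fin n → ℂ}
    (hαβ : ∀ a, α a = β a ∨ α a = β a + 1) (hβ : ∀ a b, a ≠ b → ∀ k : ℤ, β a - β b ≠ k)
    (hα : ∑ a, α a = ((n : ℂ) - 1) / 2) {u : ℂ} (hu : ‖u‖ = 1) (hs : u ∈ slitPlane) :
    ∃ C r₁ : ℝ, ∀ ρ ≥ r₁, ‖(∑ J, ∑' k,
        simpleResidue (gammaKernel α (log (ρ * u) - Real.log n)) (gammaPole β J k)) -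
          gaussConst n * exp (-(ρ * u))‖ ≤ C / ρ * ‖exp (-(ρ * u))‖ := by
  have hn' : (0 : ℝ) < n := by exact_mod_cast hn
  obtain ⟨A, K, C, hK, hC, hE⟩ := exists_norm_gammaKernelError_le hn α hα
  obtain ⟨X, hX, hX'⟩ := exists_generic_abscissa hn (fun a => (β a).re)
  set M := ∑ a, ‖β a‖ with hM
  have hM0 : 0 ≤ M := Finset.sum_nonneg fun _ _ => norm_nonneg _
  have hMa : ∀ a, ‖β a‖ ≤ M := fun a =>
    Finset.single_le_sum (f := fun a => ‖β a‖) (fun _ _ => norm_nonneg _) (Finset.mem_univ a)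
  set K' := K + n * M with hK'
  have hnM : 0 ≤ n * M := by positivity
  have hKK' : K ≤ K' := by linarith
  obtain ⟨κ, r₁, hκ, hR⟩ := exists_isSaddleRectangle hu hs (K := K') (by linarith)
  -- The three summands come from the horizontal sides, the right side, and the second term `A
  -- e^{-S} / S`. The condition `ρ ≥ κ K'` forces `Y ≥ K'`, so that all poles lie below height `Y`
  -- and the error estimate applies.
  refine ⟨2 * Real.pi * C * κ ^ 3 + 16 * C * κ + ‖A‖, max r₁ (κ * K'), fun ρ hρ => ?_⟩
  obtain ⟨c, Y, hcY⟩ := hR ρ (le_trans (le_max_left _ _) hρ)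
  have hρK : κ * K' ≤ ρ := le_trans (le_max_right _ _) hρ
  have hρ0 : 0 < ρ := lt_of_lt_of_le (by have : 0 < K' := by linarith
                                         positivity) hρK
  have hρne : (ρ : ℂ) ≠ 0 := by exact_mod_cast hρ0.ne'
  set S : ℂ := ρ * u with hS
  have hSn : ‖S‖ = ρ := by rw [hS, norm_mul, hu, mul_one, norm_real, Real.norm_of_nonneg hρ0.le]
  have hS0 : S ≠ 0 := norm_pos_iff.1 (by rw [hSn]; exact hρ0)
  have hcK : K' ≤ c := hcY.le_right
  have hcρ : c ≤ ρ := hSn ▸ hcY.right_le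
  have hYρ : Y ≤ ρ := hSn ▸ hcY.height_le
  have hρY : ρ ≤ κ * Y := hSn ▸ hcY.le_height
  have hYK : K' ≤ Y := by
    have := hρK.trans hρY
    exact le_of_mul_le_mul_left this hκ
  have hc0 : 0 < c := by linarith
  have hY0 : 0 < Y := by linarith
  have hlim := tendsto_threeSideIntegral_gammaKernelError hn hαβ hβ hX hX' hY0 (c := c)
    (fun a => by
      have h1 := (neg_le_abs _).trans ((abs_re_le_norm (β a)).trans (hMa a))
      nlinarith)
    (fun a => by
      have h1 := (abs_im_le_norm (β a)).trans (hMa a)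
      nlinarith) (by linarith) A (log S)
  rw [exp_log hS0] at hlim
  set B₁ := C * κ ^ 3 / ρ ^ 2 * Real.exp (-S.re) with hB₁
  set B₂ := 8 * C * κ / ρ ^ 2 * Real.exp (-S.re) with hB₂
  have hexp : ∀ w, Real.exp (gammaExponent (log S) w) =
      Real.exp (gammaExponent (log S) w + S.re) * Real.exp (-S.re) := by
    intro w; rw [← Real.exp_add]; congr 1; ring
  have h₁ : ∀ x ≤ c, ∀ y : ℝ, |y| = Y → ‖gammaKernelError α A (log S) (x + y * I)‖ ≤
      B₁ / (1 + (x / ρ) ^ 2) := by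
    intro x hx y hy
    have hfar : FarFromNegAxis Y ((x : ℂ) + y * I) := Or.inl (by simp [hy])
    refine (hE Y (hKK'.trans hYK) _ hfar (log S)).trans ?_
    have h2 := hcY.horizontal x hx y hy
    rw [hSn] at h2
    have h3 : C / Y ^ 2 ≤ C * κ ^ 2 / ρ ^ 2 := by
      rw [div_le_div_iff₀ (by positivity) (by positivity)]
      have : ρ ^ 2 ≤ (κ * Y) ^ 2 := by gcongr
      calc C * ρ ^ 2 ≤ C * (κ * Y) ^ 2 := by gcongr
        _ = C * κ ^ 2 * Y ^ 2 := by ring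
    rw [hexp]
    calc _ ≤ C * κ ^ 2 / ρ ^ 2 * (κ / (1 + (x / ρ) ^ 2) * Real.exp (-S.re)) := by gcongr
      _ = B₁ / (1 + (x / ρ) ^ 2) := by rw [hB₁]; ring
  have h₂ : ∀ y : ℝ, |y| ≤ Y → ‖gammaKernelError α A (log S) (c + y * I)‖ ≤ B₂ := by
    intro y hy
    set w : ℂ := c + y * I with hw
    have hwre : w.re = c := by simp [hw]
    have hwim : w.im = y := by simp [hw]
    have hwn : 0 < ‖w‖ := by
      have := re_le_norm w
      rw [hwre] at this; linarith
    have hwsum := norm_le_abs_re_add_abs_im w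
    rw [hwre, hwim, abs_of_pos hc0] at hwsum
    have hwn2 : ‖w‖ ≤ 2 * ρ := by linarith
    have hfar : FarFromNegAxis (max c |y|) w := by
      rcases le_total c |y| with h | h
      · rw [max_eq_right h]; left; rw [hwim]
      · rw [max_eq_left h]; right; rw [hwre]
    -- The right side may be close to the origin, so `D` is taken comparable to `‖w‖`; the cube in
    -- `vertical` then cancels `D⁻²`.
    have hmax : ‖w‖ / 2 ≤ max c |y| := by
      have a1 := le_max_left c |y|
      have a2 := le_max_right c |y|
      linarith
    refine (hE _ (hKK'.trans (hcK.trans (le_max_left _ _))) _ hfar (log S)).trans ?_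
    have h2 := hcY.vertical y hy
    rw [hSn] at h2
    rw [hexp]
    calc _ ≤ C / (‖w‖ / 2) ^ 2 * (κ * (‖w‖ / ρ) ^ 3 * Real.exp (-S.re)) := by gcongr
      _ = 4 * C * κ * ‖w‖ / ρ ^ 3 * Real.exp (-S.re) := by field_simp; norm_num
      _ ≤ 4 * C * κ * (2 * ρ) / ρ ^ 3 * Real.exp (-S.re) := by gcongr
      _ = B₂ := by rw [hB₂]; field_simp; ring
  have hac : ∀ᶠ N : ℕ in atTop, -(X + n * N) ≤ c := by
    have : Tendsto (fun N : ℕ => X + n * (N : ℝ)) atTop atTop :=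
      tendsto_atTop_add_const_left _ _ (tendsto_natCast_atTop_atTop.const_mul_atTop hn')
    filter_upwards [this.eventually_ge_atTop (-c)] with N hN
    linarith
  have hbd := le_of_tendsto hlim.norm (hac.mono fun N hN =>
    norm_threeSideIntegral_le hρ0 hN hY0.le (by positivity) h₁ h₂)
  set T := ∑ J, ∑' k, simpleResidue (gammaKernel α (log S - Real.log n)) (gammaPole β J k) with hT
  have hexpS : ‖exp (-S)‖ = Real.exp (-S.re) := by rw [norm_exp, neg_re]
  have hpi : 1 ≤ ‖(2 * Real.pi * I : ℂ)‖ := by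
    rw [norm_mul, norm_mul, norm_I, norm_real, Real.norm_of_nonneg Real.pi_nonneg]
    have : ‖(2 : ℂ)‖ = 2 := by norm_num
    rw [this]
    linarith [Real.pi_gt_three]
  rw [norm_mul] at hbd
  have hbd2 : ‖T - gaussConst n * exp (-S) - A * (exp (-log S) * exp (-S))‖ ≤
      (2 * Real.pi * C * κ ^ 3 + 16 * C * κ) / ρ * Real.exp (-S.re) := by
    refine (le_mul_of_one_le_left (norm_nonneg _) hpi).trans (hbd.trans ?_)
    calc 2 * (Real.pi * ρ * B₁) + 2 * Y * B₂ ≤ 2 * (Real.pi * ρ * B₁) + 2 * ρ * B₂ := by gcongr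
      _ = _ := by rw [hB₁, hB₂]; field_simp; ring
  have hA : ‖A * (exp (-log S) * exp (-S))‖ = ‖A‖ / ρ * Real.exp (-S.re) := by
    rw [norm_mul, norm_mul, exp_neg, exp_log hS0, norm_inv, hSn, hexpS]; ring
  calc ‖T - gaussConst n * exp (-S)‖
      = ‖(T - gaussConst n * exp (-S) - A * (exp (-log S) * exp (-S))) +
          A * (exp (-log S) * exp (-S))‖ := by rw [sub_add_cancel]
    _ ≤ (2 * Real.pi * C * κ ^ 3 + 16 * C * κ) / ρ * Real.exp (-S.re) +
        ‖A‖ / ρ * Real.exp (-S.re) := (norm_add_le _ _).trans (add_le_add hbd2 hA.le)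
    _ = _ := by rw [hexpS]; ring

end

/-! ### Vector-valued residues and localization at the fixed points. -/

/-- Filling in the value `r` makes `(t - c) • f t` holomorphic at `c`; Cauchy's formula then shows
that the normalized circle integrals equal `r` for every small radius. -/
lemma residue_eq_of_tendsto {E : Type*} [NormedAddCommGroup E] [NormedSpace ℂ E] [CompleteSpace E]
    {f : ℂ → E} {c : ℂ} {r : E} (hf : ∀ᶠ t in 𝓝[≠] c, DifferentiableAt ℂ f t)
    (hr : Tendsto (fun t => (t - c) • f t) (𝓝[≠] c) (𝓝 r)) : residue f c = r := by
  set g : ℂ → E := Function.update (fun t => (t - c) • f t) c r with hg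
  obtain ⟨δ, hδ, hball⟩ := Metric.eventually_nhds_iff_ball.1 (eventually_nhdsWithin_iff.1 hf)
  have hgt : ∀ t, t ≠ c → g t = (t - c) • f t := fun t ht => Function.update_of_ne ht _ _
  have hgd : DifferentiableOn ℂ g (Metric.ball c δ) := by
    rw [← Complex.differentiableOn_compl_singleton_and_continuousAt_iff (Metric.ball_mem_nhds c hδ)]
    refine ⟨fun t ht => ?_, continuousAt_update_same.2 hr⟩
    have h1 : DifferentiableAt ℂ (fun t => (t - c) • f t) t :=
      (by fun_prop : DifferentiableAt ℂ (fun t => t - c) t).smul (hball t ht.1 ht.2)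
    refine (h1.congr_of_eventuallyEq ?_).differentiableWithinAt
    filter_upwards [isOpen_compl_singleton.mem_nhds ht.2] with s hs using hgt s hs
  have hpi : (2 * (Real.pi : ℂ) * Complex.I) ≠ 0 := Complex.two_pi_I_ne_zero
  refine Tendsto.limUnder_eq (tendsto_const_nhds.congr' ?_)
  filter_upwards [Ioo_mem_nhdsGT hδ] with ε hε
  have h1 := DifferentiableOn.circleIntegral_sub_inv_smul (c := c) (w := c) (R := ε)
    (hgd.mono (Metric.closedBall_subset_ball hε.2)) (Metric.mem_ball_self hε.1)
  have h2 : (∮ t in C(c, ε), f t) = ∮ t in C(c, ε), (t - c)⁻¹ • g t := by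
    refine circleIntegral.integral_congr hε.1.le fun t ht => ?_
    have htc : t ≠ c := by
      rintro rfl
      rw [Metric.mem_sphere, dist_self] at ht
      exact hε.1.ne ht
    rw [hgt t htc, inv_smul_smul₀ (sub_ne_zero.2 htc)]
  have h3 : g c = r := Function.update_self _ _ _
  rw [h2, h1, inv_smul_smul₀ hpi, h3]

namespace EqCohomology

variable {n : ℕ} (z : Fin n → ℂ)

instance : FiniteDimensional ℂ (EqCohomology z) := Module.Finite.of_basis (basis z)

instance : CompleteSpace (EqCohomology z) := FiniteDimensional.complete ℂ _

lemma eval_weightPoly (b : Fin n) : (weightPoly z).eval (z b) = 0 := by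
  rw [weightPoly, eval_prod]
  exact Finset.prod_eq_zero (Finset.mem_univ b) (by simp)

/-- The restriction to the `b`-th fixed point, `x ↦ z_b`. -/
def evalAt (b : Fin n) : EqCohomology z →ₐ[ℂ] ℂ :=
  (AdjoinRoot.liftAlgHom (weightPoly z) (Algebra.ofId ℂ ℂ) (z b) (eval_weightPoly z b) :
    AdjoinRoot (weightPoly z) →ₐ[ℂ] ℂ)

/-- The class of a polynomial in `x`. -/
def ofPoly : ℂ[X] →+* EqCohomology z := AdjoinRoot.mk (weightPoly z)

lemma evalAt_ofPoly (b : Fin n) (p : ℂ[X]) : evalAt z b (ofPoly z p) = p.eval (z b) := by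
  have : evalAt z b (ofPoly z p) = p.eval₂ (algebraMap ℂ ℂ) (z b) :=
    AdjoinRoot.lift_mk (i := algebraMap ℂ ℂ) (eval_weightPoly z b) p
  rw [this, Algebra.algebraMap_self, eval]

lemma evalAt_x (b : Fin n) : evalAt z b (x z) = z b := by
  have := evalAt_ofPoly z b X
  rwa [eval_X] at this

variable {z}

/-- Chinese remainder theorem: the factors `X - z b` are pairwise coprime, so a polynomial vanishing
at every `z b` is divisible by their product. -/
lemma eq_of_forall_evalAt (hz : Function.Injective z) {h h' : EqCohomology z}
    (heq : ∀ b, evalAt z b h = evalAt z b h') : h = h' := by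
  obtain ⟨p, rfl⟩ : ∃ p, ofPoly z p = h := AdjoinRoot.mk_surjective h
  obtain ⟨q, rfl⟩ : ∃ p, ofPoly z p = h' := AdjoinRoot.mk_surjective h'
  rw [← sub_eq_zero, ← map_sub]
  refine AdjoinRoot.mk_eq_zero.2 (Finset.prod_dvd_of_coprime ?_ fun b _ => ?_)
  · exact (pairwise_coprime_X_sub_C hz).set_pairwise _
  · rw [dvd_iff_isRoot, IsRoot.def, eval_sub, sub_eq_zero, ← evalAt_ofPoly, ← evalAt_ofPoly, heq]

variable (z) in
/-- The idempotent of the `b`-th fixed point. -/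
def idem (b : Fin n) : EqCohomology z := ofPoly z (Lagrange.basis Finset.univ z b)

lemma evalAt_idem (hz : Function.Injective z) (a b : Fin n) :
    evalAt z a (idem z b) = if a = b then 1 else 0 := by
  rw [idem, evalAt_ofPoly]
  split_ifs with h
  · rw [h, Lagrange.eval_basis_self hz.injOn (Finset.mem_univ b)]
  · exact Lagrange.eval_basis_of_ne (Ne.symm h) (Finset.mem_univ a)

lemma evalAt_sum_smul_idem (hz : Function.Injective z) (b : Fin n) (v : Fin n → ℂ) :
    evalAt z b (∑ a, v a • idem z a) = v b := by
  rw [map_sum]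
  simp [evalAt_idem hz]

lemma eq_sum_evalAt_smul_idem (hz : Function.Injective z) (h : EqCohomology z) :
    h = ∑ b, evalAt z b h • idem z b :=
  eq_of_forall_evalAt hz fun b => (evalAt_sum_smul_idem hz b fun a => evalAt z a h).symm

/-- At `x = z b` the factor `u - x` of the defining relation is one of the factors `u - z a` and
cancels: the Chern roots specialize to the other `z a`. -/
lemma evalAt_W (b : Fin n) (t : ℂ) :
    evalAt z b (W z t) = ∏ a ∈ Finset.univ.erase b, (z a - t) := by
  have h1 : (chernRootPoly z).map (evalAt z b : EqCohomology z →+* ℂ) =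
      ∏ a ∈ Finset.univ.erase b, (X - C (z a)) := by
    have h2 := congrArg (Polynomial.map (evalAt z b : EqCohomology z →+* ℂ))
      (X_sub_C_x_mul_chernRootPoly z)
    rw [Polynomial.map_mul, Polynomial.map_sub, map_X, map_C, Polynomial.map_map,
      RingHom.coe_coe, evalAt_x,
      AlgHom.comp_algebraMap, Algebra.algebraMap_self, Polynomial.map_id, weightPoly,
      ← Finset.mul_prod_erase Finset.univ _ (Finset.mem_univ b)] at h2
    exact mul_left_cancel₀ (X_sub_C_ne_zero (z b)) h2
  have h3 : evalAt z b ((chernRootPoly z).eval (algebraMap ℂ (EqCohomology z) t)) =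
      ∏ a ∈ Finset.univ.erase b, (t - z a) := by
    have h4 := eval_map_apply (evalAt z b : EqCohomology z →+* ℂ) (p := chernRootPoly z)
      (algebraMap ℂ (EqCohomology z) t)
    rw [h1, RingHom.coe_coe, AlgHom.commutes, Algebra.algebraMap_self, RingHom.id_apply,
      eval_prod] at h4
    rw [← h4]
    simp
  rw [W, map_mul, map_pow, map_neg, map_one, h3]
  have hcard : (Finset.univ.erase b).card = n - 1 := by
    rw [Finset.card_erase_of_mem (Finset.mem_univ b), Finset.card_univ, Fintype.card_fin]
  rw [← hcard, ← Finset.prod_const, ← Finset.prod_mul_distrib]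
  exact Finset.prod_congr rfl fun a _ => by ring

lemma differentiable_W (hz : Function.Injective z) : Differentiable ℂ (W z) := by
  have : W z = fun t => ∑ b, (∏ a ∈ Finset.univ.erase b, (z a - t)) • idem z b := by
    funext t
    rw [eq_sum_evalAt_smul_idem hz (W z t)]
    simp only [evalAt_W]
  rw [this]
  intro t
  refine DifferentiableAt.fun_sum fun b _ => DifferentiableAt.smul_const ?_ (idem z b)
  exact DifferentiableAt.fun_finsetProd fun a _ => by fun_prop

end EqCohomology

open EqCohomology

variable {n : ℕ} {z : Fin n → ℂ}

/-! ### The components of the Jackson integrals as sums of Gamma residues. -/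

/-- The shift `(∑ z_a + (n-1)/2) / n` of the integration variable that normalizes the parameters
of the Gamma functions. -/
def centre (z : Fin n → ℂ) : ℂ := (∑ a, z a + ((n : ℂ) - 1) / 2) / n

/-- The parameters of the Gamma functions in the `b`-th component of the Jackson integrals. -/
def componentParam (z : Fin n → ℂ) (b a : Fin n) : ℂ :=
  if a = b then z a - centre z else z a - centre z + 1

lemma componentParam_eq_or (b a : Fin n) :
    componentParam z b a = z a - centre z ∨ componentParam z b a = z a - centre z + 1 := by
  rw [componentParam]
  split_ifs
  · exact Or.inl rfl
  · exact Or.inr rfl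

lemma sum_componentParam (hn : 0 < n) (b : Fin n) :
    ∑ a, componentParam z b a = ((n : ℂ) - 1) / 2 := by
  have hn0 : (n : ℂ) ≠ 0 := by exact_mod_cast hn.ne'
  have h : ∀ a, componentParam z b a = z a - centre z + 1 - if a = b then 1 else 0 := by
    intro a
    rw [componentParam]
    split_ifs <;> ring
  simp only [h]
  rw [Finset.sum_sub_distrib, Finset.sum_add_distrib, Finset.sum_sub_distrib,
    Finset.sum_ite_eq' Finset.univ b]
  simp only [Finset.sum_const, Finset.card_univ, Fintype.card_fin, Finset.mem_univ, if_true,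
    nsmul_eq_mul, centre]
  field_simp
  ring

lemma masterFunction_eq (hn : 0 < n) (t logp : ℂ) :
    masterFunction t logp z = Complex.exp (centre z * (logp + Real.pi * Complex.I * (2 - (n : ℂ)))) *
      gammaKernel (fun a => z a - centre z) ((logp + Real.pi * Complex.I * (2 - (n : ℂ))) / n)
        (n * (centre z - t)) := by
  have hn0 : (n : ℂ) ≠ 0 := by exact_mod_cast hn.ne'
  rw [masterFunction, gammaKernel, ← mul_assoc, ← Complex.exp_add]
  congr 2
  · field_simp; ring
  · funext a
    congr 1
    field_simp
    ring

lemma sub_centre_ne (hz : ∀ a b : Fin n, a ≠ b → ∀ k : ℤ, z a - z b ≠ (k : ℂ)) (a b : Fin n)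
    (h : a ≠ b) (k : ℤ) : (z a - centre z) - (z b - centre z) ≠ k := by
  rw [sub_sub_sub_cancel_right]
  exact hz a b h k

lemma injective_of_sub_ne_intCast (hz : ∀ a b : Fin n, a ≠ b → ∀ k : ℤ, z a - z b ≠ (k : ℂ)) :
    Function.Injective z := by
  intro a b hab
  by_contra h
  exact hz a b h 0 (by rw [hab]; simp)

lemma eventually_ne_intCast (s₀ : ℂ) : ∀ᶠ s : ℂ in 𝓝[≠] s₀, ∀ j : ℤ, s ≠ (j : ℂ) := by
  have hemb : IsClosedEmbedding (fun j : ℤ => (j : ℂ)) := by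
    have := Complex.isometry_ofReal.isClosedEmbedding.comp Real.isClosedEmbedding_intCast
    convert this using 1
    funext j
    simp
  have hcl : IsClosed ((fun j : ℤ => (j : ℂ)) '' {j | (j : ℂ) ≠ s₀}) :=
    hemb.isClosedMap _ (isClosed_discrete _)
  have hmem : s₀ ∉ (fun j : ℤ => (j : ℂ)) '' {j | (j : ℂ) ≠ s₀} := by
    rintro ⟨j, hj, h⟩
    exact hj h
  filter_upwards [mem_nhdsWithin_of_mem_nhds (hcl.isOpen_compl.mem_nhds hmem),
    self_mem_nhdsWithin] with s hs hs₀ j hj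
  exact hs ⟨j, fun h => hs₀ (by rw [hj, h]; rfl), hj.symm⟩

lemma eventually_sub_ne_intCast (z : Fin n → ℂ) (c : ℂ) :
    ∀ᶠ t : ℂ in 𝓝[≠] c, ∀ a, ∀ j : ℤ, z a - t ≠ (j : ℂ) := by
  rw [eventually_all]
  intro a
  have h : Tendsto (fun t : ℂ => z a - t) (𝓝[≠] c) (𝓝[≠] (z a - c)) := by
    refine tendsto_nhdsWithin_iff.2 ⟨?_, ?_⟩
    · have : Tendsto (fun t : ℂ => z a - t) (𝓝 c) (𝓝 (z a - c)) := tendsto_id.const_sub _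
      exact this.mono_left nhdsWithin_le_nhds
    · filter_upwards [self_mem_nhdsWithin] with t ht h
      exact ht (sub_right_injective h)
  exact h.eventually (eventually_ne_intCast _)

lemma tendsto_centre_sub (hn : 0 < n) (J : Fin n) (k : ℕ) :
    Tendsto (fun t : ℂ => n * (centre z - t)) (𝓝[≠] (z J + k))
      (𝓝[≠] gammaPole (fun a => z a - centre z) J k) := by
  have hn0 : (n : ℂ) ≠ 0 := by exact_mod_cast hn.ne'
  have e : n * (centre z - (z J + k)) = gammaPole (fun a => z a - centre z) J k := by
    rw [gammaPole]; ring
  refine tendsto_nhdsWithin_iff.2 ⟨?_, ?_⟩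
  · rw [← e]
    have : Tendsto (fun t : ℂ => n * (centre z - t)) (𝓝 (z J + k))
        (𝓝 (n * (centre z - (z J + k)))) := (tendsto_id.const_sub _).const_mul _
    exact this.mono_left nhdsWithin_le_nhds
  · filter_upwards [self_mem_nhdsWithin] with t ht h
    rw [Set.mem_singleton_iff, ← e, mul_right_inj' hn0] at h
    exact ht (sub_right_injective h)

/-- The factor `-1/n` is the Jacobian of `w = n (centre z - t)`; its sign cancels the minus sign in
`PsiJ`. -/
lemma tendsto_sub_mul_masterFunction (hn : 0 < n)
    (hz : ∀ a b : Fin n, a ≠ b → ∀ k : ℤ, z a - z b ≠ (k : ℂ)) (J : Fin n) (k : ℕ) (logp : ℂ) :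
    Tendsto (fun t => (t - (z J + k)) * masterFunction t logp z) (𝓝[≠] (z J + k))
      (𝓝 (-(Complex.exp (centre z * (logp + Real.pi * Complex.I * (2 - (n : ℂ)))) / n) *
        simpleResidue (gammaKernel (fun a => z a - centre z)
          ((logp + Real.pi * Complex.I * (2 - (n : ℂ))) / n))
          (gammaPole (fun a => z a - centre z) J k))) := by
  have hn0 : (n : ℂ) ≠ 0 := by exact_mod_cast hn.ne'
  have h1 := (exists_tendsto_gammaKernel (α := fun a => z a - centre z)
    (lam := (logp + Real.pi * Complex.I * (2 - (n : ℂ))) / n) hn (fun _ => Or.inl rfl)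
    (sub_centre_ne hz) J k).comp (tendsto_centre_sub hn J k)
  refine (h1.const_mul _).congr fun t => ?_
  rw [masterFunction_eq hn, Function.comp]
  simp only [gammaPole]
  field_simp
  ring

lemma residue_masterFunction_smul_W (hn : 0 < n)
    (hz : ∀ a b : Fin n, a ≠ b → ∀ k : ℤ, z a - z b ≠ (k : ℂ)) (J : Fin n) (k : ℕ) (logp : ℂ) :
    residue (fun t : ℂ => masterFunction t logp z • W z t) (z J + k) =
      (-(Complex.exp (centre z * (logp + Real.pi * Complex.I * (2 - (n : ℂ)))) / n) *
        simpleResidue (gammaKernel (fun a => z a - centre z)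
          ((logp + Real.pi * Complex.I * (2 - (n : ℂ))) / n))
          (gammaPole (fun a => z a - centre z) J k)) • W z (z J + k) := by
  have hW := differentiable_W (injective_of_sub_ne_intCast hz)
  apply residue_eq_of_tendsto
  · filter_upwards [eventually_sub_ne_intCast z (z J + k)] with t ht
    have h1 : DifferentiableAt ℂ (fun t => masterFunction t logp z) t := by
      unfold masterFunction
      refine DifferentiableAt.mul (by fun_prop) (DifferentiableAt.fun_finsetProd fun a _ => ?_)
      have : DifferentiableAt ℂ Complex.Gamma (z a - t) :=
        Complex.differentiableAt_Gamma _ fun j h => ht a (-j) (by rw [h]; push_cast; rfl)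
      exact this.comp (f := fun t => z a - t) t (by fun_prop)
    exact h1.smul (hW t)
  · have h2 : Tendsto (W z) (𝓝[≠] (z J + k)) (𝓝 (W z (z J + k))) :=
      (hW.continuous.tendsto _).mono_left nhdsWithin_le_nhds
    refine ((tendsto_sub_mul_masterFunction hn hz J k logp).smul h2).congr fun t => ?_
    rw [smul_smul]

/-- The product from `evalAt_W` raises the argument of every Gamma function except the `b`-th by
one, and the exponential accounts for the shift from `mu` to `n L`. -/
lemma gammaKernel_componentParam (hn : 0 < n) {b : Fin n} {t mu L : ℂ} {m : ℤ}
    (hL : n * L = mu + 2 * Real.pi * Complex.I * (m - 1)) (ht : ∀ a, z a - t ≠ 0) :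
    gammaKernel (componentParam z b) L (n * (centre z - t)) =
      Complex.exp (2 * Real.pi * Complex.I * (m - 1) * (t - centre z)) *
        gammaKernel (fun a => z a - centre z) (mu / n) (n * (centre z - t)) *
        ∏ a ∈ Finset.univ.erase b, (z a - t) := by
  have hn0 : (n : ℂ) ≠ 0 := by exact_mod_cast hn.ne'
  have hw : n * (centre z - t) / n = centre z - t := by field_simp
  have hexp : Complex.exp (-(L * (n * (centre z - t)))) =
      Complex.exp (2 * Real.pi * Complex.I * (m - 1) * (t - centre z)) *
        Complex.exp (-(mu / n * (n * (centre z - t)))) := by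
    rw [← Complex.exp_add]
    congr 1
    have : mu / n * (n * (centre z - t)) = mu * (centre z - t) := by field_simp
    rw [this]
    linear_combination (t - centre z) * hL
  rw [gammaKernel, gammaKernel, hw, hexp,
    ← Finset.mul_prod_erase Finset.univ _ (Finset.mem_univ b),
    ← Finset.mul_prod_erase Finset.univ (fun a => Complex.Gamma _) (Finset.mem_univ b)]
  have h1 : ∏ a ∈ Finset.univ.erase b, Complex.Gamma (componentParam z b a + (centre z - t)) =
      (∏ a ∈ Finset.univ.erase b, (z a - t)) *
        ∏ a ∈ Finset.univ.erase b, Complex.Gamma (z a - centre z + (centre z - t)) := by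
    rw [← Finset.prod_mul_distrib]
    refine Finset.prod_congr rfl fun a ha => ?_
    rw [componentParam, if_neg (Finset.ne_of_mem_erase ha)]
    have e1 : z a - centre z + 1 + (centre z - t) = (z a - t) + 1 := by ring
    have e2 : z a - centre z + (centre z - t) = z a - t := by ring
    rw [e1, e2, Complex.Gamma_add_one _ (ht a)]
  rw [h1, componentParam, if_pos rfl]
  ring

lemma simpleResidue_gammaKernel_componentParam (hn : 0 < n)
    (hz : ∀ a b : Fin n, a ≠ b → ∀ k : ℤ, z a - z b ≠ (k : ℂ)) (b J : Fin n) (k : ℕ)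
    {mu L : ℂ} {m : ℤ} (hL : n * L = mu + 2 * Real.pi * Complex.I * (m - 1)) :
    simpleResidue (gammaKernel (componentParam z b) L) (gammaPole (fun a => z a - centre z) J k) =
      Complex.exp (2 * Real.pi * Complex.I * (m - 1) * (z J + k - centre z)) *
        simpleResidue (gammaKernel (fun a => z a - centre z) (mu / n))
          (gammaPole (fun a => z a - centre z) J k) *
        ∏ a ∈ Finset.univ.erase b, (z a - (z J + k)) := by
  have h1 := (exists_tendsto_gammaKernel (α := componentParam z b) (lam := L) hn
    (componentParam_eq_or b) (sub_centre_ne hz) J k).comp (tendsto_centre_sub hn J k)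
  have h2 := (exists_tendsto_gammaKernel (α := fun a => z a - centre z) (lam := mu / n) hn
    (fun _ => Or.inl rfl) (sub_centre_ne hz) J k).comp (tendsto_centre_sub hn J k)
  have h3 : Tendsto (fun t => Complex.exp (2 * Real.pi * Complex.I * (m - 1) * (t - centre z)))
      (𝓝[≠] (z J + k))
      (𝓝 (Complex.exp (2 * Real.pi * Complex.I * (m - 1) * (z J + k - centre z)))) :=
    (Continuous.tendsto (by fun_prop) (z J + (k : ℂ))).mono_left nhdsWithin_le_nhds
  have h4 : Tendsto (fun t => ∏ a ∈ Finset.univ.erase b, (z a - t)) (𝓝[≠] (z J + k))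
      (𝓝 (∏ a ∈ Finset.univ.erase b, (z a - (z J + k)))) :=
    (Continuous.tendsto (by fun_prop) (z J + (k : ℂ))).mono_left nhdsWithin_le_nhds
  refine tendsto_nhds_unique h1 (((h3.mul h2).mul h4).congr' ?_)
  filter_upwards [eventually_sub_ne_intCast z (z J + k)] with t ht
  simp only [Function.comp]
  rw [gammaKernel_componentParam hn hL fun a h => ht a 0 (by simpa using h)]
  ring

/-- Because `e^{2πi(m-1)k} = 1`, the exponential evaluated at `t = z J + k` depends only on `z J`.
The inverse power is exactly what the weight of `PsiJ` in `Psi` cancels. -/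
lemma evalAt_residue (hn : 0 < n)
    (hz : ∀ a b : Fin n, a ≠ b → ∀ k : ℤ, z a - z b ≠ (k : ℂ)) (b J : Fin n) (k : ℕ)
    {logp L : ℂ} {m : ℤ} (hL : n * L = logp + Real.pi * Complex.I * (2 - (n : ℂ)) +
      2 * Real.pi * Complex.I * (m - 1)) :
    evalAt z b (residue (fun t : ℂ => masterFunction t logp z • W z t) (z J + k)) =
      -(Complex.exp (centre z * (n * L)) / n) *
        (Complex.exp (2 * Real.pi * Complex.I * z J) ^ (m - 1))⁻¹ *
        simpleResidue (gammaKernel (componentParam z b) L)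
          (gammaPole (fun a => z a - centre z) J k) := by
  set mu := logp + Real.pi * Complex.I * (2 - (n : ℂ)) with hmu
  rw [residue_masterFunction_smul_W hn hz, map_smul, evalAt_W,
    simpleResidue_gammaKernel_componentParam hn hz b J k hL, smul_eq_mul, ← hmu]
  have h1 : Complex.exp (centre z * (n * L)) *
      (Complex.exp (2 * Real.pi * Complex.I * z J) ^ (m - 1))⁻¹ *
      Complex.exp (2 * Real.pi * Complex.I * (m - 1) * (z J + k - centre z)) =
      Complex.exp (centre z * mu) := by
    have h2 : Complex.exp (((m - 1) * k : ℤ) * (2 * Real.pi * Complex.I)) = 1 :=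
      Complex.exp_int_mul_two_pi_mul_I _
    have h3 : Complex.exp (centre z * mu) =
        Complex.exp (centre z * mu + ((m - 1) * k : ℤ) * (2 * Real.pi * Complex.I)) := by
      rw [Complex.exp_add, h2, mul_one]
    rw [h3, ← Complex.exp_int_mul, ← Complex.exp_neg, ← Complex.exp_add, ← Complex.exp_add, hL]
    congr 1
    push_cast
    ring
  rw [← h1]
  ring

lemma summable_residue (hn : 0 < n)
    (hz : ∀ a b : Fin n, a ≠ b → ∀ k : ℤ, z a - z b ≠ (k : ℂ)) (J : Fin n)
    {logp L : ℂ} {m : ℤ} (hL : n * L = logp + Real.pi * Complex.I * (2 - (n : ℂ)) +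
      2 * Real.pi * Complex.I * (m - 1)) :
    Summable fun k : ℕ => residue (fun t : ℂ => masterFunction t logp z • W z t) (z J + k) := by
  have h : (fun k : ℕ => residue (fun t : ℂ => masterFunction t logp z • W z t) (z J + k)) =
      fun k : ℕ => ∑ b, evalAt z b
        (residue (fun t : ℂ => masterFunction t logp z • W z t) (z J + k)) • idem z b :=
    funext fun k => eq_sum_evalAt_smul_idem (injective_of_sub_ne_intCast hz) _
  rw [h]
  refine summable_sum fun b _ => Summable.smul_const ?_ _
  simp only [evalAt_residue hn hz b J _ hL]
  exact (summable_simpleResidue_gammaKernel hn (componentParam_eq_or b) (sub_centre_ne hz) J).mul_left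
    _

/-- The components of `Ψ^m` are sums of residues of products of Gamma functions. -/
lemma evalAt_Psi (hn : 0 < n)
    (hz : ∀ a b : Fin n, a ≠ b → ∀ k : ℤ, z a - z b ≠ (k : ℂ)) (b : Fin n)
    {logp L : ℂ} {m : ℤ} (hL : n * L = logp + Real.pi * Complex.I * (2 - (n : ℂ)) +
      2 * Real.pi * Complex.I * (m - 1)) :
    evalAt z b (Psi m logp z) = Complex.exp (centre z * (n * L)) / n *
      ∑ J, ∑' k, simpleResidue (gammaKernel (componentParam z b) L)
          (gammaPole (fun a => z a - centre z) J k) := by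
  rw [Psi, PsiQ, map_sum, Finset.mul_sum]
  refine Finset.sum_congr rfl fun J _ => ?_
  have h1 : evalAt z b (∑' k : ℕ, residue (fun t : ℂ => masterFunction t logp z • W z t) (z J + k)) =
      ∑' k : ℕ, evalAt z b (residue (fun t : ℂ => masterFunction t logp z • W z t) (z J + k)) :=
    (LinearMap.toContinuousLinearMap (evalAt z b).toLinearMap).map_tsum (summable_residue hn hz J hL)
  have h2 : Complex.exp (2 * Real.pi * Complex.I * z J) ^ (m - 1) ≠ 0 :=
    zpow_ne_zero _ (Complex.exp_ne_zero _)
  rw [map_smul, PsiJ, map_neg, h1, smul_eq_mul]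
  simp only [evalAt_residue hn hz b J _ hL]
  rw [tsum_mul_left]
  field_simp

/-! ### Assembling the relative error. -/

lemma isBigO_mul_sub_one {ι : Type*} {l : Filter ι} {f g : ι → ℂ} {h : ι → ℝ}
    (hh : Tendsto h l (𝓝 0)) (hf : (fun i => f i - 1) =O[l] h) (hg : (fun i => g i - 1) =O[l] h) :
    (fun i => f i * g i - 1) =O[l] h := by
  have h1 : (fun i => (f i - 1) * (g i - 1)) =O[l] h := by
    have := hf.mul (hg.trans (hh.isBigO_one ℝ))
    simpa using this
  refine ((h1.add hf).add hg).congr_left fun i => ?_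
  ring

lemma isBigO_prod_sub_one {ι κ : Type*} {l : Filter ι} {h : ι → ℝ} (hh : Tendsto h l (𝓝 0))
    (s : Finset κ) {f : κ → ι → ℂ} (hf : ∀ k, (fun i => f k i - 1) =O[l] h) :
    (fun i => ∏ k ∈ s, f k i - 1) =O[l] h := by
  classical
  induction s using Finset.induction_on with
  | empty => simpa using isBigO_zero h l
  | insert k s hk ih =>
    simp only [Finset.prod_insert hk]
    exact isBigO_mul_sub_one hh (hf k) ih

lemma half_le_norm_add {a u : ℂ} (hu : ‖u‖ = 1) {r : ℝ} (hr : 2 * ‖a‖ + 1 ≤ r) :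
    r / 2 ≤ ‖a + r * u‖ := by
  have h0 : 0 ≤ r := by linarith [norm_nonneg a]
  have h1 : ‖(r : ℂ) * u‖ = r := by rw [norm_mul, hu, mul_one, Complex.norm_of_nonneg h0]
  have h2 := norm_sub_norm_le ((r : ℂ) * u) (-a)
  rw [norm_neg, h1, sub_neg_eq_add, add_comm _ a] at h2
  linarith

lemma isBigO_div_add_sub_one (a : ℂ) {u : ℂ} (hu : ‖u‖ = 1) :
    (fun r : ℝ => (r : ℂ) * u / (a + r * u) - 1) =O[atTop] fun r : ℝ => r⁻¹ := by
  refine IsBigO.of_bound (2 * ‖a‖) ?_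
  filter_upwards [eventually_ge_atTop (2 * ‖a‖ + 1)] with r hr
  have h0 : 0 < r := by linarith [norm_nonneg a]
  have h1 := half_le_norm_add hu hr
  have h2 : a + r * u ≠ 0 := by
    intro h
    rw [h, norm_zero] at h1
    linarith
  have h3 : (r : ℂ) * u / (a + r * u) - 1 = -a / (a + r * u) := by
    field_simp
    ring
  rw [h3, norm_div, norm_neg, Real.norm_of_nonneg (inv_nonneg.2 h0.le), div_le_iff₀ (by linarith)]
  calc ‖a‖ = 2 * ‖a‖ * r⁻¹ * (r / 2) := by field_simp
    _ ≤ 2 * ‖a‖ * r⁻¹ * ‖a + r * u‖ := by gcongr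

lemma gaussConst_div {n : ℕ} (hn : 0 < n) :
    gaussConst n / n = (2 * Real.pi) ^ (((n : ℝ) - 1) / 2) / Real.sqrt n := by
  have hp : (0 : ℝ) < 2 * Real.pi := by positivity
  have hn0 : (0 : ℝ) < n := by exact_mod_cast hn
  have h1 : (2 * Real.pi) ^ (((n : ℝ) - 1) / 2) =
      Real.sqrt (2 * Real.pi) ^ n / Real.sqrt (2 * Real.pi) := by
    rw [sub_div, Real.rpow_sub hp, ← Real.sqrt_eq_rpow, Real.sqrt_eq_rpow, ← Real.rpow_natCast,
      ← Real.rpow_mul hp.le]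
    congr 2
    ring
  rw [gaussConst, h1, div_eq_div_iff hn0.ne' (Real.sqrt_pos.2 hn0).ne', mul_assoc,
    Real.mul_self_sqrt hn0.le]

lemma gaussConst_ne_zero {n : ℕ} (hn : 0 < n) : gaussConst n ≠ 0 := by
  have hn0 : (0 : ℝ) < n := by exact_mod_cast hn
  have hp : (0 : ℝ) < 2 * Real.pi := by positivity
  rw [gaussConst]
  positivity

/-- The sum of the residues that gives the `b`-th component of `Ψ^m`, with `-ω^m s = r u`. -/
def residueSum (z : Fin n → ℂ) (b : Fin n) (L : ℂ) : ℂ :=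
  ∑ J, ∑' k, simpleResidue (gammaKernel (componentParam z b) L)
    (gammaPole (fun a => z a - centre z) J k)

lemma isBigO_residueSum_div_sub_one (hn : 0 < n)
    (hz : ∀ a b : Fin n, a ≠ b → ∀ k : ℤ, z a - z b ≠ (k : ℂ)) (b : Fin n) {θ : ℝ}
    (hθ : θ ∈ Set.Ioo (-Real.pi) Real.pi) :
    (fun r : ℝ => residueSum z b (Real.log r + θ * Complex.I) /
      (gaussConst n * Complex.exp (-(n * (r * Complex.exp (θ * Complex.I))))) - 1)
      =O[atTop] fun r : ℝ => r⁻¹ := by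
  set u := Complex.exp (θ * Complex.I) with hu
  have hu1 : ‖u‖ = 1 := Complex.norm_exp_ofReal_mul_I θ
  have hlogu : Complex.log u = θ * Complex.I := by
    rw [hu, Complex.log_exp] <;> simp [hθ.1, hθ.2.le]
  have hus : u ∈ Complex.slitPlane := by
    rw [Complex.mem_slitPlane_iff_arg]
    refine ⟨?_, Complex.exp_ne_zero _⟩
    rw [← Complex.log_im, hlogu]
    simpa using hθ.2.ne
  have hn0 : (0 : ℝ) < n := by exact_mod_cast hn
  obtain ⟨C, r₁, h⟩ := exists_norm_sum_residues_sub_le hn (componentParam_eq_or b)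
    (sub_centre_ne hz) (sum_componentParam hn b) hu1 hus
  refine IsBigO.of_bound (C / n / |gaussConst n|) ?_
  filter_upwards [eventually_gt_atTop 0, eventually_ge_atTop (r₁ / n)] with r hr hr1
  -- The saddle point is `S = n r u`, whose modulus is `n r`; the factor `n` undoes the `log n` in
  -- the comparison with one Gamma function.
  have hρ : r₁ ≤ n * r := by rwa [div_le_iff₀' hn0] at hr1
  have hL : Complex.log ((n * r : ℝ) * u) - (Real.log n : ℝ) = Real.log r + θ * Complex.I := by
    rw [Complex.log_ofReal_mul (by positivity) (Complex.exp_ne_zero _), hlogu,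
      Real.log_mul hn0.ne' hr.ne']
    push_cast
    ring
  have h1 := h (n * r) hρ
  rw [hL] at h1
  have hS : ((n * r : ℝ) : ℂ) * u = n * (r * u) := by push_cast; ring
  rw [hS] at h1
  have hg : (gaussConst n : ℂ) ≠ 0 := by exact_mod_cast gaussConst_ne_zero hn
  have he := Complex.exp_ne_zero (-(n * (r * u)))
  have h2 : residueSum z b (Real.log r + θ * Complex.I) /
      (gaussConst n * Complex.exp (-(n * (r * u)))) - 1 =
      (residueSum z b (Real.log r + θ * Complex.I) -
        gaussConst n * Complex.exp (-(n * (r * u)))) /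
      (gaussConst n * Complex.exp (-(n * (r * u)))) := by
    field_simp
  rw [h2, norm_div, norm_mul, Complex.norm_real, Real.norm_eq_abs,
    div_le_iff₀ (mul_pos (abs_pos.2 (gaussConst_ne_zero hn)) (norm_pos_iff.2 he)),
    Real.norm_of_nonneg (inv_nonneg.2 hr.le)]
  refine h1.trans (le_of_eq ?_)
  have := abs_pos.2 (gaussConst_ne_zero hn)
  field_simp

/-- The `b`-th component of the relative error. -/
def relError (z : Fin n → ℂ) (θ : ℝ) (b : Fin n) (r : ℝ) : ℂ :=
  residueSum z b (Real.log r + θ * Complex.I) /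
      (gaussConst n * Complex.exp (-(n * (r * Complex.exp (θ * Complex.I))))) *
    (∏ a ∈ Finset.univ.erase b,
      r * Complex.exp (θ * Complex.I) / (z a + r * Complex.exp (θ * Complex.I))) - 1

lemma isBigO_relError (hn : 0 < n)
    (hz : ∀ a b : Fin n, a ≠ b → ∀ k : ℤ, z a - z b ≠ (k : ℂ)) (b : Fin n) {θ : ℝ}
    (hθ : θ ∈ Set.Ioo (-Real.pi) Real.pi) :
    relError z θ b =O[atTop] fun r : ℝ => r⁻¹ :=
  isBigO_mul_sub_one tendsto_inv_atTop_zero (isBigO_residueSum_div_sub_one hn hz b hθ)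
    (isBigO_prod_sub_one tendsto_inv_atTop_zero _ fun a =>
      isBigO_div_add_sub_one (z a) (Complex.norm_exp_ofReal_mul_I θ))

/-- The exponent `∑ z_a + (n-1)/2` exceeds the one wanted by `n - 1`; the surplus power is traded
against the `n - 1` factors of `W`. -/
lemma exp_centre_mul (hn : 0 < n) (L : ℂ) :
    Complex.exp (centre z * (n * L)) =
      Complex.exp ((∑ a, z a + (1 - (n : ℂ)) / 2) * L) * Complex.exp L ^ (n - 1) := by
  have hn0 : (n : ℂ) ≠ 0 := by exact_mod_cast hn.ne'
  rw [← Complex.exp_nat_mul, ← Complex.exp_add, Nat.cast_sub hn, centre]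
  congr 1
  field_simp
  push_cast
  ring

/-- An exact identity, since `relError` is defined as the relative error in each component. `hne`
makes the components of `W` invertible so that the division is legitimate. -/
lemma Psi_eq_of_ne (hn : 0 < n)
    (hz : ∀ a b : Fin n, a ≠ b → ∀ k : ℤ, z a - z b ≠ (k : ℂ)) {θ r : ℝ} (hr : 0 < r)
    {logp : ℂ} {m : ℤ} (hL : n * (Real.log r + θ * Complex.I) =
      logp + Real.pi * Complex.I * (2 - (n : ℂ)) + 2 * Real.pi * Complex.I * (m - 1))
    (hne : ∀ a, z a + r * Complex.exp (θ * Complex.I) ≠ 0) :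
    Psi m logp z =
      ((((2 * Real.pi) ^ (((n : ℝ) - 1) / 2) / Real.sqrt n : ℝ) : ℂ)
        * Complex.exp (-(n * (r * Complex.exp (θ * Complex.I))))
        * Complex.exp ((∑ a, z a + (1 - (n : ℂ)) / 2) * (Real.log r + θ * Complex.I)))
      • (W z (-(r * Complex.exp (θ * Complex.I))) * (1 + ∑ b, relError z θ b r • idem z b)) := by
  have hinj := injective_of_sub_ne_intCast hz
  have hn0 : (n : ℂ) ≠ 0 := by exact_mod_cast hn.ne'
  have hg : (gaussConst n : ℂ) ≠ 0 := by exact_mod_cast gaussConst_ne_zero hn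
  refine eq_of_forall_evalAt hinj fun b => ?_
  have hexpL : Complex.exp (Real.log r + θ * Complex.I) = r * Complex.exp (θ * Complex.I) := by
    rw [Complex.exp_add, ← Complex.ofReal_exp, Real.exp_log hr]
  rw [evalAt_Psi hn hz b hL, map_smul, map_mul, map_add, map_one, evalAt_sum_smul_idem hinj,
    evalAt_W, exp_centre_mul hn, hexpL, ← gaussConst_div hn, relError, smul_eq_mul,
    Finset.prod_div_distrib, Finset.prod_const, Finset.card_erase_of_mem (Finset.mem_univ b),
    Finset.card_univ, Fintype.card_fin]
  have hW : ∏ a ∈ Finset.univ.erase b, (z a - -(r * Complex.exp (θ * Complex.I))) =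
      ∏ a ∈ Finset.univ.erase b, (z a + r * Complex.exp (θ * Complex.I)) := by
    simp only [sub_neg_eq_add]
  have hP : ∏ a ∈ Finset.univ.erase b, (z a + r * Complex.exp (θ * Complex.I)) ≠ 0 :=
    Finset.prod_ne_zero_iff.2 fun a _ => hne a
  have he := Complex.exp_ne_zero (-(n * (r * Complex.exp (θ * Complex.I))))
  rw [hW]
  change _ * residueSum z b (Real.log r + θ * Complex.I) = _
  push_cast
  generalize Complex.exp (-(n * (r * Complex.exp (θ * Complex.I)))) = e at *
  generalize ∏ a ∈ Finset.univ.erase b, (z a + r * Complex.exp (θ * Complex.I)) = P at *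
  generalize residueSum z b (Real.log r + θ * Complex.I) = R
  generalize ((r : ℂ) * Complex.exp (θ * Complex.I)) ^ (n - 1) = q
  generalize Complex.exp ((∑ a, z a + (1 - (n : ℂ)) / 2) * (Real.log r + θ * Complex.I)) = c
  field_simp
  ring

end QuantumPn

end

open QuantumPn in
/-- Here `log s = log r - 2πiφ` and `log p = n log s` fix the arguments of `s = r e^{-2πiφ}` and
`p = s^n`, and the power of `-ω^m s` is taken with the argument `2πm/n - π - 2πφ`. -/
theorem lemma5p1 (n : ℕ) (hn : 2 ≤ n) (z : Fin n → ℂ)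
    (hz : ∀ a b : Fin n, a ≠ b → ∀ k : ℤ, z a - z b ≠ (k : ℂ))
    (m : ℤ) (φ : ℝ) (hφ₁ : (m : ℝ) / n - 1 < φ) (hφ₂ : φ < (m : ℝ) / n) :
    ∃ E : ℝ → EqCohomology z,
      (E =O[atTop] fun r : ℝ => ((r : ℂ) * Complex.exp (-2 * Real.pi * Complex.I * φ))⁻¹) ∧
      ∀ᶠ r : ℝ in atTop,
        let logs : ℂ := Real.log r - 2 * Real.pi * Complex.I * φ
        let s : ℂ := r * Complex.exp (-2 * Real.pi * Complex.I * φ)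
        let ω : ℂ := Complex.exp (2 * Real.pi * Complex.I / n)
        let logNegωs : ℂ :=
          Real.log r + (2 * Real.pi * m / n - Real.pi - 2 * Real.pi * φ) * Complex.I
        Psi m (n * logs) z =
          ((((2 * Real.pi) ^ (((n : ℝ) - 1) / 2) / Real.sqrt n : ℝ) : ℂ)
            * Complex.exp (n * ω ^ m * s)
            * Complex.exp ((∑ a, z a + (1 - (n : ℂ)) / 2) * logNegωs))
          • (EqCohomology.W z (ω ^ m * s) * (1 + E r)) := by
  have hn' : 0 < n := by lia
  have hnR : (0 : ℝ) < n := by exact_mod_cast hn'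
  have hn0 : (n : ℂ) ≠ 0 := by exact_mod_cast hn'.ne'
  -- The argument of `-ω^m s`; the two bounds on `φ` say exactly that it lies strictly between `-π`
  -- and `π`.
  set θ : ℝ := 2 * Real.pi * m / n - Real.pi - 2 * Real.pi * φ with hθdef
  have hπ := Real.pi_pos
  have hθ : θ ∈ Set.Ioo (-Real.pi) Real.pi := by
    have e : θ = 2 * Real.pi * ((m : ℝ) / n - φ) - Real.pi := by rw [hθdef]; ring
    rw [e]
    constructor <;> nlinarith
  refine ⟨fun r => ∑ b, relError z θ b r • EqCohomology.idem z b, ?_, ?_⟩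
  · have hO : (fun r : ℝ => ∑ b, relError z θ b r • EqCohomology.idem z b)
        =O[atTop] fun r : ℝ => r⁻¹ := by
      refine IsBigO.fun_sum fun b _ => ?_
      have h1 : (fun r : ℝ => relError z θ b r • EqCohomology.idem z b) =O[atTop] relError z θ b :=
        IsBigO.of_bound ‖EqCohomology.idem z b‖
          (Eventually.of_forall fun r => by rw [norm_smul, mul_comm])
      exact h1.trans (isBigO_relError hn' hz b hθ)
    refine hO.trans (IsBigO.of_bound 1 (Eventually.of_forall fun r => ?_))
    have h1 : ‖Complex.exp (-2 * Real.pi * Complex.I * φ)‖ = 1 := by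
      rw [← Complex.norm_exp_ofReal_mul_I (-2 * Real.pi * φ)]
      congr 2
      push_cast
      ring
    rw [norm_inv, norm_inv, norm_mul, h1, mul_one, one_mul, Complex.norm_real]
  · have hev : ∀ᶠ r : ℝ in atTop, ∀ a, z a + r * Complex.exp (θ * Complex.I) ≠ 0 := by
      rw [eventually_all]
      intro a
      filter_upwards [eventually_ge_atTop (2 * ‖z a‖ + 1)] with r hr h
      have := half_le_norm_add (a := z a) (Complex.norm_exp_ofReal_mul_I θ) hr
      rw [h, norm_zero] at this
      linarith [norm_nonneg (z a)]
    filter_upwards [eventually_gt_atTop 0, hev] with r hr hne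
    intro logs s ω logNegωs
    have hlog : logNegωs = Real.log r + θ * Complex.I := by
      simp only [logNegωs, hθdef]
      push_cast
      ring
    have hs : ω ^ m * s = -(r * Complex.exp (θ * Complex.I)) := by
      have e : (θ : ℂ) * Complex.I = m * (2 * Real.pi * Complex.I / n) +
          -2 * Real.pi * Complex.I * φ - Real.pi * Complex.I := by
        rw [hθdef]
        push_cast
        ring
      rw [e, Complex.exp_sub, Complex.exp_add, Complex.exp_int_mul, Complex.exp_pi_mul_I]
      simp only [ω, s]
      ring
    -- The phase `e^{πi(2-n)}` and the weight `e^{2πi(m-1)t}` together contribute `πi(2m - n)`,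
    -- which turns `log s` into `log (-ω^m s)` after division by `n`.
    have hL : n * (Real.log r + θ * Complex.I) = n * logs +
        Real.pi * Complex.I * (2 - (n : ℂ)) + 2 * Real.pi * Complex.I * (m - 1) := by
      simp only [logs, hθdef]
      push_cast
      field_simp
      ring
    rw [Psi_eq_of_ne hn' hz hr hL hne, hlog, mul_assoc (n : ℂ) (ω ^ m) s, hs, mul_neg]
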